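/- **Definitions.** A *block* is a finite sequence of distinct symbols. An *$m$-block sequence* is a finite sequence presented as a concatenation of at most $m$ blocks (empty blocks are allowed). It has *order $s$* if it contains no (not necessarily contiguous) alternating subsequence $a\,b\,a\,b\cdots$ of length $s+2$ with $a\neq b$. Let $\lambda_s(n,m)$ be the maximum length of an order-$s$, $m$-block sequence using exactly $n$ distinct symbols. *Ackermann's function.* $a_{1,j}=2^j$ for $j\ge 1$, $a_{i,1}=2$ for $i\ge 2$, and $a_{i,j}=w\cdot a_{i-1,w}$ with $w=a_{i,j-1}$ for $i,j\ge 2$. *Derivation trees.* A derivation tree of a sequence $S$ with a given division into blocks is a rooted ordered tree whose $p$-th leaf carries the $p$-th block of $S$, whose root carries no block and whose other internal nodes carry sets of symbols. If $S$ has at most two blocks, these are the children of the root. If $S$ has $m>2$ blocks, partition it into $\hat m$ nonempty intervals $S_1,\dots,S_{\hat m}$ of consecutive blocks, $2\le\hat m<m$. Call a symbol global if it appears in at least two intervals, and local otherwise. Let $\hat S'=\beta_1\cdots\beta_{\hat m}$, where the block $\beta_q$ lists the distinct global symbols of $S_q$ in order of first appearance, and let $\check S_q$ be $S_q$ restricted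 to local symbols, with the same division into blocks. Take derivation trees $\hat{\mathcal T}$ of $\hat S'$ and $\check{\mathcal T}_q$ of $\check S_q$, identify the root of $\check{\mathcal T}_q$ with the $q$-th leaf of $\hat{\mathcal T}$ (which keeps the block $\beta_q$), and place the blocks of $S$ at the leaves. *Feathers.* For a symbol $a$ occurring at least twice in $S$, the nodes of a derivation tree $\mathcal T$ whose blocks contain $a$, with the inherited ancestor relation and order, form two trees; their roots are the left head and the right head of $a$. The left wing is the path from the left head to the leftmost leaf and the right wing is the path from the right head to the rightmost leaf. A quill is a child of a wing node that is not on the wing. A leaf is a feather of $a$ if it is the rightmost leaf descending from a quill of the left wing or the leftmost leaf descending from a quill of the right wing (a quill that is a leaf counts as its own descendant). A symbol occurring only once has no feathers. The number of feathers of $S$ with respect to $\mathcal T$ is the total over all symbols $a$. Let $\Phi_s(n,m)$ be the maximum, over all order-$s$, $m$-block sequences $S$ using exactly $n$ distinct symbols, of the minimum number of feathers of $S$ over all derivation trees of $S$. **Statement.** Let $m\ge 1$ and $n\ge 0$ be integers. If $n\ge 1$, then $$\lambda_1(n,m)=n+m-1,\qquad \lambda_2(n,m)\le 2n+m-2,$$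 with equality $\lambda_2(n,m)=2n+m-2$ when $m\ge 2$. Furthermore let $s\ge 3$, $i\ge 1$ and $c\ge s-2$ be integers, let $j\ge 1$ be the minimum integer such that $m\le a_{i,j}^{\,c}$, and let $t=\lfloor\frac{s-2}{2}\rfloor$. Then $$\lambda_3(n,m)\le(2i+2)n+(3i-2)\,cj\,(m-1)\qquad\text{if } s=3,$$ $$\lambda_s(n,m)\le\mu_{s,i}\bigl(n+(cj)^{s-2}(m-1)\bigr)\qquad\text{if } s\ge 4,$$ $$\Phi_s(n,m)\le\nu_{s,i}\bigl(n+(cj)^{s-2}(m-1)\bigr)\qquad\text{if } s\ge 5\text{ is odd},$$ where $$\mu_{s,i}=\begin{cases}2^{\binom{i+t+3}{t}}-3\,(2(i+t+1))^{t}& s\ge 4\text{ even},\\[2pt] \tfrac32\,(2(i+t+1))^{t+1}\,2^{\binom{i+t+3}{t}}& s\ge 5\text{ odd},\end{cases}\qquad \nu_{s,i}=4\cdot 2^{\binom{i+t+3}{t}}\quad(s\ge 5\text{ odd}).$$ -/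

import Mathlib

namespace DavenportSchinzel

/-! ### Davenport-Schinzel sequences and blocked sequences -/

/-- The alternating sequence `a b a b ⋯` of length `k`. -/
def alternating {α : Type*} (a b : α) : ℕ → List α
  | 0 => []
  | k + 1 => a :: alternating b a k

/-- `l` is an order-`s` Davenport-Schinzel sequence (immediate repetitions are allowed): it has no
(not necessarily contiguous) subsequence `a b a b ⋯` of length `s + 2` with `a ≠ b`. -/
def IsOrder {α : Type*} (s : ℕ) (l : List α) : Prop :=
  ∀ a b : α, a ≠ b → ¬ (alternating a b (s + 2)).Sublist l

/-- `S` is a list of at most `m` blocks (lists of distinct symbols, possibly empty), whose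
concatenation is an order-`s` Davenport-Schinzel sequence using exactly `n` distinct symbols. -/
def IsBlockedDS (s n m : ℕ) (S : List (List ℕ)) : Prop :=
  S.length ≤ m ∧ (∀ B ∈ S, B.Nodup) ∧ IsOrder s S.flatten ∧ S.flatten.toFinset.card = n

/-- The possible lengths of order-`s`, `m`-block sequences over an `n`-letter alphabet. -/
def dsLengths (s n m : ℕ) : Set ℕ :=
  {k | ∃ S : List (List ℕ), IsBlockedDS s n m S ∧ k = S.flatten.length}

/-- The extremal function `λ_s(n, m)`: the maximum length of an order-`s`, `m`-block sequence over
an `n`-letter alphabet. -/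
noncomputable def lam (s n m : ℕ) : ℕ := sSup (dsLengths s n m)

/-! ### Decomposition of a blocked sequence

A blocked sequence is partitioned into intervals of consecutive blocks, given as the list `P` of
its intervals; the sequence itself is `P.flatten`. -/

section Decomposition

variable {α : Type*} [DecidableEq α]

/-- A symbol is global if it appears in at least two intervals (otherwise it is local). -/
abbrev IsGlobal (P : List (List (List α))) (a : α) : Prop :=
  2 ≤ P.countP (fun I => decide (a ∈ I.flatten))

/-- The projection of an interval `I` of `P` onto its local symbols, with the same blocks. -/
def localPart (P : List (List (List α))) (I : List (List α)) : List (List α) :=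
  I.map fun B => B.filter fun a => decide (¬ IsGlobal P a)

/-- The distinct symbols of `l`, listed in the order of their first appearance. -/
def firsts (l : List α) : List α := l.reverse.dedup.reverse

/-- The contracted sequence: each interval is replaced by a single block that contains its global
symbols, listed in the order of first appearance. -/
def contract (P : List (List (List α))) : List (List α) :=
  P.map fun I => firsts (I.flatten.filter fun a => decide (IsGlobal P a))

end Decomposition

/-! ### Derivation trees -/

/-- Finite ordered forests, that is, lists of ordered trees. `leaf p rest` starts with the tree that
is the single leaf `p`; `node B children rest` starts with the tree whose root carries the block `B`
(as a set) and has the given list of child trees; `rest` is the list of the remaining trees. -/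
inductive Forest (α : Type*) where
  | nil : Forest α
  | leaf (p : ℕ) (rest : Forest α) : Forest α
  | node (B : Finset α) (children rest : Forest α) : Forest α

namespace Forest

variable {α : Type*}

/-- Concatenation of two lists of trees. -/
def append : Forest α → Forest α → Forest α
  | nil, G => G
  | leaf p r, G => leaf p (r.append G)
  | node B c r, G => node B c (r.append G)

/-- Adds `d` to the names of all leaves. -/
def shift (d : ℕ) : Forest α → Forest α
  | nil => nil
  | leaf p r => leaf (d + p) (r.shift d)
  | node B c r => node B (c.shift d) (r.shift d)

/-- Turns every leaf `q` into an internal node with block `β q` and list of children `F q`. -/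
def graft (β : ℕ → Finset α) (F : ℕ → Forest α) : Forest α → Forest α
  | nil => nil
  | leaf q r => node (β q) (F q) (r.graft β F)
  | node B c r => node B (c.graft β F) (r.graft β F)

/-- The leaves, from left to right. -/
def leaves : Forest α → List ℕ
  | nil => []
  | leaf p r => p :: r.leaves
  | node _ c r => c.leaves ++ r.leaves

/-- The first tree of a list of trees. -/
def first : Forest α → Forest α
  | nil => nil
  | leaf p _ => leaf p nil
  | node B c _ => node B c nil

/-- The list of all trees but the first. -/
def tail : Forest α → Forest α
  | nil => nil
  | leaf _ r => r
  | node _ _ r => r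

/-- The rightmost leaf of each tree of the list. -/
def rightmostLeaves : Forest α → List ℕ
  | nil => []
  | leaf p r => p :: r.rightmostLeaves
  | node _ c r => c.leaves.getLast?.toList ++ r.rightmostLeaves

/-- The leftmost leaf of each tree of the list. -/
def leftmostLeaves : Forest α → List ℕ
  | nil => []
  | leaf p r => p :: r.leftmostLeaves
  | node _ c r => c.leaves.head?.toList ++ r.leftmostLeaves

/-- The subtrees hanging off the path that leads from the first root to the leftmost leaf: the
first tree of each list of siblings continues the path, the others are collected. -/
def hangingOffLeft : Forest α → Forest α
  | nil => nil
  | leaf _ r => r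
  | node _ c r => c.hangingOffLeft.append r

/-- The subtrees hanging off the path that leads from the last root to the rightmost leaf: the
last tree of each list of siblings continues the path, the others are collected. -/
def hangingOffRight : Forest α → Forest α
  | nil => nil
  | leaf _ nil => nil
  | leaf p r => leaf p r.hangingOffRight
  | node _ c nil => c.hangingOffRight
  | node B c r => node B c r.hangingOffRight

end Forest

section Trees

variable {α : Type*} [DecidableEq α]

/-- The set of symbols of the `p`-th block of `S` (blocks are numbered from `0`). -/
def blockSet (S : List (List α)) (p : ℕ) : Finset α := (S.getD p []).toFinset

/-- `IsDerivationTree S T`: `T` is the list of the children of the root of a derivation tree of the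
blocked sequence `S`. The root itself carries no block; the leaf named `p` carries the `p`-th block
of `S`; the internal nodes carry the blocks written at them.

If `S` has at most two blocks then the blocks are the children of the root. Otherwise choose a
partition `P` of `S` into more than one and fewer than `S.length` nonempty intervals, a derivation
tree `That` of the contracted sequence and derivation trees `Tloc q` of the local parts of the
intervals, identify the root of `Tloc q` with the `q`-th leaf of `That` (which carries the `q`-th
block of the contracted sequence), and place the blocks of `S` at the leaves. -/
inductive IsDerivationTree : List (List α) → Forest α → Prop
  | base (S : List (List α)) (hS : S.length ≤ 2) :
      IsDerivationTree S ((List.range S.length).foldr Forest.leaf Forest.nil)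
  | comp (P : List (List (List α))) (That : Forest α) (Tloc : ℕ → Forest α)
      (hne : ∀ I ∈ P, I ≠ []) (h2 : 2 ≤ P.length) (hlt : P.length < P.flatten.length)
      (hThat : IsDerivationTree (contract P) That)
      (hTloc : ∀ (q : ℕ) (hq : q < P.length), IsDerivationTree (localPart P P[q]) (Tloc q)) :
      IsDerivationTree P.flatten
        (That.graft (blockSet (contract P))
          (fun q => (Tloc q).shift (P.take q).flatten.length))

/-- The projection of a derivation tree of `S` onto a symbol `a`, without its crown: the nodes whose
block contains `a`, with the inherited ancestor relation and left-to-right order. For a symbol that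
appears in at least two blocks this is a list of two trees, whose roots are the left head and the
right head of `a`; the crown of `a` is the common parent of the two heads. For a symbol that appears
in only one block it is a single leaf. -/
def proj (S : List (List α)) (a : α) : Forest α → Forest α
  | .nil => .nil
  | .leaf p r => if a ∈ blockSet S p then .leaf p (proj S a r) else proj S a r
  | .node B c r =>
      if a ∈ B then .node B (proj S a c) (proj S a r) else (proj S a c).append (proj S a r)

/-- The dove quills of `a`: the left wing is the path in the projected tree from the left head to
the leftmost leaf, and the quills are the children of wing nodes that are not on the wing. -/
def doveQuills (S : List (List α)) (T : Forest α) (a : α) : Forest α :=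
  (proj S a T).first.hangingOffLeft

/-- The hawk quills of `a`: the same for the path from the right head to the rightmost leaf. -/
def hawkQuills (S : List (List α)) (T : Forest α) (a : α) : Forest α :=
  (proj S a T).tail.hangingOffRight

/-- The occurrence of `a` in the `p`-th block of `S` is a feather: the `p`-th leaf is the rightmost
descendant of a dove quill or the leftmost descendant of a hawk quill. -/
def IsFeather (S : List (List α)) (T : Forest α) (a : α) (p : ℕ) : Prop :=
  p ∈ (doveQuills S T a).rightmostLeaves ∨ p ∈ (hawkQuills S T a).leftmostLeaves

instance (S : List (List α)) (T : Forest α) (a : α) (p : ℕ) : Decidable (IsFeather S T a p) := by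
  unfold IsFeather; infer_instance

/-- The number of occurrences in `S` that are feathers with respect to `T`. -/
def featherCount (S : List (List α)) (T : Forest α) : ℕ :=
  ((S.flatten.toFinset ×ˢ Finset.range S.length).filter fun x => IsFeather S T x.1 x.2).card

/-- The number of feathers of `S` with respect to a derivation tree that minimizes it. -/
noncomputable def minFeathers (S : List (List α)) : ℕ :=
  sInf {k | ∃ T : Forest α, IsDerivationTree S T ∧ k = featherCount S T}

end Trees

/-- The possible optimal feather counts of order-`s`, `m`-block sequences over an `n`-letter
alphabet. -/
def featherCounts (s n m : ℕ) : Set ℕ :=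
  {k | ∃ S : List (List ℕ), IsBlockedDS s n m S ∧ k = minFeathers S}

/-- The function `Φ_s(n, m)`: the maximum number of feathers in an order-`s`, `m`-block sequence
over an `n`-letter alphabet, with respect to an optimal derivation tree of the sequence. -/
noncomputable def Phi (s n m : ℕ) : ℕ := sSup (featherCounts s n m)

/-! ### Ackermann's function and the constants -/

/-- Ackermann's function `a_{i,j}` for `i, j ≥ 1`: `a_{1,j} = 2 ^ j`, and for `i ≥ 2`,
`a_{i,1} = 2` and `a_{i,j} = w * a_{i-1,w}` with `w = a_{i,j-1}` if `j ≥ 2`. The values at `i = 0`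
and at `j = 0`, `i ≥ 2` are irrelevant. -/
def ackermann : ℕ → ℕ → ℕ
  | 0, _ => 0
  | 1, j => 2 ^ j
  | _ + 2, 0 => 0
  | _ + 2, 1 => 2
  | i + 2, j + 2 => ackermann (i + 2) (j + 1) * ackermann (i + 1) (ackermann (i + 2) (j + 1))

/-- The least `j ≥ 1` such that `m ≤ a_{i,j} ^ c`. -/
noncomputable def ackIndex (i c m : ℕ) : ℕ := sInf {j | 1 ≤ j ∧ m ≤ ackermann i j ^ c}

/-- The constants `μ_{s,i}` (for `s ≥ 4`), with `t = ⌊(s - 2) / 2⌋`. -/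
noncomputable def mu (s i : ℕ) : ℝ :=
  let t := (s - 2) / 2
  if Even s then
    2 ^ (i + t + 3).choose t - 3 * (2 * ((i : ℝ) + t + 1)) ^ t
  else
    3 / 2 * (2 * ((i : ℝ) + t + 1)) ^ (t + 1) * 2 ^ (i + t + 3).choose t

/-- The constants `ν_{s,i}` (for odd `s ≥ 5`), with `t = ⌊(s - 2) / 2⌋`. -/
noncomputable def nu (s i : ℕ) : ℝ :=
  let t := (s - 2) / 2
  4 * 2 ^ (i + t + 3).choose t

/-! ### The extrema above are attained -/

theorem bddAbove_dsLengths (s n m : ℕ) : BddAbove (dsLengths s n m) := by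
  refine ⟨m * n, ?_⟩
  rintro k ⟨S, ⟨hm, hS, -, hn⟩, rfl⟩
  rw [List.length_flatten]
  have h : ∀ x ∈ S.map List.length, x ≤ n := by
    intro x hx
    obtain ⟨B, hB, rfl⟩ := List.mem_map.1 hx
    rw [← List.toFinset_card_of_nodup (hS B hB), ← hn]
    apply Finset.card_le_card
    intro a ha
    simp only [List.mem_toFinset, List.mem_flatten] at *
    exact ⟨B, hB, ha⟩
  have := List.sum_le_card_nsmul _ n h
  simp only [List.length_map, smul_eq_mul] at this
  exact this.trans (Nat.mul_le_mul_right _ hm)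

theorem exists_isBlockedDS {s m : ℕ} (n : ℕ) (hs : 1 ≤ s) (hm : 1 ≤ m) :
    ∃ S : List (List ℕ), IsBlockedDS s n m S := by
  refine ⟨[List.range n], by simpa using hm, by simp [List.nodup_range], ?_, ?_⟩
  swap
  · simp [List.toFinset_card_of_nodup List.nodup_range]
  intro a b _ h
  obtain ⟨k, rfl⟩ : ∃ k, s = k + 1 := ⟨s - 1, by omega⟩
  have h' := h.nodup (by simpa using List.nodup_range)
  simp [alternating] at h'

/-- `lam s n m` is a maximum, not a junk value. -/
theorem isGreatest_lam {s m : ℕ} (n : ℕ) (hs : 1 ≤ s) (hm : 1 ≤ m) :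
    IsGreatest (dsLengths s n m) (lam s n m) := by
  obtain ⟨S, hS⟩ := exists_isBlockedDS n hs hm
  exact ⟨Nat.sSup_mem ⟨_, S, hS, rfl⟩ (bddAbove_dsLengths s n m),
    fun _ h => le_csSup (bddAbove_dsLengths s n m) h⟩

/-- Every blocked sequence has a derivation tree. -/
theorem exists_isDerivationTree {α : Type*} [DecidableEq α] (S : List (List α)) :
    ∃ T, IsDerivationTree S T := by
  induction hk : S.length using Nat.strong_induction_on generalizing S with
  | _ k ih =>
    subst hk
    by_cases h : S.length ≤ 2
    · exact ⟨_, .base S h⟩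
    match S, h, ih with
    | [], h, _ => simp at h
    | [_], h, _ => simp at h
    | B₁ :: B₂ :: R, h, ih =>
      set P : List (List (List α)) := [B₁, B₂] :: R.map (fun B => [B]) with hP
      have hf : P.flatten = B₁ :: B₂ :: R := by
        have hR : ∀ R : List (List α), (R.map fun B => [B]).flatten = R := by
          intro R
          induction R with
          | nil => rfl
          | cons B R ihR => simp [ihR]
        simp [hP, hR]
      have hsm : ∀ I ∈ P, I.length ≤ 2 := by
        intro I hI
        simp only [hP, List.mem_cons, List.mem_map] at hI
        rcases hI with rfl | ⟨B, -, rfl⟩ <;> simp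
      obtain ⟨That, hT⟩ := ih (contract P).length (by simp [contract, hP]) _ rfl
      have hl : ∀ q : ℕ, ∃ T, ∀ hq : q < P.length, IsDerivationTree (localPart P P[q]) T := by
        intro q
        by_cases hq : q < P.length
        · have hb := IsDerivationTree.base (localPart P P[q])
            (by simpa [localPart] using hsm _ (List.getElem_mem hq))
          exact ⟨_, fun _ => hb⟩
        · exact ⟨.nil, fun h => absurd h hq⟩
      choose Tloc hTl using hl
      rw [← hf]
      refine ⟨_, .comp P That Tloc ?_ ?_ ?_ hT hTl⟩
      · intro I hI
        simp only [hP, List.mem_cons, List.mem_map] at hI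
        rcases hI with rfl | ⟨B, -, rfl⟩ <;> simp
      · simp only [List.length_cons] at h
        simp only [hP, List.length_cons, List.length_map]
        omega
      · rw [hf]; simp [hP]

/-- `minFeathers S` is a minimum, not a junk value. -/
theorem exists_minFeathers {α : Type*} [DecidableEq α] (S : List (List α)) :
    ∃ T, IsDerivationTree S T ∧ minFeathers S = featherCount S T := by
  obtain ⟨T, hT⟩ := exists_isDerivationTree S
  exact Nat.sInf_mem (s := {k | ∃ T : Forest α, IsDerivationTree S T ∧ k = featherCount S T})
    ⟨_, T, hT, rfl⟩

theorem bddAbove_featherCounts (s n m : ℕ) : BddAbove (featherCounts s n m) := by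
  refine ⟨n * m, ?_⟩
  rintro k ⟨S, ⟨hm, -, -, hn⟩, rfl⟩
  obtain ⟨T, -, h⟩ := exists_minFeathers S
  rw [h, featherCount]
  refine (Finset.card_filter_le _ _).trans ?_
  rw [Finset.card_product, hn, Finset.card_range]
  exact Nat.mul_le_mul_left _ hm

/-- `Phi s n m` is a maximum, not a junk value. -/
theorem isGreatest_Phi {s m : ℕ} (n : ℕ) (hs : 1 ≤ s) (hm : 1 ≤ m) :
    IsGreatest (featherCounts s n m) (Phi s n m) := by
  obtain ⟨S, hS⟩ := exists_isBlockedDS n hs hm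
  exact ⟨Nat.sSup_mem ⟨_, S, hS, rfl⟩ (bddAbove_featherCounts s n m),
    fun _ h => le_csSup (bddAbove_featherCounts s n m) h⟩

theorem le_ackermann {i : ℕ} (hi : 1 ≤ i) : ∀ {j : ℕ}, 1 ≤ j → j + 1 ≤ ackermann i j := by
  induction i, hi using Nat.le_induction with
  | base => intro j _; rw [ackermann]; exact Nat.lt_two_pow_self
  | succ i hi ih =>
    obtain ⟨i, rfl⟩ : ∃ k, i = k + 1 := ⟨i - 1, by omega⟩
    intro j hj
    induction j, hj using Nat.le_induction with
    | base => simp [ackermann]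
    | succ j hj ihj =>
      obtain ⟨j, rfl⟩ : ∃ k, j = k + 1 := ⟨j - 1, by omega⟩
      have h0 : j + 2 ≤ ackermann (i + 2) (j + 1) := ihj
      have h1 : ackermann (i + 2) (j + 1) + 1 ≤ ackermann (i + 1) (ackermann (i + 2) (j + 1)) := ih (by omega)
      have h2 : ackermann (i + 2) (j + 2) = _ := ackermann.eq_5 i j
      change j + 2 + 1 ≤ ackermann (i + 2) (j + 2)
      rw [h2]
      nlinarith

/-- For `i, c ≥ 1` the index `j` exists. -/
theorem isLeast_ackIndex {i c : ℕ} (m : ℕ) (hi : 1 ≤ i) (hc : 1 ≤ c) :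
    IsLeast {j | 1 ≤ j ∧ m ≤ ackermann i j ^ c} (ackIndex i c m) := by
  refine ⟨Nat.sInf_mem (s := {j | 1 ≤ j ∧ m ≤ ackermann i j ^ c}) ⟨m + 1, by omega, ?_⟩,
    fun _ h => Nat.sInf_le h⟩
  have h := le_ackermann hi (j := m + 1) (by omega)
  exact le_trans (by omega) (Nat.le_self_pow (by omega) _)

end DavenportSchinzel

open DavenportSchinzel

namespace DavenportSchinzel

/-! ### Subsequences and orders -/

section Order

variable {α : Type*}

/-! Orders one and two are settled directly (`lam_one`, `lam_two_le`, `lam_two`). For higher order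
`s`, cut the sequence into intervals of blocks. A local symbol stays inside one interval. A global
symbol starts in one interval, ends in another, and passes the ones it meets in between. Inside an
interval, the symbols that start there all recur later and those that end there all occurred
earlier, so either projection has order `s - 1`: an alternation gains a letter from outside. The
passing symbols occur on both sides, so their projection has order `s - 2`. The incidences of
passing symbols with intervals number at most the length of the contracted sequence minus twice the
number of global symbols. Thus a bound follows from bounds of orders `s`, `s - 1`, `s - 2` on the
intervals and of order `s` on the contracted sequence (`length_le_recurrence`).

For odd `s ≥ 5` this is too weak, and derivation trees repair it. Suppose `a` and `b` both occur at
a leaf below their left heads, neither is at its wing tip, and `a` has no feather there. Then `a b`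
is a subsequence of the part before the leaf or of the part after it
(`IsDerivationTree.dove_alternation`; `IsDerivationTree.hawk_alternation` is the mirror image). With
`s` odd, an alternation in the interval then gains three letters (`IsOrder.of_surround_odd`). So the
passing occurrences without feathers have order `s - 3`, and only the feathers are charged at order
`s - 2` (`length_le_recurrence_odd`). Feathers are few because they satisfy a recurrence without a
passing term (`feathers_le_recurrence`): a feather of the contracted sequence yields at most one
feather of the whole.

The recurrences are solved along `ackermann (i + 1) (j + 1) = w * ackermann i w` with `w = ackermann
(i + 1) j` (`ackermann_induction`). Intervals have at most `w ^ c` blocks and use the bound for `(i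
+ 1, j)`; there are at most `ackermann i w ^ c` of them and the contracted sequence uses the bound
for `(i, w)`. Its block term `(c w) ^ (s - 2)` is absorbed because it has about `w ^ c` times fewer
blocks and `c ≥ s - 2`. The growth from `(c j) ^ (s - 2)` to `(c (j + 1)) ^ (s - 2)` pays for the
other block terms. Powers of two are the base case, by halving. The inequalities required of the
coefficients rest on Pascal's rule (`exists_factors`). -/

theorem alternating_succ' (a b : α) (k : ℕ) :
    alternating a b (k + 1) = alternating a b k ++ [if Even k then a else b] := by
  induction k generalizing a b with
  | zero => simp [alternating]
  | succ k ih =>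
    rw [alternating, ih b a, alternating, List.cons_append]
    congr 3
    by_cases h : Even k <;> simp [Nat.even_add_one, h]

theorem IsOrder.sublist {s : ℕ} {l l' : List α} (h : IsOrder s l) (hl : l'.Sublist l) :
    IsOrder s l' :=
  fun a b hab h' => h a b hab (h'.trans hl)

theorem pair_sublist_or {a b : α} {l : List α} (ha : a ∈ l) (hb : b ∈ l) (hab : a ≠ b) :
    [a, b].Sublist l ∨ [b, a].Sublist l := by
  induction l with
  | nil => simp at ha
  | cons x l ih =>
    rcases List.mem_cons.1 ha with rfl | ha'
    · left
      simpa [hab.symm] using hb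
    · rcases List.mem_cons.1 hb with rfl | hb'
      · right
        simpa [hab] using ha
      · exact (ih ha' hb').imp (fun h => h.cons x) (fun h => h.cons x)

theorem pair_sublist_append {a b : α} {l l' : List α} (ha : a ∈ l) (hb : b ∈ l') :
    [a, b].Sublist (l ++ l') := by
  have := (List.singleton_sublist.2 ha).append (List.singleton_sublist.2 hb)
  simpa using this

/-- An alternation inside `l` can be prolonged by one more letter found in `r`, so the order drops
by one. -/
theorem IsOrder.of_append_right {s : ℕ} {l r : List α} (h : IsOrder (s + 1) (l ++ r))
    (hr : ∀ a ∈ l, a ∈ r) : IsOrder s l := by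
  intro a b hab h'
  have ha : a ∈ l := h'.subset (by simp [alternating])
  have hb : b ∈ l := h'.subset (by simp [alternating])
  refine h a b hab ?_
  rw [alternating_succ']
  refine h'.append (List.singleton_sublist.2 ?_)
  split_ifs
  exacts [hr _ ha, hr _ hb]

theorem IsOrder.of_append_left {s : ℕ} {l r : List α} (h : IsOrder (s + 1) (r ++ l))
    (hr : ∀ a ∈ l, a ∈ r) : IsOrder s l := by
  intro a b hab h'
  have hb : b ∈ l := h'.subset (by simp [alternating])
  refine h b a hab.symm ?_
  rw [show s + 1 + 2 = (s + 2) + 1 by ring, alternating]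
  exact (List.singleton_sublist.2 (hr _ hb)).append h'

/-- An alternation inside `l` gains one letter at each end, so the order drops by two. -/
theorem IsOrder.of_surround {s : ℕ} {l r t : List α} (h : IsOrder (s + 2) (r ++ l ++ t))
    (hr : ∀ a ∈ l, a ∈ r) (ht : ∀ a ∈ l, a ∈ t) : IsOrder s l := by
  intro a b hab h'
  have ha : a ∈ l := h'.subset (by simp [alternating])
  have hb : b ∈ l := h'.subset (by simp [alternating])
  refine h b a hab.symm ?_
  rw [show s + 2 + 2 = (s + 2 + 1) + 1 by ring, alternating_succ', alternating]
  refine ((List.singleton_sublist.2 (hr _ hb)).append h').append (List.singleton_sublist.2 ?_)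
  split_ifs
  exacts [ht _ hb, ht _ ha]

/-- For odd order `s + 3`, a subsequence `l` has order `s` if all of its symbols occur before and
after it, and any two of them occur in either order on one of the two sides. -/
theorem IsOrder.of_surround_odd {s : ℕ} {l r t : List α} (hs : Even s)
    (h : IsOrder (s + 3) (r ++ l ++ t))
    (hr : ∀ a ∈ l, a ∈ r) (ht : ∀ a ∈ l, a ∈ t)
    (hrt : ∀ a ∈ l, ∀ b ∈ l, a ≠ b → [a, b].Sublist r ∨ [a, b].Sublist t) : IsOrder s l := by
  intro a b hab h'
  have ha : a ∈ l := h'.subset (by simp [alternating])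
  have hb : b ∈ l := h'.subset (by simp [alternating])
  -- As `s` is even, the alternation in `l` starts with `a` and ends with `b`. Three letters are
  -- added: `a b` in front and `a` behind, or `b` in front and `a b` behind.
  rcases hrt a ha b hb hab with hab' | hab'
  · refine h a b hab ?_
    have h1 : Even (s + 4) := by simp [hs, parity_simps]
    have h2 : alternating a b (s + 3 + 2) = [a, b] ++ alternating a b (s + 2) ++ [a] := by
      rw [show s + 3 + 2 = (s + 4) + 1 by ring, alternating_succ']
      simp [h1, alternating]
    rw [h2]
    exact (hab'.append h').append (List.singleton_sublist.2 (ht a ha))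
  · refine h b a hab.symm ?_
    have h1 : Even (s + 3 + 1) := by simp [hs, parity_simps]
    have h2 : ¬ Even (s + 3) := by simp [hs, parity_simps]
    have h3 : alternating b a (s + 3 + 2) = [b] ++ alternating a b (s + 2) ++ [a, b] := by
      rw [show s + 3 + 2 = (s + 3 + 1) + 1 by ring, alternating_succ', alternating_succ']
      simp [h1, h2, alternating]
    rw [h3]
    exact ((List.singleton_sublist.2 (hr b hb)).append h').append hab'

end Order

/-! ### Orders one and two -/

section LowOrder

variable {α : Type*} [DecidableEq α]

/-- The first block shares at most one symbol with the rest: two shared symbols would give `a b a`.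
Each further block therefore costs at most one repeated symbol. -/
theorem length_le_of_isOrder_one (S : List (List α)) (hS : S ≠ []) (hB : ∀ B ∈ S, B.Nodup)
    (h : IsOrder 1 S.flatten) : S.flatten.length + 1 ≤ S.flatten.toFinset.card + S.length := by
  induction S with
  | nil => exact absurd rfl hS
  | cons B R ih =>
    have hBn : B.toFinset.card = B.length := List.toFinset_card_of_nodup (hB B (by simp))
    by_cases hR : R = []
    · subst hR; simp [hBn]
    have := ih hR (fun C hC => hB C (by simp [hC])) (h.sublist (by simp))
    have h1 : (B.toFinset ∩ R.flatten.toFinset).card ≤ 1 := by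
      rw [Finset.card_le_one]
      intro a ha b hb
      simp only [Finset.mem_inter, List.mem_toFinset] at ha hb
      by_contra hab
      rcases pair_sublist_or ha.1 hb.1 hab with h' | h'
      · exact h a b hab (by
          simpa [alternating] using h'.append (List.singleton_sublist.2 ha.2))
      · exact h b a (Ne.symm hab) (by
          simpa [alternating] using h'.append (List.singleton_sublist.2 hb.2))
    have h2 := Finset.card_union_add_card_inter B.toFinset R.flatten.toFinset
    simp only [List.flatten_cons, List.toFinset_append, List.length_append, List.length_cons]
    omega

/-- The number of adjacent equal pairs of a list. -/
def reps : List α → ℕ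
  | a :: b :: l => (if a = b then 1 else 0) + reps (b :: l)
  | _ => 0

theorem reps_append_ge (u v : List α) : reps u + reps v ≤ reps (u ++ v) := by
  induction u with
  | nil => simp [reps]
  | cons a u ih =>
    cases u with
    | nil => cases v <;> simp [reps]
    | cons b u => simp only [reps, List.cons_append] at ih ⊢; omega

theorem reps_append_le (u v : List α) : reps (u ++ v) ≤ reps u + reps v + 1 := by
  induction u with
  | nil => simp [reps]
  | cons a u ih =>
    cases u with
    | nil =>
      cases v with
      | nil => simp [reps]
      | cons b v => simp only [reps, List.cons_append, List.nil_append]; split_ifs <;> omega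
    | cons b u => simp only [reps, List.cons_append] at ih ⊢; omega

theorem reps_of_nodup {l : List α} (h : l.Nodup) : reps l = 0 := by
  induction l with
  | nil => rfl
  | cons a l ih =>
    cases l with
    | nil => rfl
    | cons b l =>
      simp only [reps, ih (List.nodup_cons.1 h).2]
      simp only [List.nodup_cons, List.mem_cons, not_or] at h
      simp [h.1.1]

/-- Symbols of a block are distinct, so adjacent equal symbols occur only across block boundaries.
-/
theorem reps_flatten (S : List (List α)) (hS : S ≠ []) (hB : ∀ B ∈ S, B.Nodup) :
    reps S.flatten + 1 ≤ S.length := by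
  induction S with
  | nil => exact absurd rfl hS
  | cons B R ih =>
    by_cases hR : R = []
    · subst hR; simp [reps_of_nodup (hB B (by simp))]
    have := ih hR (fun C hC => hB C (by simp [hC]))
    have h2 := reps_append_le B R.flatten
    rw [reps_of_nodup (hB B (by simp))] at h2
    simp only [List.flatten_cons, List.length_cons]
    omega

/-- Cut at the second occurrence of the first symbol, `a u a v`. The symbols of `u` are disjoint
from those of `a v`, so the two bounds for `u` and `a v` add up, and the spare one pays for the
first letter. If `u` is empty, the first letter is an adjacent repetition instead. -/
theorem length_le_of_isOrder_two_aux (l : List α) (hl : l ≠ []) (h : IsOrder 2 l) :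
    l.length + 1 ≤ 2 * l.toFinset.card + reps l := by
  induction hk : l.length using Nat.strong_induction_on generalizing l with
  | _ k ih =>
  subst hk
  match l, hl, h, ih with
  | a :: l, _, h, ih =>
  by_cases ha : a ∈ l
  · obtain ⟨u, v, hau, rfl⟩ : ∃ u v, a ∉ u ∧ l = u ++ a :: v := by
      obtain ⟨u, v, rfl, hu⟩ := List.eq_append_cons_of_mem ha
      exact ⟨u, v, hu, rfl⟩
    have hv := ih (a :: v).length (by simp) (a :: v) (by simp) (h.sublist (by simp)) rfl
    by_cases hu : u = []
    · subst hu
      simp only [List.nil_append, List.length_cons, reps, if_true] at hv ⊢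
      simp only [List.toFinset_cons, Finset.insert_idem] at hv ⊢
      omega
    · have hu' := ih u.length (by simp) u hu
        (h.sublist ((List.sublist_append_left _ _).cons a)) rfl
      -- A symbol `b` of both `u` and `v` would give the forbidden `a b a b`.
      have hd : Disjoint u.toFinset (a :: v).toFinset := by
        rw [Finset.disjoint_left]
        intro b hb hb'
        simp only [List.mem_toFinset, List.mem_cons] at hb hb'
        have hba : b ≠ a := by rintro rfl; exact hau hb
        have hbv : b ∈ v := by tauto
        refine h a b hba.symm ?_
        have := (List.singleton_sublist.2 hb).append ((List.singleton_sublist.2 hbv).cons_cons a)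
        simpa [alternating] using this
      have hc := Finset.card_union_of_disjoint hd
      rw [← List.toFinset_append] at hc
      have hr := reps_append_ge u (a :: v)
      have hr' := reps_append_ge [a] (u ++ a :: v)
      have ht : (a :: (u ++ a :: v)).toFinset = (u ++ a :: v).toFinset := by
        ext; simp
      rw [ht]
      simp only [List.singleton_append, List.length_cons, List.length_append] at *
      omega
  · have hc : (a :: l).toFinset.card = l.toFinset.card + 1 := by
      rw [List.toFinset_cons, Finset.card_insert_of_notMem (by simpa using ha)]
    by_cases hl : l = []
    · subst hl; simp
    · have := ih l.length (by simp) l hl (h.sublist (List.sublist_cons_self a l)) rfl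
      have hr' := reps_append_ge [a] l
      simp only [List.singleton_append, List.length_cons] at *
      omega

/-- One weaker than the sharp bound, so as to include sequences without symbols; such projections do
arise in the recurrences. -/
theorem length_le_of_isOrder_two (S : List (List α)) (hS : S ≠ []) (hB : ∀ B ∈ S, B.Nodup)
    (h : IsOrder 2 S.flatten) : S.flatten.length + 1 ≤ 2 * S.flatten.toFinset.card + S.length := by
  have h1 := reps_flatten S hS hB
  by_cases hl : S.flatten = []
  · simp [hl]; omega
  · have := length_le_of_isOrder_two_aux _ hl h
    omega

theorem length_le_of_isOrder_two' (S : List (List α)) (hS : S.flatten ≠ []) (hB : ∀ B ∈ S, B.Nodup)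
    (h : IsOrder 2 S.flatten) : S.flatten.length + 2 ≤ 2 * S.flatten.toFinset.card + S.length := by
  have h1 := reps_flatten S (by rintro rfl; simp at hS) hB
  have := length_le_of_isOrder_two_aux _ hS h
  omega

end LowOrder

/-! ### Extremal examples and exact values for orders one and two -/

theorem isBlockedDS_one {n m : ℕ} (hn : 1 ≤ n) (hm : 1 ≤ m) :
    IsBlockedDS 1 n m (List.range n :: List.replicate (m - 1) [n - 1]) := by
  have hf : (List.range n :: List.replicate (m - 1) [n - 1]).flatten
      = List.range n ++ List.replicate (m - 1) (n - 1) := by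
    simp
  refine ⟨by simp; omega, ?_, ?_, ?_⟩
  · intro B hB
    simp only [List.mem_cons, List.mem_replicate] at hB
    rcases hB with rfl | ⟨_, rfl⟩
    exacts [List.nodup_range, by simp]
  · rw [hf]
    intro a b hab h
    -- A nondecreasing sequence contains no `a b a`.
    have hs : (List.range n ++ List.replicate (m - 1) (n - 1)).Pairwise (· ≤ ·) := by
      rw [List.pairwise_append]
      refine ⟨List.pairwise_le_range, ?_, ?_⟩
      · simp [List.pairwise_replicate]
      · intro x hx y hy
        simp only [List.mem_range, List.mem_replicate] at hx hy
        omega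
    have := hs.sublist h
    simp [alternating] at this
    omega
  · rw [hf]
    have : (List.range n ++ List.replicate (m - 1) (n - 1)).toFinset = Finset.range n := by
      ext x; simp; omega
    rw [this, Finset.card_range]

theorem isBlockedDS_two {n m : ℕ} (hn : 1 ≤ n) (hm : 2 ≤ m) :
    IsBlockedDS 2 n m (List.range n :: (List.range n).reverse :: List.replicate (m - 2) [0]) := by
  have hf : (List.range n :: (List.range n).reverse :: List.replicate (m - 2) [0]).flatten
      = List.range n ++ ((List.range n).reverse ++ List.replicate (m - 2) 0) := by
    simp
  refine ⟨by simp; omega, ?_, ?_, ?_⟩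
  · intro B hB
    simp only [List.mem_cons, List.mem_replicate] at hB
    rcases hB with rfl | rfl | ⟨_, rfl⟩
    exacts [List.nodup_range, by simp [List.nodup_range], by simp]
  · rw [hf]
    intro a b hab h
    have h1 : (List.range n).Pairwise (· < ·) := List.pairwise_lt_range
    have h2 : ((List.range n).reverse ++ List.replicate (m - 2) 0).Pairwise (· ≥ ·) := by
      rw [List.pairwise_append]
      refine ⟨?_, ?_, ?_⟩
      · rw [List.pairwise_reverse]; exact List.pairwise_le_range
      · simp [List.pairwise_replicate]
      · intro x hx y hy
        simp only [List.mem_replicate] at hy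
        omega
    -- The sequence is increasing and then nonincreasing. Wherever `a b a b` is cut between the two
    -- pieces, one part violates the monotonicity or the two parts contradict each other.
    obtain ⟨l₁, l₂, he, hl₁, hl₂⟩ := List.sublist_append_iff.1 h
    have h1 := h1.sublist hl₁
    have h2 := h2.sublist hl₂
    simp only [alternating] at he
    match l₁, he with
    | [], he => 
      simp only [List.nil_append] at he; subst he
      simp at h2; omega
    | [_], he => 
      simp at he; obtain ⟨rfl, rfl⟩ := he
      simp at h2; omega
    | [_, _], he => 
      simp at he; obtain ⟨rfl, rfl, rfl⟩ := he
      simp at h1 h2; omega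
    | _ :: _ :: _ :: _, he => 
      simp at he; obtain ⟨rfl, rfl, rfl, _⟩ := he
      simp at h1
  · rw [hf]
    have : (List.range n ++ ((List.range n).reverse ++ List.replicate (m - 2) 0)).toFinset
        = Finset.range n := by
      ext x; simp; omega
    rw [this, Finset.card_range]

theorem exists_lam_eq {s m : ℕ} (n : ℕ) (hs : 1 ≤ s) (hm : 1 ≤ m) :
    ∃ S, IsBlockedDS s n m S ∧ lam s n m = S.flatten.length :=
  (isGreatest_lam n hs hm).1

theorem lam_one {n m : ℕ} (hn : 1 ≤ n) (hm : 1 ≤ m) : lam 1 n m + 1 = n + m := by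
  obtain ⟨S, ⟨h1, h2, h3, h4⟩, h⟩ := exists_lam_eq n le_rfl hm
  have hS : S ≠ [] := by rintro rfl; simp at h4; omega
  have hle := length_le_of_isOrder_one S hS h2 h3
  have hge := (isGreatest_lam n le_rfl hm).2 ⟨_, isBlockedDS_one hn hm, rfl⟩
  simp at hge
  omega

theorem lam_two_le {n m : ℕ} (hn : 1 ≤ n) (hm : 1 ≤ m) : lam 2 n m + 2 ≤ 2 * n + m := by
  obtain ⟨S, ⟨h1, h2, h3, h4⟩, h⟩ := exists_lam_eq n one_le_two hm
  have hS : S.flatten ≠ [] := by intro h0; simp [h0] at h4; omega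
  have hle := length_le_of_isOrder_two' S hS h2 h3
  omega

theorem lam_two {n m : ℕ} (hn : 1 ≤ n) (hm : 2 ≤ m) : lam 2 n m + 2 = 2 * n + m := by
  have hle := lam_two_le hn (one_le_two.trans hm)
  have hge := (isGreatest_lam n one_le_two (one_le_two.trans hm)).2 ⟨_, isBlockedDS_two hn hm, rfl⟩
  simp at hge
  omega

/-! ### Partition into intervals -/

/-- Greedy cutting: all intervals but the last have exactly `W` blocks and the last is nonempty,
whence the strict inequality. -/
theorem exists_chunks {α : Type*} (S : List α) {W : ℕ} (hW : 1 ≤ W) (hS : S ≠ []) :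
    ∃ P : List (List α), P.flatten = S ∧ (∀ I ∈ P, I ≠ [] ∧ I.length ≤ W) ∧
      P ≠ [] ∧ (P.length - 1) * W < S.length := by
  induction hk : S.length using Nat.strong_induction_on generalizing S with
  | _ k ih =>
  subst hk
  have hpos := List.length_pos_of_ne_nil hS
  by_cases h : S.length ≤ W
  · exact ⟨[S], by simp, by simpa [hS] using h, by simp, by simpa using hpos⟩
  · obtain ⟨P, h1, h2, h3, h4⟩ := ih (S.drop W).length (by simp; omega) (S.drop W)
      (by simp; omega) rfl
    refine ⟨S.take W :: P, by simp [h1], ?_, by simp, ?_⟩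
    · intro I hI
      rcases List.mem_cons.1 hI with rfl | hI
      · exact ⟨by simp [hS]; omega, by simp⟩
      · exact h2 I hI
    · have := List.length_pos_of_ne_nil h3
      simp only [List.length_drop, List.length_cons, Nat.add_sub_cancel] at h4 ⊢
      obtain ⟨x, hx⟩ : ∃ x, P.length = x + 1 := ⟨P.length - 1, by omega⟩
      rw [hx] at h4 ⊢
      simp only [Nat.add_sub_cancel, add_mul] at h4 ⊢
      omega

end DavenportSchinzel

namespace DavenportSchinzel

/-! ### Symbols and positions of a decomposed sequence -/

section Lists

variable {β : Type*}

theorem length_flatten_eq_sum (L : List (List β)) :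
    L.flatten.length = ∑ q ∈ Finset.range L.length, (L.getD q []).length := by
  induction L with
  | nil => simp
  | cons B L ih =>
    rw [List.length_cons, Finset.sum_range_succ', List.flatten_cons, List.length_append, ih]
    simp [add_comm]

theorem length_le_of_cover (l : List β) (p₁ p₂ p₃ p₄ : β → Bool)
    (h : ∀ a ∈ l, p₁ a ∨ p₂ a ∨ p₃ a ∨ p₄ a) :
    l.length ≤ (l.filter p₁).length + (l.filter p₂).length + (l.filter p₃).length
      + (l.filter p₄).length := by
  induction l with
  | nil => simp
  | cons a l ih =>
    have h1 := ih (fun b hb => h b (by simp [hb]))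
    have h2 := h a (by simp)
    simp only [← List.countP_eq_length_filter, List.countP_cons, List.length_cons] at h1 ⊢
    rcases h2 with h | h | h | h <;> simp only [h, if_true] <;> omega

theorem countP_eq_card (L : List β) (d : β) (p : β → Bool) :
    L.countP p = ((Finset.range L.length).filter fun q => p (L.getD q d)).card := by
  induction L with
  | nil => simp
  | cons B L ih =>
    rw [List.countP_cons, ih, Finset.card_filter, Finset.card_filter, List.length_cons,
      Finset.sum_range_succ']
    simp

theorem mem_flatten_take {L : List (List β)} {q : ℕ} {x : β} :
    x ∈ (L.take q).flatten ↔ ∃ r < q, x ∈ L.getD r [] := by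
  induction L generalizing q with
  | nil => simp
  | cons B L ih =>
    cases q with
    | zero => simp
    | succ q =>
      rw [List.take_succ_cons, List.flatten_cons, List.mem_append, ih]
      constructor
      · rintro (h | ⟨r, hr, h⟩)
        · exact ⟨0, by omega, by simpa using h⟩
        · exact ⟨r + 1, by omega, by simpa using h⟩
      · rintro ⟨r, hr, h⟩
        cases r with
        | zero => left; simpa using h
        | succ r => right; exact ⟨r, by omega, by simpa using h⟩

theorem mem_flatten_drop {L : List (List β)} {q : ℕ} {x : β} :
    x ∈ (L.drop q).flatten ↔ ∃ r, q ≤ r ∧ x ∈ L.getD r [] := by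
  induction L generalizing q with
  | nil => simp
  | cons B L ih =>
    cases q with
    | zero =>
      rw [List.drop_zero, ← List.take_length (l := B :: L), mem_flatten_take]
      constructor
      · rintro ⟨r, -, h⟩; exact ⟨r, by omega, by simpa using h⟩
      · rintro ⟨r, -, h⟩
        refine ⟨r, ?_, by simpa using h⟩
        by_contra hr
        rw [List.getD_eq_default _ _ (by simpa using hr)] at h
        simp at h
    | succ q =>
      rw [List.drop_succ_cons, ih]
      constructor
      · rintro ⟨r, hr, h⟩
        exact ⟨r + 1, by omega, by simpa using h⟩
      · rintro ⟨r, hr, h⟩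
        obtain ⟨r, rfl⟩ : ∃ r', r = r' + 1 := ⟨r - 1, by omega⟩
        exact ⟨r, by omega, by simpa using h⟩

theorem getD_mem {L : List β} {q : ℕ} {d : β} (hq : q < L.length) : L.getD q d ∈ L := by
  rw [List.getD_eq_getElem _ _ hq]; exact List.getElem_mem hq

theorem flatten_eq_take_getD_drop (L : List (List β)) (q : ℕ) :
    L.flatten = (L.take q).flatten ++ L.getD q [] ++ (L.drop (q + 1)).flatten := by
  by_cases hq : q < L.length
  · conv_lhs => rw [← List.take_append_drop q L, List.flatten_append,
      List.drop_eq_getElem_cons hq, List.flatten_cons]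
    rw [List.getD_eq_getElem _ _ hq, List.append_assoc]
  · rw [List.take_of_length_le (by omega), List.drop_eq_nil_of_le (by omega),
      List.getD_eq_default _ _ (by omega)]
    simp

open Classical in
/-- The projection of a blocked sequence onto the symbols with property `p`. -/
noncomputable def restrict (p : β → Prop) (I : List (List β)) : List (List β) :=
  I.map (List.filter fun a => decide (p a))

@[simp] theorem length_restrict (p : β → Prop) (I : List (List β)) :
    (restrict p I).length = I.length := by simp [restrict]

open Classical in
theorem flatten_restrict (p : β → Prop) (I : List (List β)) :
    (restrict p I).flatten = I.flatten.filter fun a => decide (p a) := by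
  simp [restrict, List.filter_flatten]

theorem mem_flatten_restrict {p : β → Prop} {I : List (List β)} {a : β} :
    a ∈ (restrict p I).flatten ↔ a ∈ I.flatten ∧ p a := by
  classical
  rw [flatten_restrict, List.mem_filter]
  simp

theorem flatten_restrict_sublist (p : β → Prop) (I : List (List β)) :
    (restrict p I).flatten.Sublist I.flatten := by
  rw [flatten_restrict]; exact List.filter_sublist

theorem nodup_restrict {p : β → Prop} {I : List (List β)} (h : ∀ B ∈ I, B.Nodup) :
    ∀ B ∈ restrict p I, B.Nodup := by
  intro B hB
  obtain ⟨C, hC, rfl⟩ := List.mem_map.1 hB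
  exact (h C hC).filter _

theorem flatten_flatten_eq (P : List (List (List β))) (q : ℕ) :
    P.flatten.flatten = (P.take q).flatten.flatten ++ (P.getD q []).flatten
      ++ (P.drop (q + 1)).flatten.flatten := by
  conv_lhs => rw [flatten_eq_take_getD_drop P q]
  simp

theorem flatten_map_sublist {γ : Type*} (L : List β) (f g : β → List γ)
    (h : ∀ I, (f I).Sublist (g I)) : (L.map f).flatten.Sublist (L.map g).flatten := by
  induction L with
  | nil => simp
  | cons I L ih => simpa using (h I).append ih

end Lists

section Symbols

variable {α : Type*} [DecidableEq α]

theorem firsts_sublist (l : List α) : (firsts l).Sublist l := by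
  have := (List.dedup_sublist l.reverse).reverse
  simpa [firsts] using this

theorem mem_firsts {l : List α} {a : α} : a ∈ firsts l ↔ a ∈ l := by simp [firsts]

theorem nodup_firsts (l : List α) : (firsts l).Nodup := by simp [firsts, List.nodup_dedup]

/-- The number of symbols of a blocked sequence. -/
def nsym (S : List (List α)) : ℕ := S.flatten.toFinset.card

/-- The blocks of `S` are lists of distinct symbols, and `S` has order `s`. -/
def IsBlocked (s : ℕ) (S : List (List α)) : Prop :=
  (∀ B ∈ S, B.Nodup) ∧ IsOrder s S.flatten

theorem mem_blockSet {S : List (List α)} {p : ℕ} {a : α} :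
    a ∈ blockSet S p ↔ a ∈ S.getD p [] := by simp [blockSet]

theorem mem_blockSet_restrict {p : α → Prop} {I : List (List α)} {a : α} {x : ℕ} :
    a ∈ blockSet (restrict p I) x ↔ a ∈ blockSet I x ∧ p a := by
  simp only [mem_blockSet, restrict]
  by_cases h : x < I.length
  · rw [List.getD_eq_getElem _ _ (by simpa using h), List.getD_eq_getElem _ _ h]
    simp
  · rw [List.getD_eq_default _ _ (by simpa using h), List.getD_eq_default _ _ (by simpa using h)]
    simp

theorem localPart_eq_restrict (P : List (List (List α))) (I : List (List α)) :
    localPart P I = restrict (fun a => ¬ IsGlobal P a) I := by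
  unfold localPart restrict
  congr!

variable (P : List (List (List α)))

/-- The symbols of the `q`-th interval. -/
def syms (q : ℕ) : Finset α := (P.getD q []).flatten.toFinset

/-- The global symbols. -/
def globals : Finset α := P.flatten.flatten.toFinset.filter fun a => IsGlobal P a

/-- The global symbol `a` does not occur before the `q`-th interval. -/
def StartsAt (q : ℕ) (a : α) : Prop := IsGlobal P a ∧ ∀ r < q, a ∉ syms P r

/-- The global symbol `a` does not occur after the `q`-th interval. -/
def EndsAt (q : ℕ) (a : α) : Prop := IsGlobal P a ∧ ∀ r > q, a ∉ syms P r

/-- The symbol `a` occurs both before and after the `q`-th interval. -/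
def PassesAt (q : ℕ) (a : α) : Prop :=
  IsGlobal P a ∧ (∃ r < q, a ∈ syms P r) ∧ ∃ r > q, a ∈ syms P r

variable {P}

theorem mem_syms {q : ℕ} {a : α} : a ∈ syms P q ↔ a ∈ (P.getD q []).flatten := by simp [syms]

theorem lt_of_mem_syms {q : ℕ} {a : α} (h : a ∈ syms P q) : q < P.length := by
  by_contra hq
  rw [mem_syms, List.getD_eq_default _ _ (by omega)] at h
  simp at h

theorem isGlobal_iff {a : α} : IsGlobal P a ↔ ∃ q r, q < r ∧ a ∈ syms P q ∧ a ∈ syms P r := by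
  unfold IsGlobal
  rw [countP_eq_card P [], Nat.succ_le_iff, Finset.one_lt_card]
  constructor
  · rintro ⟨q, hq, r, hr, hqr⟩
    simp only [Finset.mem_filter, decide_eq_true_eq, ← mem_syms] at hq hr
    rcases lt_or_gt_of_ne hqr with h | h
    exacts [⟨q, r, h, hq.2, hr.2⟩, ⟨r, q, h, hr.2, hq.2⟩]
  · rintro ⟨q, r, h, hq, hr⟩
    refine ⟨q, ?_, r, ?_, h.ne⟩
    · simpa only [Finset.mem_filter, Finset.mem_range, decide_eq_true_eq, ← mem_syms] using
        ⟨lt_of_mem_syms hq, hq⟩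
    · simpa only [Finset.mem_filter, Finset.mem_range, decide_eq_true_eq, ← mem_syms] using
        ⟨lt_of_mem_syms hr, hr⟩

theorem eq_of_not_isGlobal {a : α} (h : ¬ IsGlobal P a) {q r : ℕ} (hq : a ∈ syms P q)
    (hr : a ∈ syms P r) : q = r := by
  by_contra hqr
  rcases lt_or_gt_of_ne hqr with h' | h'
  exacts [h (isGlobal_iff.2 ⟨q, r, h', hq, hr⟩), h (isGlobal_iff.2 ⟨r, q, h', hr, hq⟩)]

theorem mem_flatten_flatten_take {q : ℕ} {a : α} :
    a ∈ (P.take q).flatten.flatten ↔ ∃ r < q, a ∈ syms P r := by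
  simp only [List.mem_flatten (L := (P.take q).flatten), mem_flatten_take, mem_syms,
    List.mem_flatten (L := P.getD _ _)]
  constructor
  · rintro ⟨l, ⟨r, hr, hl⟩, ha⟩; exact ⟨r, hr, l, hl, ha⟩
  · rintro ⟨r, hr, l, hl, ha⟩; exact ⟨l, ⟨r, hr, hl⟩, ha⟩

theorem mem_flatten_flatten_drop {q : ℕ} {a : α} :
    a ∈ (P.drop q).flatten.flatten ↔ ∃ r, q ≤ r ∧ a ∈ syms P r := by
  simp only [List.mem_flatten (L := (P.drop q).flatten), mem_flatten_drop, mem_syms,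
    List.mem_flatten (L := P.getD _ _)]
  constructor
  · rintro ⟨l, ⟨r, hr, hl⟩, ha⟩; exact ⟨r, hr, l, hl, ha⟩
  · rintro ⟨r, hr, l, hl, ha⟩; exact ⟨l, ⟨r, hr, hl⟩, ha⟩

theorem mem_flatten_flatten {a : α} : a ∈ P.flatten.flatten ↔ ∃ r, a ∈ syms P r := by
  rw [← List.drop_zero (l := P), mem_flatten_flatten_drop]; simp

@[simp] theorem length_contract : (contract P).length = P.length := by simp [contract]

theorem mem_blockSet_contract {q : ℕ} {a : α} :
    a ∈ blockSet (contract P) q ↔ a ∈ syms P q ∧ IsGlobal P a := by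
  rw [mem_blockSet, mem_syms]
  by_cases h : q < P.length
  · rw [List.getD_eq_getElem _ _ (by simpa using h), List.getD_eq_getElem _ _ h]
    simp only [contract, List.getElem_map, mem_firsts, List.mem_filter, decide_eq_true_eq]
  · rw [List.getD_eq_default _ _ (by simpa using h), List.getD_eq_default _ _ (by simpa using h)]
    simp

theorem mem_globals {a : α} : a ∈ globals P ↔ IsGlobal P a := by
  rw [globals, Finset.mem_filter, List.mem_toFinset, and_iff_right_iff_imp]
  intro h
  obtain ⟨q, r, -, hq, -⟩ := isGlobal_iff.1 h
  exact mem_flatten_flatten.2 ⟨q, hq⟩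

theorem mem_flatten_iff_blockSet {S : List (List α)} {a : α} :
    a ∈ S.flatten ↔ ∃ p, a ∈ blockSet S p := by
  rw [← List.drop_zero (l := S), mem_flatten_drop]; simp [mem_blockSet]

theorem nsym_contract : nsym (contract P) = (globals P).card := by
  rw [nsym]
  congr 1
  ext a
  rw [List.mem_toFinset, mem_flatten_iff_blockSet, mem_globals]
  simp only [mem_blockSet_contract]
  constructor
  · rintro ⟨q, -, h⟩; exact h
  · intro h
    obtain ⟨q, r, -, hq, -⟩ := isGlobal_iff.1 h
    exact ⟨q, hq, h⟩

theorem nodup_contract : ∀ B ∈ contract P, B.Nodup := by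
  intro B hB
  obtain ⟨C, hC, rfl⟩ := List.mem_map.1 hB
  exact nodup_firsts _

theorem contract_take_sublist (q : ℕ) :
    ((contract P).take q).flatten.Sublist (P.take q).flatten.flatten := by
  rw [contract, ← List.map_take, List.flatten_flatten]
  exact flatten_map_sublist _ _ _ fun I => (firsts_sublist _).trans List.filter_sublist

theorem contract_drop_sublist (q : ℕ) :
    ((contract P).drop q).flatten.Sublist (P.drop q).flatten.flatten := by
  rw [contract, ← List.map_drop, List.flatten_flatten]
  exact flatten_map_sublist _ _ _ fun I => (firsts_sublist _).trans List.filter_sublist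

theorem IsBlocked.contracted {s : ℕ} (h : IsBlocked s P.flatten) : IsBlocked s (contract P) := by
  refine ⟨nodup_contract, h.2.sublist ?_⟩
  have := contract_drop_sublist (P := P) 0
  simpa only [List.drop_zero] using this

omit [DecidableEq α] in
theorem IsBlocked.nodup_interval {s : ℕ} (h : IsBlocked s P.flatten) (q : ℕ) :
    ∀ B ∈ P.getD q [], B.Nodup := by
  intro B hB
  refine h.1 B ?_
  rw [flatten_eq_take_getD_drop P q]
  exact List.mem_append_left _ (List.mem_append_right _ hB)

theorem IsBlocked.restrict_local {s : ℕ} (h : IsBlocked s P.flatten) (q : ℕ) :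
    IsBlocked s (localPart P (P.getD q [])) := by
  rw [localPart_eq_restrict]
  refine ⟨nodup_restrict (h.nodup_interval q), h.2.sublist ?_⟩
  rw [flatten_flatten_eq P q]
  refine (flatten_restrict_sublist _ _).trans ?_
  simp [List.append_assoc]

/-- A global symbol absent from all earlier intervals occurs in a later one, which supplies one more
letter on the right. -/
theorem IsBlocked.restrict_startsAt {s : ℕ} (h : IsBlocked (s + 1) P.flatten) (q : ℕ) :
    IsBlocked s (restrict (StartsAt P q) (P.getD q [])) := by
  refine ⟨nodup_restrict (h.nodup_interval q), ?_⟩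
  refine IsOrder.of_append_right (r := (P.drop (q + 1)).flatten.flatten) (h.2.sublist ?_) ?_
  · rw [flatten_flatten_eq P q]
    exact ((flatten_restrict_sublist _ _).append_right _).trans (by simp [List.append_assoc])
  · intro a ha
    obtain ⟨ha, hg, hs⟩ := mem_flatten_restrict.1 ha
    obtain ⟨x, y, hxy, hx, hy⟩ := isGlobal_iff.1 hg
    refine mem_flatten_flatten_drop.2 ⟨y, ?_, hy⟩
    by_contra hc
    exact hs x (by omega) hx

theorem IsBlocked.restrict_endsAt {s : ℕ} (h : IsBlocked (s + 1) P.flatten) (q : ℕ) :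
    IsBlocked s (restrict (EndsAt P q) (P.getD q [])) := by
  refine ⟨nodup_restrict (h.nodup_interval q), ?_⟩
  refine IsOrder.of_append_left (r := (P.take q).flatten.flatten) (h.2.sublist ?_) ?_
  · rw [flatten_flatten_eq P q]
    exact ((flatten_restrict_sublist _ _).append_left _).trans (List.sublist_append_left _ _)
  · intro a ha
    obtain ⟨ha, hg, hs⟩ := mem_flatten_restrict.1 ha
    obtain ⟨x, y, hxy, hx, hy⟩ := isGlobal_iff.1 hg
    refine mem_flatten_flatten_take.2 ⟨x, ?_, hx⟩
    by_contra hc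
    exact hs y (by omega) hy

omit [DecidableEq α] in
theorem surround_sublist (p : α → Prop) (q : ℕ) :
    ((P.take q).flatten.flatten ++ (restrict p (P.getD q [])).flatten
      ++ (P.drop (q + 1)).flatten.flatten).Sublist P.flatten.flatten := by
  conv_rhs => rw [flatten_flatten_eq P q]
  exact ((flatten_restrict_sublist _ _).append_left _).append_right _

/-- Every such symbol occurs on both sides of the interval, so alternations gain a letter at each
end. -/
theorem IsBlocked.restrict_passesAt {s : ℕ} (h : IsBlocked (s + 2) P.flatten) (q : ℕ) :
    IsBlocked s (restrict (PassesAt P q) (P.getD q [])) := by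
  refine ⟨nodup_restrict (h.nodup_interval q), ?_⟩
  refine IsOrder.of_surround (h.2.sublist (surround_sublist _ q)) ?_ ?_
  · intro a ha
    obtain ⟨ha, hg, h1, h2⟩ := mem_flatten_restrict.1 ha
    exact mem_flatten_flatten_take.2 h1
  · intro a ha
    obtain ⟨ha, hg, h1, x, hx, hx'⟩ := mem_flatten_restrict.1 ha
    exact mem_flatten_flatten_drop.2 ⟨x, hx, hx'⟩

/-! ### Counting symbols of the parts -/

open Classical in
theorem nsym_restrict (p : α → Prop) (q : ℕ) :
    nsym (restrict p (P.getD q [])) = ((syms P q).filter p).card := by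
  rw [nsym]
  congr 1
  ext a
  rw [List.mem_toFinset, mem_flatten_restrict, Finset.mem_filter, mem_syms]

/-- If a symbol is selected in at most one interval, the selected sets are disjoint. This serves the
local, the starting and the ending symbols. -/
theorem sum_nsym_le_card {p : ℕ → α → Prop} {G : Finset α}
    (hG : ∀ q, ∀ a ∈ syms P q, p q a → a ∈ G)
    (h : ∀ q r, ∀ a, a ∈ syms P q → a ∈ syms P r → p q a → p r a → q = r) :
    ∑ q ∈ Finset.range P.length, nsym (restrict (p q) (P.getD q [])) ≤ G.card := by
  classical
  simp only [nsym_restrict]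
  rw [← Finset.card_biUnion]
  · refine Finset.card_le_card fun a ha => ?_
    obtain ⟨q, -, ha⟩ := Finset.mem_biUnion.1 ha
    obtain ⟨h1, h2⟩ := Finset.mem_filter.1 ha
    exact hG q a h1 h2
  · intro q _ r _ hqr
    refine Finset.disjoint_left.2 fun a ha hb => ?_
    obtain ⟨h1, h2⟩ := Finset.mem_filter.1 ha
    obtain ⟨h3, h4⟩ := Finset.mem_filter.1 hb
    exact hqr (h q r a h1 h3 h2 h4)

theorem startsAt_unique {q r : ℕ} {a : α} (hq : a ∈ syms P q) (hr : a ∈ syms P r)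
    (h : StartsAt P q a) (h' : StartsAt P r a) : q = r := by
  by_contra hqr
  rcases lt_or_gt_of_ne hqr with hl | hl
  exacts [h'.2 _ hl hq, h.2 _ hl hr]

theorem endsAt_unique {q r : ℕ} {a : α} (hq : a ∈ syms P q) (hr : a ∈ syms P r)
    (h : EndsAt P q a) (h' : EndsAt P r a) : q = r := by
  by_contra hqr
  rcases lt_or_gt_of_ne hqr with hl | hl
  exacts [h.2 _ hl hr, h'.2 _ hl hq]

theorem sum_nsym_startsAt_le :
    ∑ q ∈ Finset.range P.length, nsym (restrict (StartsAt P q) (P.getD q [])) ≤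
      (globals P).card :=
  sum_nsym_le_card (fun _ _ _ h => mem_globals.2 h.1) fun _ _ _ => startsAt_unique

theorem sum_nsym_endsAt_le :
    ∑ q ∈ Finset.range P.length, nsym (restrict (EndsAt P q) (P.getD q [])) ≤
      (globals P).card :=
  sum_nsym_le_card (fun _ _ _ h => mem_globals.2 h.1) fun _ _ _ => endsAt_unique

theorem sum_nsym_local_le :
    ∑ q ∈ Finset.range P.length, nsym (localPart P (P.getD q [])) + (globals P).card ≤
      nsym P.flatten := by
  have h := sum_nsym_le_card (P := P) (p := fun _ a => ¬ IsGlobal P a)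
    (G := P.flatten.flatten.toFinset.filter fun a => ¬ IsGlobal P a)
    (fun q a ha h => by
      rw [Finset.mem_filter, List.mem_toFinset]
      exact ⟨mem_flatten_flatten.2 ⟨q, ha⟩, h⟩)
    (fun q r a hq hr h _ => eq_of_not_isGlobal h hq hr)
  have h2 := Finset.card_filter_add_card_filter_not (s := P.flatten.flatten.toFinset)
    (fun a => IsGlobal P a)
  simp only [localPart_eq_restrict, nsym, globals] at *
  omega

theorem card_globals_le_sum_startsAt :
    (globals P).card ≤
      ∑ q ∈ Finset.range P.length, nsym (restrict (StartsAt P q) (P.getD q [])) := by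
  classical
  simp only [nsym_restrict]
  refine le_trans (Finset.card_le_card fun a ha => ?_) Finset.card_biUnion_le
  have hg := mem_globals.1 ha
  obtain ⟨x, -, -, hx, -⟩ := isGlobal_iff.1 hg
  have hex : ∃ x, a ∈ syms P x := ⟨x, hx⟩
  refine Finset.mem_biUnion.2 ⟨Nat.find hex, Finset.mem_range.2 (lt_of_mem_syms (Nat.find_spec hex)),
    Finset.mem_filter.2 ⟨Nat.find_spec hex, hg, fun r hr => Nat.find_min hex hr⟩⟩

theorem card_globals_le_sum_endsAt :
    (globals P).card ≤
      ∑ q ∈ Finset.range P.length, nsym (restrict (EndsAt P q) (P.getD q [])) := by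
  classical
  simp only [nsym_restrict]
  refine le_trans (Finset.card_le_card fun a ha => ?_) Finset.card_biUnion_le
  have hg := mem_globals.1 ha
  obtain ⟨x, -, -, hx, -⟩ := isGlobal_iff.1 hg
  set T := (Finset.range P.length).filter fun x => a ∈ syms P x with hT
  have hne : T.Nonempty := ⟨x, by simp [hT, lt_of_mem_syms hx, hx]⟩
  have hmax := T.max'_mem hne
  replace hmax := Finset.mem_filter.1 hmax
  refine Finset.mem_biUnion.2 ⟨T.max' hne, hmax.1, Finset.mem_filter.2 ⟨hmax.2, hg, ?_⟩⟩
  intro r hr hc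
  have : r ∈ T := by simp [hT, lt_of_mem_syms hc, hc]
  exact absurd (T.le_max' r this) (by omega)

/-- Each block of the contracted sequence consists of the starting, ending and passing symbols of
its interval, and these classes are disjoint. Every global symbol starts once and ends once, which
takes away twice the number of global symbols. -/
theorem sum_nsym_passesAt_le :
    ∑ q ∈ Finset.range P.length, nsym (restrict (PassesAt P q) (P.getD q []))
      + 2 * (globals P).card ≤ (contract P).flatten.length := by
  classical
  have h : (contract P).flatten.length = ∑ q ∈ Finset.range P.length,
      (nsym (restrict (StartsAt P q) (P.getD q [])) + nsym (restrict (EndsAt P q) (P.getD q []))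
        + nsym (restrict (PassesAt P q) (P.getD q []))) := by
    rw [length_flatten_eq_sum, length_contract]
    refine Finset.sum_congr rfl fun q hq => ?_
    have h1 : ((contract P).getD q []).length = (blockSet (contract P) q).card :=
      (List.toFinset_card_of_nodup (nodup_contract _ (getD_mem (by simpa using hq)))).symm
    rw [h1, nsym_restrict, nsym_restrict, nsym_restrict, ← Finset.card_union_of_disjoint,
      ← Finset.card_union_of_disjoint]
    · congr 1
      ext a
      simp only [mem_blockSet_contract, Finset.mem_union, Finset.mem_filter, StartsAt, EndsAt,
        PassesAt]
      constructor
      · rintro ⟨h1, h2⟩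
        by_cases h3 : ∃ r < q, a ∈ syms P r
        · by_cases h4 : ∃ r > q, a ∈ syms P r
          · exact Or.inr ⟨h1, h2, h3, h4⟩
          · push Not at h4; exact Or.inl (Or.inr ⟨h1, h2, h4⟩)
        · push Not at h3; exact Or.inl (Or.inl ⟨h1, h2, h3⟩)
      · tauto
    · rw [Finset.disjoint_left]
      intro a ha hb
      simp only [Finset.mem_union, Finset.mem_filter] at ha hb
      obtain ⟨-, -, ⟨x, hx, hx'⟩, y, hy, hy'⟩ := hb
      rcases ha with ha | ha
      exacts [ha.2.2 x hx hx', ha.2.2 y hy hy']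
    · rw [Finset.disjoint_left]
      intro a ha hb
      simp only [Finset.mem_filter] at ha hb
      obtain ⟨x, y, hxy, hx, hy⟩ := isGlobal_iff.1 ha.2.1
      have h1 : q ≤ x := by by_contra hc; exact ha.2.2 x (by omega) hx
      exact hb.2.2 y (by omega) hy
  rw [h, Finset.sum_add_distrib, Finset.sum_add_distrib]
  have := card_globals_le_sum_startsAt (P := P)
  have := card_globals_le_sum_endsAt (P := P)
  omega

theorem length_interval_le (q : ℕ) :
    (P.getD q []).flatten.length ≤ (localPart P (P.getD q [])).flatten.length
      + (restrict (StartsAt P q) (P.getD q [])).flatten.length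
      + (restrict (EndsAt P q) (P.getD q [])).flatten.length
      + (restrict (PassesAt P q) (P.getD q [])).flatten.length := by
  classical
  rw [localPart_eq_restrict]
  simp only [flatten_restrict]
  refine length_le_of_cover _ _ _ _ _ fun a ha => ?_
  have h : ¬ IsGlobal P a ∨ StartsAt P q a ∨ EndsAt P q a ∨ PassesAt P q a := by
    by_cases h1 : IsGlobal P a
    · by_cases h3 : ∃ r < q, a ∈ syms P r
      · by_cases h4 : ∃ r > q, a ∈ syms P r
        · exact Or.inr (Or.inr (Or.inr ⟨h1, h3, h4⟩))
        · push Not at h4; exact Or.inr (Or.inr (Or.inl ⟨h1, h4⟩))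
      · push Not at h3; exact Or.inr (Or.inl ⟨h1, h3⟩)
    · exact Or.inl h1
  simpa only [decide_eq_true_eq] using h

theorem length_flatten_flatten_le :
    P.flatten.flatten.length ≤ ∑ q ∈ Finset.range P.length,
      ((localPart P (P.getD q [])).flatten.length
      + (restrict (StartsAt P q) (P.getD q [])).flatten.length
      + (restrict (EndsAt P q) (P.getD q [])).flatten.length
      + (restrict (PassesAt P q) (P.getD q [])).flatten.length) := by
  have : P.flatten.flatten.length = ∑ q ∈ Finset.range P.length, (P.getD q []).flatten.length := by
    rw [List.flatten_flatten, length_flatten_eq_sum, List.length_map]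
    refine Finset.sum_congr rfl fun q hq => ?_
    have hq := Finset.mem_range.1 hq
    rw [List.getD_eq_getElem _ _ (by simpa using hq), List.getD_eq_getElem _ _ hq, List.getElem_map]
  rw [this]
  exact Finset.sum_le_sum fun q _ => length_interval_le q

end Symbols

end DavenportSchinzel

namespace DavenportSchinzel

/-! ### Ordered forests -/

theorem getLast?_flatMap_of_ne_nil {β γ : Type*} (L : List β) (f : β → List γ)
    (h : ∀ q ∈ L, f q ≠ []) : (L.flatMap f).getLast? = L.getLast?.bind fun q => (f q).getLast? := by
  induction L using List.reverseRecOn with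
  | nil => rfl
  | append_singleton L x _ =>
    have hx := h x (by simp)
    rw [List.flatMap_append, List.flatMap_singleton, List.getLast?_append, List.getLast?_concat,
      List.getLast?_eq_some_getLast hx]
    simp [List.getLast?_eq_some_getLast hx]

theorem head?_flatMap_of_ne_nil {β γ : Type*} (L : List β) (f : β → List γ)
    (h : ∀ q ∈ L, f q ≠ []) : (L.flatMap f).head? = L.head?.bind fun q => (f q).head? := by
  cases L with
  | nil => rfl
  | cons x L =>
    have hx := h x (by simp)
    rw [List.flatMap_cons, List.head?_append, List.head?_cons, List.head?_eq_some_head hx]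
    simp [List.head?_eq_some_head hx]

namespace Forest

variable {α : Type*}

/-- The list of single leaves with the given names. -/
def ofLeaves (L : List ℕ) : Forest α := L.foldr leaf nil

@[simp] theorem ofLeaves_nil : (ofLeaves [] : Forest α) = nil := rfl

@[simp] theorem ofLeaves_cons (p : ℕ) (L : List ℕ) :
    (ofLeaves (p :: L) : Forest α) = leaf p (ofLeaves L) := rfl

@[simp] theorem nil_append (F : Forest α) : nil.append F = F := rfl

@[simp] theorem append_nil (F : Forest α) : F.append nil = F := by
  induction F <;> simp_all [append]

theorem append_assoc (F G H : Forest α) : (F.append G).append H = F.append (G.append H) := by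
  induction F <;> simp_all [append]

@[simp] theorem leaves_append (F G : Forest α) : (F.append G).leaves = F.leaves ++ G.leaves := by
  induction F <;> simp_all [append, leaves]

@[simp] theorem leaves_ofLeaves (L : List ℕ) : (ofLeaves L : Forest α).leaves = L := by
  induction L <;> simp_all [leaves]

@[simp] theorem leaves_shift (d : ℕ) (F : Forest α) :
    (F.shift d).leaves = F.leaves.map (d + ·) := by
  induction F <;> simp_all [shift, leaves]

theorem shift_append (d : ℕ) (F G : Forest α) :
    (F.append G).shift d = (F.shift d).append (G.shift d) := by
  induction F <;> simp_all [shift, append]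

@[simp] theorem leaves_graft (β : ℕ → Finset α) (G : ℕ → Forest α) (F : Forest α) :
    (F.graft β G).leaves = F.leaves.flatMap fun q => (G q).leaves := by
  induction F <;> simp_all [graft, leaves]

theorem graft_append (β : ℕ → Finset α) (G : ℕ → Forest α) (F H : Forest α) :
    (F.append H).graft β G = (F.graft β G).append (H.graft β G) := by
  induction F <;> simp_all [graft, append]

theorem graft_congr {β : ℕ → Finset α} {G G' : ℕ → Forest α} {F : Forest α}
    (h : ∀ q ∈ F.leaves, G q = G' q) : F.graft β G = F.graft β G' := by
  induction F with
  | nil => rfl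
  | leaf p r ih =>
    simp only [leaves, List.mem_cons] at h
    rw [graft, graft, h p (by simp), ih fun q hq => h q (by simp [hq])]
  | node B c r ihc ihr =>
    simp only [leaves, List.mem_append] at h
    rw [graft, graft, ihc fun q hq => h q (by simp [hq]), ihr fun q hq => h q (by simp [hq])]

theorem leaves_first_append_tail (F : Forest α) : F.first.leaves ++ F.tail.leaves = F.leaves := by
  cases F <;> simp [first, tail, leaves]

theorem first_graft (β : ℕ → Finset α) (G : ℕ → Forest α) (F : Forest α) :
    (F.graft β G).first = F.first.graft β G := by cases F <;> rfl

theorem tail_graft (β : ℕ → Finset α) (G : ℕ → Forest α) (F : Forest α) :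
    (F.graft β G).tail = F.tail.graft β G := by cases F <;> rfl

theorem first_shift (d : ℕ) (F : Forest α) : (F.shift d).first = F.first.shift d := by
  cases F <;> rfl

theorem tail_shift (d : ℕ) (F : Forest α) : (F.shift d).tail = F.tail.shift d := by
  cases F <;> rfl

theorem tail_ofLeaves (L : List ℕ) : (ofLeaves L : Forest α).tail = ofLeaves L.tail := by
  cases L <;> rfl

/-- Every internal node has a child. -/
def Full : Forest α → Prop
  | nil => True
  | leaf _ r => r.Full
  | node _ c r => c ≠ nil ∧ c.Full ∧ r.Full

theorem shift_ne_nil {F : Forest α} (h : F ≠ nil) (d : ℕ) : F.shift d ≠ nil := by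
  cases F <;> simp_all [shift]

theorem graft_ne_nil {F : Forest α} (h : F ≠ nil) (β : ℕ → Finset α) (G : ℕ → Forest α) :
    F.graft β G ≠ nil := by
  cases F <;> simp_all [graft]

theorem Full.shift {F : Forest α} (h : F.Full) (d : ℕ) : (F.shift d).Full := by
  induction F with
  | nil => trivial
  | leaf p r ih => exact ih h
  | node B c r ihc ihr => exact ⟨shift_ne_nil h.1 d, ihc h.2.1, ihr h.2.2⟩

theorem full_ofLeaves (L : List ℕ) : (ofLeaves L : Forest α).Full := by
  induction L with
  | nil => trivial
  | cons p L ih => exact ih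

theorem Full.graft {F : Forest α} (h : F.Full) (β : ℕ → Finset α) {G : ℕ → Forest α}
    (hG : ∀ q ∈ F.leaves, G q ≠ nil ∧ (G q).Full) : (F.graft β G).Full := by
  induction F with
  | nil => trivial
  | leaf p r ih =>
    simp only [leaves, List.mem_cons] at hG
    exact ⟨(hG p (by simp)).1, (hG p (by simp)).2, ih h fun q hq => hG q (by simp [hq])⟩
  | node B c r ihc ihr =>
    simp only [leaves, List.mem_append] at hG
    exact ⟨graft_ne_nil h.1 β G, ihc h.2.1 fun q hq => hG q (by simp [hq]),
      ihr h.2.2 fun q hq => hG q (by simp [hq])⟩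

theorem Full.first {F : Forest α} (h : F.Full) : F.first.Full := by
  cases F with
  | nil => trivial
  | leaf p r => trivial
  | node B c r => exact ⟨h.1, h.2.1, trivial⟩

theorem Full.tail {F : Forest α} (h : F.Full) : F.tail.Full := by
  cases F with
  | nil => trivial
  | leaf p r => exact h
  | node B c r => exact h.2.2

theorem Full.leaves_ne_nil {F : Forest α} (h : F.Full) (hF : F ≠ nil) : F.leaves ≠ [] := by
  induction F with
  | nil => exact absurd rfl hF
  | leaf p r ih => simp [leaves]
  | node B c r ihc ihr => simp [leaves, ihc h.2.1 h.1]

theorem hangingOffLeft_shift (d : ℕ) (F : Forest α) :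
    (F.shift d).hangingOffLeft = F.hangingOffLeft.shift d := by
  induction F <;> simp_all [shift, hangingOffLeft, shift_append]

theorem hangingOffRight_shift (d : ℕ) (F : Forest α) :
    (F.shift d).hangingOffRight = F.hangingOffRight.shift d := by
  induction F with
  | nil => rfl
  | leaf p r ih => cases r <;> simp_all [shift, hangingOffRight]
  | node B c r ihc ihr => cases r <;> simp_all [shift, hangingOffRight]

theorem hangingOffLeft_ofLeaves (L : List ℕ) :
    (ofLeaves L : Forest α).hangingOffLeft = ofLeaves L.tail := by cases L <;> rfl

theorem hangingOffRight_ofLeaves (L : List ℕ) :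
    (ofLeaves L : Forest α).hangingOffRight = ofLeaves L.dropLast := by
  induction L with
  | nil => rfl
  | cons p L ih =>
    cases L with
    | nil => rfl
    | cons q L => simpa [hangingOffRight] using ih

/-- After grafting, the leftmost path runs through the old first leaf `q` and on into `G q`, so the
new subtrees hanging off it come from `G q` and the old ones are merely grafted. `Full` ensures that
the leftmost leaf of the forest lies below its first root. -/
theorem hangingOffLeft_graft {F : Forest α} (h : F.Full) (β : ℕ → Finset α) (G : ℕ → Forest α)
    {q : ℕ} (hq : F.leaves.head? = some q) :
    (F.graft β G).hangingOffLeft = (G q).hangingOffLeft.append (F.hangingOffLeft.graft β G) := by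
  induction F with
  | nil => simp [leaves] at hq
  | leaf p r ih =>
    simp only [leaves, List.head?_cons, Option.some.injEq] at hq
    subst hq
    rfl
  | node B c r ihc ihr =>
    have hc := h.2.1.leaves_ne_nil h.1
    rw [leaves, List.head?_append_of_ne_nil _ hc] at hq
    rw [graft, hangingOffLeft, hangingOffLeft, ihc h.2.1 hq, graft_append, append_assoc]

theorem hangingOffRight_node {B : Finset α} {c r : Forest α} (h : r ≠ nil) :
    (node B c r).hangingOffRight = node B c r.hangingOffRight := by
  cases r <;> simp_all [hangingOffRight]

theorem hangingOffRight_leaf {p : ℕ} {r : Forest α} (h : r ≠ nil) :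
    (leaf p r).hangingOffRight = leaf p r.hangingOffRight := by
  cases r <;> simp_all [hangingOffRight]

theorem hangingOffRight_graft {F : Forest α} (h : F.Full) (β : ℕ → Finset α) (G : ℕ → Forest α)
    {q : ℕ} (hq : F.leaves.getLast? = some q) :
    (F.graft β G).hangingOffRight = (F.hangingOffRight.graft β G).append (G q).hangingOffRight := by
  induction F with
  | nil => simp [leaves] at hq
  | leaf p r ih =>
    by_cases hr : r = nil
    · subst hr
      simp only [leaves, List.getLast?_singleton, Option.some.injEq] at hq
      subst hq
      rfl
    · have hr' := Full.leaves_ne_nil (F := r) h hr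
      rw [leaves, ← List.singleton_append, List.getLast?_append_of_ne_nil _ hr'] at hq
      rw [graft, hangingOffRight_node (graft_ne_nil hr β G), hangingOffRight_leaf hr, ih h hq]
      rfl
  | node B c r ihc ihr =>
    by_cases hr : r = nil
    · subst hr
      rw [leaves, leaves, List.append_nil] at hq
      exact ihc h.2.1 hq
    · have hr' := h.2.2.leaves_ne_nil hr
      rw [leaves, List.getLast?_append_of_ne_nil _ hr'] at hq
      rw [graft, hangingOffRight_node (graft_ne_nil hr β G), hangingOffRight_node hr, ihr h.2.2 hq]
      rfl

theorem leaves_hangingOffLeft_subset (F : Forest α) : F.hangingOffLeft.leaves ⊆ F.leaves := by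
  induction F with
  | nil => simp [hangingOffLeft]
  | leaf p r ih => simp [hangingOffLeft, leaves]
  | node B c r ihc ihr =>
    rw [hangingOffLeft, leaves, leaves_append]
    intro x hx
    rcases List.mem_append.1 hx with hx | hx
    exacts [List.mem_append_left _ (ihc hx), List.mem_append_right _ hx]

theorem leaves_hangingOffRight_subset (F : Forest α) : F.hangingOffRight.leaves ⊆ F.leaves := by
  induction F with
  | nil => simp [hangingOffRight]
  | leaf p r ih =>
    by_cases hr : r = nil
    · subst hr; simp [hangingOffRight, leaves]
    · rw [hangingOffRight_leaf hr, leaves, leaves]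
      exact List.cons_subset_cons _ ih
  | node B c r ihc ihr =>
    by_cases hr : r = nil
    · subst hr; simpa [hangingOffRight, leaves] using ihc
    · rw [hangingOffRight_node hr, leaves, leaves]
      intro x hx
      rcases List.mem_append.1 hx with hx | hx
      exacts [List.mem_append_left _ hx, List.mem_append_right _ (ihr hx)]

theorem rightmostLeaves_subset (F : Forest α) : F.rightmostLeaves ⊆ F.leaves := by
  induction F with
  | nil => simp [rightmostLeaves]
  | leaf p r ih => exact List.cons_subset_cons _ ih
  | node B c r ihc ihr =>
    rw [rightmostLeaves, leaves]
    intro x hx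
    rcases List.mem_append.1 hx with hx | hx
    · exact List.mem_append_left _ (List.mem_of_getLast? (by simpa using hx))
    · exact List.mem_append_right _ (ihr hx)

theorem leftmostLeaves_subset (F : Forest α) : F.leftmostLeaves ⊆ F.leaves := by
  induction F with
  | nil => simp [leftmostLeaves]
  | leaf p r ih => exact List.cons_subset_cons _ ih
  | node B c r ihc ihr =>
    rw [leftmostLeaves, leaves]
    intro x hx
    rcases List.mem_append.1 hx with hx | hx
    · exact List.mem_append_left _ (List.mem_of_head? (by simpa using hx))
    · exact List.mem_append_right _ (ihr hx)

theorem rightmostLeaves_append (F G : Forest α) :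
    (F.append G).rightmostLeaves = F.rightmostLeaves ++ G.rightmostLeaves := by
  induction F <;> simp_all [append, rightmostLeaves]

theorem leftmostLeaves_append (F G : Forest α) :
    (F.append G).leftmostLeaves = F.leftmostLeaves ++ G.leftmostLeaves := by
  induction F <;> simp_all [append, leftmostLeaves]

theorem rightmostLeaves_ofLeaves (L : List ℕ) :
    (ofLeaves L : Forest α).rightmostLeaves = L := by
  induction L <;> simp_all [rightmostLeaves]

theorem leftmostLeaves_ofLeaves (L : List ℕ) :
    (ofLeaves L : Forest α).leftmostLeaves = L := by
  induction L <;> simp_all [leftmostLeaves]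

theorem rightmostLeaves_shift (d : ℕ) (F : Forest α) :
    (F.shift d).rightmostLeaves = F.rightmostLeaves.map (d + ·) := by
  induction F <;> simp_all [shift, rightmostLeaves, Option.toList_map]

theorem leftmostLeaves_shift (d : ℕ) (F : Forest α) :
    (F.shift d).leftmostLeaves = F.leftmostLeaves.map (d + ·) := by
  induction F <;> simp_all [shift, leftmostLeaves, Option.toList_map]

/-- The rightmost leaf of a tree is replaced by the rightmost leaf of what is grafted onto it; this
fails if that grafted forest has no leaf. -/
theorem rightmostLeaves_graft {F : Forest α} {β : ℕ → Finset α} {G : ℕ → Forest α}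
    (hG : ∀ q ∈ F.leaves, (G q).leaves ≠ []) :
    (F.graft β G).rightmostLeaves =
      F.rightmostLeaves.flatMap fun q => (G q).leaves.getLast?.toList := by
  induction F with
  | nil => rfl
  | leaf p r ih =>
    simp only [leaves, List.mem_cons] at hG
    rw [graft, rightmostLeaves, rightmostLeaves, ih fun q hq => hG q (by simp [hq])]
    rfl
  | node B c r ihc ihr =>
    simp only [leaves, List.mem_append] at hG
    rw [graft, rightmostLeaves, rightmostLeaves, ihr fun q hq => hG q (by simp [hq]), leaves_graft,
      getLast?_flatMap_of_ne_nil _ _ fun q hq => hG q (by simp [hq]), List.flatMap_append]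
    cases c.leaves.getLast? <;> simp

theorem leftmostLeaves_graft {F : Forest α} {β : ℕ → Finset α} {G : ℕ → Forest α}
    (hG : ∀ q ∈ F.leaves, (G q).leaves ≠ []) :
    (F.graft β G).leftmostLeaves =
      F.leftmostLeaves.flatMap fun q => (G q).leaves.head?.toList := by
  induction F with
  | nil => rfl
  | leaf p r ih =>
    simp only [leaves, List.mem_cons] at hG
    rw [graft, leftmostLeaves, leftmostLeaves, ih fun q hq => hG q (by simp [hq])]
    rfl
  | node B c r ihc ihr =>
    simp only [leaves, List.mem_append] at hG
    rw [graft, leftmostLeaves, leftmostLeaves, ihr fun q hq => hG q (by simp [hq]), leaves_graft,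
      head?_flatMap_of_ne_nil _ _ fun q hq => hG q (by simp [hq]), List.flatMap_append]
    cases c.leaves.head? <;> simp

/-- The symbol `a` occurs in the block of an internal node. -/
def HasNode (a : α) : Forest α → Prop
  | nil => False
  | leaf _ r => r.HasNode a
  | node B c r => a ∈ B ∨ c.HasNode a ∨ r.HasNode a

theorem hasNode_shift {a : α} {d : ℕ} {F : Forest α} : (F.shift d).HasNode a ↔ F.HasNode a := by
  induction F <;> simp_all [shift, HasNode]

theorem not_hasNode_ofLeaves (a : α) (L : List ℕ) : ¬ (ofLeaves L).HasNode a := by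
  induction L <;> simp_all [HasNode]

theorem HasNode.of_graft {a : α} {β : ℕ → Finset α} {G : ℕ → Forest α} {F : Forest α}
    (h : (F.graft β G).HasNode a) :
    F.HasNode a ∨ ∃ q ∈ F.leaves, a ∈ β q ∨ (G q).HasNode a := by
  induction F with
  | nil => exact h.elim
  | leaf p r ih =>
    rcases h with h | h | h
    · exact Or.inr ⟨p, by simp [leaves], Or.inl h⟩
    · exact Or.inr ⟨p, by simp [leaves], Or.inr h⟩
    · rcases ih h with h | ⟨q, hq, h⟩
      exacts [Or.inl h, Or.inr ⟨q, by simp [leaves, hq], h⟩]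
  | node B c r ihc ihr =>
    rcases h with h | h | h
    · exact Or.inl (Or.inl h)
    · rcases ihc h with h | ⟨q, hq, h⟩
      exacts [Or.inl (Or.inr (Or.inl h)), Or.inr ⟨q, by simp [leaves, hq], h⟩]
    · rcases ihr h with h | ⟨q, hq, h⟩
      exacts [Or.inl (Or.inr (Or.inr h)), Or.inr ⟨q, by simp [leaves, hq], h⟩]

end Forest

open Forest

/-! ### Projections of forests -/

section Proj

variable {α : Type*} [DecidableEq α]

theorem leaves_proj (S : List (List α)) (a : α) (F : Forest α) :
    (proj S a F).leaves = F.leaves.filter fun p => a ∈ blockSet S p := by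
  induction F with
  | nil => rfl
  | leaf p r ih => rw [proj, leaves, List.filter_cons]; split_ifs <;> simp_all [leaves]
  | node B c r ihc ihr =>
    rw [proj, leaves, List.filter_append]; split_ifs <;> simp_all [leaves]

theorem proj_of_not_hasNode {S : List (List α)} {a : α} {F : Forest α} (h : ¬ F.HasNode a) :
    proj S a F = ofLeaves (F.leaves.filter fun p => a ∈ blockSet S p) := by
  induction F with
  | nil => rfl
  | leaf p r ih =>
    rw [proj, leaves, List.filter_cons, ih h]; split_ifs <;> simp_all
  | node B c r ihc ihr =>
    simp only [HasNode, not_or] at h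
    rw [proj, leaves, if_neg h.1, ihc h.2.1, ihr h.2.2, List.filter_append]
    generalize c.leaves.filter _ = L
    induction L <;> simp_all [append]

theorem proj_shift {S S' : List (List α)} {a : α} {d : ℕ} {F : Forest α}
    (h : ∀ p ∈ F.leaves, a ∈ blockSet S (d + p) ↔ a ∈ blockSet S' p) :
    proj S a (F.shift d) = (proj S' a F).shift d := by
  induction F with
  | nil => rfl
  | leaf p r ih =>
    simp only [leaves, List.mem_cons] at h
    rw [Forest.shift, proj, proj, ih fun q hq => h q (by simp [hq])]
    simp only [h p (by simp)]
    split_ifs <;> rfl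
  | node B c r ihc ihr =>
    simp only [leaves, List.mem_append] at h
    rw [Forest.shift, proj, proj, ihc fun q hq => h q (by simp [hq]),
      ihr fun q hq => h q (by simp [hq])]
    split_ifs
    · rfl
    · rw [shift_append]

/-- Used for global symbols. The hypothesis says that a leaf dropped by the projection carries
nothing of `a` below it, so grafting and projecting commute. -/
theorem proj_graft {S S' : List (List α)} {a : α} {G : ℕ → Forest α} {F : Forest α}
    (h : ∀ q ∈ F.leaves, a ∉ blockSet S' q → proj S a (G q) = nil) :
    proj S a (F.graft (blockSet S') G) =
      (proj S' a F).graft (blockSet S') fun q => proj S a (G q) := by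
  induction F with
  | nil => rfl
  | leaf p r ih =>
    simp only [leaves, List.mem_cons] at h
    rw [graft, proj, proj, ih fun q hq => h q (by simp [hq])]
    split_ifs with hp
    · rfl
    · rw [h p (by simp) hp]; rfl
  | node B c r ihc ihr =>
    simp only [leaves, List.mem_append] at h
    rw [graft, proj, proj, ihc fun q hq => h q (by simp [hq]), ihr fun q hq => h q (by simp [hq])]
    split_ifs
    · rfl
    · rw [graft_append]

/-- Used for local symbols: the upper tree disappears under the projection and only the grafted
parts remain, side by side. -/
theorem proj_graft_of_not_hasNode {S : List (List α)} {a : α} {β : ℕ → Finset α}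
    {G : ℕ → Forest α} {F : Forest α} (hF : ¬ F.HasNode a) (hβ : ∀ q ∈ F.leaves, a ∉ β q) :
    proj S a (F.graft β G) = (F.leaves.map fun q => proj S a (G q)).foldr append nil := by
  induction F with
  | nil => rfl
  | leaf p r ih =>
    simp only [leaves, List.mem_cons] at hβ
    rw [graft, proj, if_neg (hβ p (by simp)), ih hF fun q hq => hβ q (by simp [hq])]
    rfl
  | node B c r ihc ihr =>
    simp only [HasNode, not_or] at hF
    simp only [leaves, List.mem_append] at hβ
    rw [graft, proj, if_neg hF.1, ihc hF.2.1 fun q hq => hβ q (by simp [hq]),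
      ihr hF.2.2 fun q hq => hβ q (by simp [hq]), leaves, List.map_append]
    generalize c.leaves.map _ = L
    induction L with
    | nil => rfl
    | cons x L ih => rw [List.foldr_cons, List.cons_append, List.foldr_cons, append_assoc, ih]

omit [DecidableEq α] in
theorem foldr_append_eq_single {G : ℕ → Forest α} {L : List ℕ} (hL : L.Nodup) {q : ℕ} (hq : q ∈ L)
    (h : ∀ r ∈ L, r ≠ q → G r = nil) : (L.map G).foldr append nil = G q := by
  have hnil : ∀ L : List ℕ, (∀ r ∈ L, G r = nil) → (L.map G).foldr append nil = nil := by
    intro L hL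
    induction L with
    | nil => rfl
    | cons x L ih =>
      rw [List.map_cons, List.foldr_cons, hL x (by simp), ih fun r hr => hL r (by simp [hr])]
      rfl
  induction L with
  | nil => simp at hq
  | cons x L ih =>
    rw [List.map_cons, List.foldr_cons]
    obtain ⟨hx, hL⟩ := List.nodup_cons.1 hL
    rcases List.mem_cons.1 hq with rfl | hq'
    · rw [hnil L fun r hr => h r (by simp [hr]) (by rintro rfl; exact hx hr), append_nil]
    · rw [h x (by simp) (by rintro rfl; exact hx hq'), nil_append,
        ih hL hq' fun r hr => h r (by simp [hr])]

end Proj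

end DavenportSchinzel

namespace DavenportSchinzel
open Forest

/-! ### Positions of blocks -/

section Positions

variable {α : Type*} [DecidableEq α] {P : List (List (List α))}

theorem lt_length_of_mem_blockSet {S : List (List α)} {a : α} {p : ℕ} (h : a ∈ blockSet S p) :
    p < S.length := by
  by_contra hp
  rw [mem_blockSet, List.getD_eq_default _ _ (by omega)] at h
  simp at h

theorem pair_sublist_take {S : List (List α)} {a b : α} {x y p : ℕ} (hx : a ∈ blockSet S x)
    (hy : b ∈ blockSet S y) (hxy : x < y) (hyp : y < p) : [a, b].Sublist (S.take p).flatten := by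
  rw [← List.take_append_drop y (S.take p), List.flatten_append]
  rw [mem_blockSet] at hx hy
  refine pair_sublist_append ?_ ?_
  · rw [List.take_take, mem_flatten_take]
    exact ⟨x, by omega, hx⟩
  · rw [mem_flatten_drop]
    refine ⟨y, le_rfl, ?_⟩
    rw [List.getD_eq_getElem?_getD, List.getElem?_take_of_lt hyp]
    simpa using hy

theorem pair_sublist_drop {S : List (List α)} {a b : α} {x y p : ℕ} (hx : a ∈ blockSet S x)
    (hy : b ∈ blockSet S y) (hxy : x < y) (hpx : p < x) :
    [a, b].Sublist (S.drop (p + 1)).flatten := by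
  refine List.Sublist.trans ?_ (List.drop_sublist_drop_left S hpx).flatten
  rw [← List.take_append_drop 1 (S.drop x), List.flatten_append]
  rw [mem_blockSet] at hx hy
  refine pair_sublist_append ?_ ?_
  · rw [mem_flatten_take]
    exact ⟨0, by omega, by simpa using hx⟩
  · rw [List.drop_drop, mem_flatten_drop]
    exact ⟨y, by omega, hy⟩

variable (P) in
/-- The position of the first block of the `q`-th interval. -/
def off (q : ℕ) : ℕ := (P.take q).flatten.length

omit [DecidableEq α] in
theorem off_succ (q : ℕ) : off P (q + 1) = off P q + (P.getD q []).length := by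
  rw [off, off]
  by_cases hq : q < P.length
  · rw [List.take_succ_eq_append_getElem hq, List.getD_eq_getElem _ _ hq, List.flatten_append,
      List.length_append, List.flatten_singleton]
  · rw [List.take_of_length_le (by omega), List.take_of_length_le (by omega),
      List.getD_eq_default _ _ (by omega)]
    simp

omit [DecidableEq α] in
theorem off_length : off P P.length = P.flatten.length := by simp [off]

omit [DecidableEq α] in
theorem off_mono : Monotone (off P) :=
  monotone_nat_of_le_succ fun q => by rw [off_succ]; omega

omit [DecidableEq α] in
theorem take_off (q : ℕ) : P.flatten.take (off P q) = (P.take q).flatten := by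
  conv_lhs => rw [← List.take_append_drop q P, List.flatten_append]
  exact List.take_left' (by simp [off])

omit [DecidableEq α] in
theorem drop_off (q : ℕ) : P.flatten.drop (off P q) = (P.drop q).flatten := by
  conv_lhs => rw [← List.take_append_drop q P, List.flatten_append]
  exact List.drop_left' (by simp [off])

theorem blockSet_off_add {q p : ℕ} (hp : p < (P.getD q []).length) :
    blockSet P.flatten (off P q + p) = blockSet (P.getD q []) p := by
  rw [blockSet, blockSet, flatten_eq_take_getD_drop P q, List.append_assoc,
    List.getD_append_right _ _ _ _ (by simp [off])]
  rw [show off P q + p - (P.take q).flatten.length = p by simp [off], List.getD_append _ _ _ _ hp]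

omit [DecidableEq α] in
theorem lt_of_off_add_lt {q r p p' : ℕ} (hp' : p' < (P.getD r []).length)
    (h : off P q + p ≤ off P r + p') : q ≤ r := by
  by_contra hc
  have h1 : off P (r + 1) ≤ off P q := off_mono (by omega)
  rw [off_succ] at h1
  omega

omit [DecidableEq α] in
theorem off_add_inj {q r p p' : ℕ} (hp : p < (P.getD q []).length) (hp' : p' < (P.getD r []).length)
    (h : off P q + p = off P r + p') : q = r ∧ p = p' := by
  have h1 := lt_of_off_add_lt hp' h.le
  have h2 := lt_of_off_add_lt hp h.ge
  obtain rfl : q = r := le_antisymm h1 h2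
  exact ⟨rfl, by omega⟩

omit [DecidableEq α] in
theorem off_add_lt_off_add {q r p p' : ℕ} (hp : p < (P.getD q []).length) (h : q < r) :
    off P q + p < off P r + p' := by
  have h1 : off P (q + 1) ≤ off P r := off_mono h
  rw [off_succ] at h1
  omega

omit [DecidableEq α] in
theorem exists_eq_off_add {x : ℕ} (hx : x < P.flatten.length) :
    ∃ q p, p < (P.getD q []).length ∧ x = off P q + p := by
  rw [← off_length] at hx
  generalize P.length = k at hx
  induction k with
  | zero => simp [off] at hx
  | succ k ih =>
    by_cases h : x < off P k
    · exact ih h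
    · rw [off_succ] at hx
      exact ⟨k, x - off P k, by omega, by omega⟩

theorem exists_eq_off_add_of_mem {x : ℕ} {a : α} (hx : a ∈ blockSet P.flatten x) :
    ∃ q p, p < (P.getD q []).length ∧ x = off P q + p ∧ a ∈ blockSet (P.getD q []) p := by
  obtain ⟨q, p, hp, rfl⟩ := exists_eq_off_add (lt_length_of_mem_blockSet hx)
  exact ⟨q, p, hp, rfl, by rwa [blockSet_off_add hp] at hx⟩

theorem mem_syms_of_mem_blockSet {q p : ℕ} {a : α} (h : a ∈ blockSet (P.getD q []) p) :
    a ∈ syms P q := mem_syms.2 (mem_flatten_iff_blockSet.2 ⟨p, h⟩)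

theorem exists_mem_blockSet_of_mem_syms {q : ℕ} {a : α} (h : a ∈ syms P q) :
    ∃ p, p < (P.getD q []).length ∧ a ∈ blockSet (P.getD q []) p := by
  obtain ⟨p, hp⟩ := mem_flatten_iff_blockSet.1 (mem_syms.1 h)
  exact ⟨p, lt_length_of_mem_blockSet hp, hp⟩

theorem contract_take_sublist' (q p : ℕ) :
    ((contract P).take q).flatten.Sublist (P.flatten.take (off P q + p)).flatten := by
  refine (contract_take_sublist q).trans ?_
  rw [← take_off]
  exact (List.take_sublist_take_left (by omega)).flatten

theorem contract_drop_sublist' {q p : ℕ} (hp : p < (P.getD q []).length) :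
    ((contract P).drop (q + 1)).flatten.Sublist (P.flatten.drop (off P q + p + 1)).flatten := by
  refine (contract_drop_sublist _).trans ?_
  rw [← drop_off]
  refine (List.drop_sublist_drop_left _ ?_).flatten
  rw [off_succ]; omega

theorem localPart_take_sublist (I : List (List α)) (p : ℕ) :
    ((localPart P I).take p).flatten.Sublist (I.take p).flatten := by
  rw [localPart_eq_restrict, restrict, ← List.map_take]
  exact flatten_restrict_sublist _ _

theorem localPart_drop_sublist (I : List (List α)) (p : ℕ) :
    ((localPart P I).drop p).flatten.Sublist (I.drop p).flatten := by
  rw [localPart_eq_restrict, restrict, ← List.map_drop]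
  exact flatten_restrict_sublist _ _

theorem localPart_take_sublist' {q p : ℕ} (hp : p < (P.getD q []).length) :
    ((localPart P (P.getD q [])).take p).flatten.Sublist
      (P.flatten.take (off P q + p)).flatten := by
  refine (localPart_take_sublist _ _).trans (List.Sublist.flatten ?_)
  rw [flatten_eq_take_getD_drop P q, List.append_assoc]
  rw [show off P q + p = (P.take q).flatten.length + p from rfl, List.take_length_add_append,
    List.take_append_of_le_length hp.le]
  exact List.sublist_append_right _ _

theorem localPart_drop_sublist' {q p : ℕ} (hp : p < (P.getD q []).length) :
    ((localPart P (P.getD q [])).drop (p + 1)).flatten.Sublist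
      (P.flatten.drop (off P q + p + 1)).flatten := by
  refine (localPart_drop_sublist _ _).trans (List.Sublist.flatten ?_)
  rw [flatten_eq_take_getD_drop P q, List.append_assoc]
  rw [show off P q + p + 1 = (P.take q).flatten.length + (p + 1) from rfl,
    List.drop_length_add_append, List.drop_append_of_le_length hp]
  exact List.sublist_append_left _ _

/-- The positions of the occurrences of `a` in the `q`-th interval. -/
def occPos (P : List (List (List α))) (a : α) (q : ℕ) : List ℕ :=
  ((List.range (P.getD q []).length).map (off P q + ·)).filter fun x => a ∈ blockSet P.flatten x

theorem mem_occPos {a : α} {q x : ℕ} :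
    x ∈ occPos P a q ↔ ∃ p < (P.getD q []).length, x = off P q + p ∧ a ∈ blockSet (P.getD q []) p := by
  simp only [occPos, List.mem_filter, List.mem_map, List.mem_range, decide_eq_true_eq]
  constructor
  · rintro ⟨⟨p, hp, rfl⟩, h⟩
    exact ⟨p, hp, rfl, by rwa [blockSet_off_add hp] at h⟩
  · rintro ⟨p, hp, rfl, h⟩
    exact ⟨⟨p, hp, rfl⟩, by rwa [blockSet_off_add hp]⟩

theorem off_add_mem_occPos {a : α} {q r p : ℕ} (hp : p < (P.getD q []).length) :
    off P q + p ∈ occPos P a r ↔ q = r ∧ a ∈ blockSet (P.getD q []) p := by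
  rw [mem_occPos]
  constructor
  · rintro ⟨p', hp', h, ha⟩
    obtain ⟨rfl, rfl⟩ := off_add_inj hp hp' h
    exact ⟨rfl, ha⟩
  · rintro ⟨rfl, ha⟩
    exact ⟨p, hp, rfl, ha⟩

theorem occPos_ne_nil {a : α} {q : ℕ} (h : a ∈ syms P q) : occPos P a q ≠ [] := by
  obtain ⟨p, hp, ha⟩ := exists_mem_blockSet_of_mem_syms h
  exact List.ne_nil_of_mem ((off_add_mem_occPos hp).2 ⟨rfl, ha⟩)

theorem occPos_eq_nil {a : α} {q : ℕ} (h : a ∉ syms P q) : occPos P a q = [] := by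
  rw [List.eq_nil_iff_forall_not_mem]
  intro x hx
  obtain ⟨p, -, -, ha⟩ := mem_occPos.1 hx
  exact h (mem_syms_of_mem_blockSet ha)

theorem pairwise_occPos (a : α) (q : ℕ) : (occPos P a q).Pairwise (· < ·) := by
  refine List.Pairwise.filter _ (List.Pairwise.map _ (fun x y h => ?_) List.pairwise_lt_range)
  simpa using h

end Positions

/-! ### Strictly increasing lists of positions -/

section Sorted

variable {l : List ℕ} (hl : l.Pairwise (· < ·))
include hl

theorem mem_tail_of_lt {x y : ℕ} (hx : x ∈ l) (hy : y ∈ l) (hxy : x < y) : y ∈ l.tail := by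
  cases l with
  | nil => simp at hx
  | cons z l =>
    rcases List.mem_cons.1 hy with rfl | hy
    · rcases List.mem_cons.1 hx with rfl | hx
      · omega
      · have := (List.pairwise_cons.1 hl).1 x hx; omega
    · exact hy

theorem head?_le {x h : ℕ} (hh : l.head? = some h) (hx : x ∈ l) : h ≤ x := by
  cases l with
  | nil => simp at hx
  | cons z l =>
    simp only [List.head?_cons, Option.some.injEq] at hh
    subst hh
    rcases List.mem_cons.1 hx with rfl | hx
    · rfl
    · exact ((List.pairwise_cons.1 hl).1 x hx).le

theorem head?_eq_of_le {x : ℕ} (hx : x ∈ l) (h : ∀ y ∈ l, x ≤ y) : l.head? = some x := by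
  obtain ⟨z, hz⟩ : ∃ z, l.head? = some z := by
    cases l with
    | nil => simp at hx
    | cons z l => exact ⟨z, rfl⟩
  rw [hz, le_antisymm (head?_le hl hz hx) (h z (List.mem_of_head? hz))]

theorem le_getLast? {x h : ℕ} (hh : l.getLast? = some h) (hx : x ∈ l) : x ≤ h := by
  induction l using List.reverseRecOn with
  | nil => simp at hx
  | append_singleton l z _ =>
    simp only [List.getLast?_concat, Option.some.injEq] at hh
    subst hh
    rcases List.mem_append.1 hx with hx | hx
    · exact ((List.pairwise_append.1 hl).2.2 x hx z (by simp)).le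
    · simp at hx; omega

theorem getLast?_eq_of_le {x : ℕ} (hx : x ∈ l) (h : ∀ y ∈ l, y ≤ x) : l.getLast? = some x := by
  obtain ⟨z, hz⟩ : ∃ z, l.getLast? = some z := by
    rw [List.getLast?_eq_some_getLast (List.ne_nil_of_mem hx)]; exact ⟨_, rfl⟩
  rw [hz, le_antisymm (h z (List.mem_of_getLast? hz)) (le_getLast? hl hz hx)]

theorem mem_dropLast_of_lt {x y : ℕ} (hx : x ∈ l) (hy : y ∈ l) (hxy : x < y) :
    x ∈ l.dropLast := by
  induction l using List.reverseRecOn with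
  | nil => simp at hx
  | append_singleton l z _ =>
    rw [List.dropLast_concat]
    rcases List.mem_append.1 hx with hx | hx
    · exact hx
    · have := le_getLast? hl (List.getLast?_concat ..) hy
      simp at hx; omega

end Sorted

/-! ### Feathers of composite derivation trees -/

section Derivation

variable {α : Type*} [DecidableEq α]

/-- The composite of a tree of the contracted sequence and trees of the local parts. -/
abbrev compTree (P : List (List (List α))) (That : Forest α) (Tloc : ℕ → Forest α) : Forest α :=
  That.graft (blockSet (contract P)) fun q => (Tloc q).shift (off P q)

/-- `That` and `Tloc` are derivation trees of the contracted sequence and of the local parts, and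
their composite is a derivation tree. -/
structure IsComposition (P : List (List (List α))) (That : Forest α) (Tloc : ℕ → Forest α) :
    Prop where
  hat : IsDerivationTree (contract P) That
  loc : ∀ q < P.length, IsDerivationTree (localPart P (P.getD q [])) (Tloc q)
  comp : IsDerivationTree P.flatten (compTree P That Tloc)

theorem isComposition {P : List (List (List α))} {That : Forest α}
    {Tloc : ℕ → Forest α} (hhat : IsDerivationTree (contract P) That)
    (hloc : ∀ q < P.length, IsDerivationTree (localPart P (P.getD q [])) (Tloc q))
    (hne : ∀ I ∈ P, I ≠ []) (h2 : 2 ≤ P.length) (hlt : P.length < P.flatten.length) :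
    IsComposition P That Tloc := by
  refine ⟨hhat, hloc, .comp P That Tloc hne h2 hlt hhat fun q hq => ?_⟩
  have := hloc q hq
  rwa [List.getD_eq_getElem _ _ hq] at this

/-- The recursor rephrased with `getD` in place of bounded indexing; its composite case keeps the
derivation trees of all parts available. -/
theorem IsDerivationTree.induct {motive : List (List α) → Forest α → Prop}
    (base : ∀ S : List (List α), S.length ≤ 2 → motive S (ofLeaves (List.range S.length)))
    (comp : ∀ P That Tloc, IsComposition P That Tloc → motive (contract P) That →
      (∀ q < P.length, motive (localPart P (P.getD q [])) (Tloc q)) →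
      motive P.flatten (compTree P That Tloc))
    {S : List (List α)} {T : Forest α} (h : IsDerivationTree S T) : motive S T := by
  induction h with
  | base S hS => exact base S hS
  | comp P That Tloc hne h2 hlt hThat hTloc ihThat ihTloc =>
    refine comp P That Tloc (isComposition hThat (fun q hq => ?_) hne h2 hlt) ihThat fun q hq => ?_
    · rw [List.getD_eq_getElem _ _ hq]; exact hTloc q hq
    · rw [List.getD_eq_getElem _ _ hq]; exact ihTloc q hq

@[simp] theorem length_localPart (P : List (List (List α))) (I : List (List α)) :
    (localPart P I).length = I.length := by simp [localPart]

theorem IsDerivationTree.leaves_eq {S : List (List α)} {T : Forest α} (h : IsDerivationTree S T) :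
    T.leaves = List.range S.length := by
  refine h.induct (motive := fun S T => T.leaves = List.range S.length) ?_ ?_
  · intro S _; rw [leaves_ofLeaves]
  · intro P That Tloc _ hhat hloc
    have key : ∀ k ≤ P.length, ((List.range k).flatMap fun q =>
        ((Tloc q).shift (off P q)).leaves) = List.range (off P k) := by
      intro k hk
      induction k with
      | zero => simp [off]
      | succ k ih =>
        rw [List.range_succ, List.flatMap_append, ih (by omega), List.flatMap_singleton,
          leaves_shift, hloc k (by omega), length_localPart, off_succ, List.range_add]
    rw [leaves_graft, hhat, length_contract, key _ le_rfl, off_length]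

theorem IsDerivationTree.mem_of_hasNode {S : List (List α)} {T : Forest α}
    (h : IsDerivationTree S T) {a : α} (ha : T.HasNode a) : a ∈ S.flatten := by
  revert ha
  refine h.induct (motive := fun S T => T.HasNode a → a ∈ S.flatten) ?_ ?_
  · intro S _ h
    exact absurd h (not_hasNode_ofLeaves a _)
  · intro P That Tloc hc hhat hloc ha
    have hP : ∀ q, a ∈ blockSet (contract P) q → a ∈ P.flatten.flatten := fun q hq =>
      mem_flatten_flatten.2 ⟨q, (mem_blockSet_contract.1 hq).1⟩
    rcases ha.of_graft with ha | ⟨q, hq, ha | ha⟩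
    · obtain ⟨q, hq⟩ := mem_flatten_iff_blockSet.1 (hhat ha)
      exact hP q hq
    · exact hP q ha
    · rw [hc.hat.leaves_eq, List.mem_range, length_contract] at hq
      have := hloc q hq (hasNode_shift.1 ha)
      rw [localPart_eq_restrict, mem_flatten_restrict] at this
      exact mem_flatten_flatten.2 ⟨q, mem_syms.2 this.1⟩

theorem mem_syms_of_mem_leaves_proj {P : List (List (List α))} {That : Forest α} {a : α} {q : ℕ}
    (hq : q ∈ (proj (contract P) a That).leaves) : a ∈ syms P q := by
  rw [leaves_proj, List.mem_filter, decide_eq_true_eq] at hq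
  exact (mem_blockSet_contract.1 hq.2).1

section Composition

variable {P : List (List (List α))} {That : Forest α} {Tloc : ℕ → Forest α}
  (h : IsComposition P That Tloc)
include h

/-- Internal nodes of a derivation tree carry only symbols of its sequence, so `a` labels no node
here and its projection is the bare list of its leaves. -/
theorem IsComposition.proj_loc {a : α} {r : ℕ} (hr : r < P.length)
    (ha : a ∉ (localPart P (P.getD r [])).flatten) :
    proj P.flatten a ((Tloc r).shift (off P r)) = ofLeaves (occPos P a r) := by
  rw [proj_of_not_hasNode fun hn => ha ((h.loc r hr).mem_of_hasNode (hasNode_shift.1 hn)),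
    leaves_shift, (h.loc r hr).leaves_eq, length_localPart]
  rfl

/-- A local symbol labels nothing in the upper tree and no other interval contains it, so it sees
only the tree of its own interval. -/
theorem IsComposition.proj_local {a : α} {q : ℕ} (hg : ¬ IsGlobal P a) (hq : a ∈ syms P q) :
    proj P.flatten a (compTree P That Tloc) =
      (proj (localPart P (P.getD q [])) a (Tloc q)).shift (off P q) := by
  have hk := lt_of_mem_syms hq
  rw [compTree, proj_graft_of_not_hasNode]
  · rw [h.hat.leaves_eq, length_contract]
    rw [foldr_append_eq_single List.nodup_range (List.mem_range.2 hk)]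
    · refine proj_shift fun p hp => ?_
      rw [(h.loc q hk).leaves_eq, List.mem_range, length_localPart] at hp
      rw [blockSet_off_add hp, localPart_eq_restrict, mem_blockSet_restrict, and_iff_left hg]
    · intro r hr hrq
      have hr' : a ∉ syms P r := fun hr' => hrq (eq_of_not_isGlobal hg hr' hq)
      rw [h.proj_loc (List.mem_range.1 hr), occPos_eq_nil hr', ofLeaves_nil]
      rw [localPart_eq_restrict, mem_flatten_restrict, ← mem_syms]
      exact fun hc => hr' hc.1
  · intro hn
    obtain ⟨r, hr⟩ := mem_flatten_iff_blockSet.1 (h.hat.mem_of_hasNode hn)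
    exact hg (mem_blockSet_contract.1 hr).2
  · exact fun r _ hr => hg (mem_blockSet_contract.1 hr).2

/-- Every leaf of the projection for the contracted sequence becomes a node whose children are the
occurrences of `a` in that interval. -/
theorem IsComposition.proj_global {a : α} (hg : IsGlobal P a) :
    proj P.flatten a (compTree P That Tloc) =
      (proj (contract P) a That).graft (blockSet (contract P)) fun q => ofLeaves (occPos P a q) := by
  have hl : ∀ q ∈ That.leaves, q < P.length ∧ a ∉ (localPart P (P.getD q [])).flatten := by
    intro q hq
    rw [h.hat.leaves_eq, List.mem_range, length_contract] at hq
    refine ⟨hq, ?_⟩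
    rw [localPart_eq_restrict, mem_flatten_restrict]
    exact fun hc => hc.2 hg
  rw [compTree, proj_graft]
  · refine graft_congr fun q hq => ?_
    rw [leaves_proj] at hq
    obtain ⟨h1, h2⟩ := hl q (List.mem_filter.1 hq).1
    exact h.proj_loc h1 h2
  · intro q hq ha
    obtain ⟨h1, h2⟩ := hl q hq
    rw [h.proj_loc h1 h2, occPos_eq_nil, ofLeaves_nil]
    exact fun hc => ha (mem_blockSet_contract.2 ⟨hc, hg⟩)

end Composition

omit [DecidableEq α] in
theorem ofLeaves_ne_nil {L : List ℕ} (h : L ≠ []) : (ofLeaves L : Forest α) ≠ nil := by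
  cases L <;> simp_all

/-- A node block contains `a` only if some leaf below does. The lemmas on grafted wings need this.
-/
theorem IsDerivationTree.full_proj {S : List (List α)} {T : Forest α}
    (h : IsDerivationTree S T) (a : α) : (proj S a T).Full := by
  refine h.induct (motive := fun S T => (proj S a T).Full) ?_ ?_
  · intro S _
    rw [proj_of_not_hasNode (not_hasNode_ofLeaves a _)]
    exact full_ofLeaves _
  · intro P That Tloc hc hhat hloc
    by_cases hg : IsGlobal P a
    · rw [hc.proj_global hg]
      exact hhat.graft _ fun q hq =>
        ⟨ofLeaves_ne_nil (occPos_ne_nil (mem_syms_of_mem_leaves_proj hq)), full_ofLeaves _⟩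
    · by_cases hq : ∃ q, a ∈ syms P q
      · obtain ⟨q, hq⟩ := hq
        rw [hc.proj_local hg hq]
        exact (hloc q (lt_of_mem_syms hq)).shift _
      · rw [proj_of_not_hasNode]
        · exact full_ofLeaves _
        · intro hn
          rcases hn.of_graft with hn | ⟨q, hq', hn | hn⟩
          · obtain ⟨r, hr⟩ := mem_flatten_iff_blockSet.1 (hc.hat.mem_of_hasNode hn)
            exact hg (mem_blockSet_contract.1 hr).2
          · exact hg (mem_blockSet_contract.1 hn).2
          · rw [hc.hat.leaves_eq, List.mem_range, length_contract] at hq'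
            have := (hc.loc q hq').mem_of_hasNode (hasNode_shift.1 hn)
            rw [localPart_eq_restrict, mem_flatten_restrict] at this
            exact hq ⟨q, mem_syms.2 this.1⟩

end Derivation

end DavenportSchinzel

namespace DavenportSchinzel
open Forest

/-! ### Heads, wings and feathers under composition -/

section Wings

variable {α : Type*} [DecidableEq α]

/-- The leaves of `a` below its left head. -/
def leftLeaves (S : List (List α)) (T : Forest α) (a : α) : List ℕ := (proj S a T).first.leaves

/-- The leaves of `a` below its right head. -/
def rightLeaves (S : List (List α)) (T : Forest α) (a : α) : List ℕ := (proj S a T).tail.leaves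

/-- The feathers of `a` below its left head. -/
def doveFeathers (S : List (List α)) (T : Forest α) (a : α) : List ℕ :=
  (doveQuills S T a).rightmostLeaves

/-- The feathers of `a` below its right head. -/
def hawkFeathers (S : List (List α)) (T : Forest α) (a : α) : List ℕ :=
  (hawkQuills S T a).leftmostLeaves

theorem doveFeathers_subset (S : List (List α)) (T : Forest α) (a : α) :
    doveFeathers S T a ⊆ leftLeaves S T a :=
  fun _ hx => leaves_hangingOffLeft_subset _ (rightmostLeaves_subset _ hx)

theorem hawkFeathers_subset (S : List (List α)) (T : Forest α) (a : α) :
    hawkFeathers S T a ⊆ rightLeaves S T a :=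
  fun _ hx => leaves_hangingOffRight_subset _ (leftmostLeaves_subset _ hx)

section Tree

variable {S : List (List α)} {T : Forest α} (h : IsDerivationTree S T) {a : α}
include h

theorem IsDerivationTree.left_append_right (a : α) : leftLeaves S T a ++ rightLeaves S T a =
    (List.range S.length).filter fun p => a ∈ blockSet S p := by
  rw [leftLeaves, rightLeaves, leaves_first_append_tail, leaves_proj, h.leaves_eq]

theorem IsDerivationTree.mem_left_or_right {x : ℕ} :
    x ∈ leftLeaves S T a ∨ x ∈ rightLeaves S T a ↔ a ∈ blockSet S x := by
  rw [← List.mem_append, h.left_append_right, List.mem_filter, List.mem_range, decide_eq_true_eq,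
    and_iff_right_iff_imp]
  exact lt_length_of_mem_blockSet

theorem IsDerivationTree.pairwise_leaves (a : α) :
    (leftLeaves S T a ++ rightLeaves S T a).Pairwise (· < ·) := by
  rw [h.left_append_right]
  exact List.pairwise_lt_range.filter _

theorem IsDerivationTree.left_lt_right {x y : ℕ} (hx : x ∈ leftLeaves S T a)
    (hy : y ∈ rightLeaves S T a) : x < y :=
  (List.pairwise_append.1 (h.pairwise_leaves a)).2.2 x hx y hy

theorem IsDerivationTree.head?_left {x : ℕ} (hx : x ∈ leftLeaves S T a) :
    ∃ q ∈ leftLeaves S T a, (leftLeaves S T a).head? = some q ∧ ∀ y, a ∈ blockSet S y → q ≤ y := by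
  have hne := List.ne_nil_of_mem hx
  refine ⟨_, List.head_mem hne, List.head?_eq_some_head hne, fun y hy => ?_⟩
  refine head?_le (h.pairwise_leaves a) ?_ (List.mem_append.2 (h.mem_left_or_right.2 hy))
  rw [List.head?_append_of_ne_nil _ hne, List.head?_eq_some_head hne]

theorem IsDerivationTree.getLast?_right {x : ℕ} (hx : x ∈ rightLeaves S T a) :
    ∃ q ∈ rightLeaves S T a, (rightLeaves S T a).getLast? = some q ∧
      ∀ y, a ∈ blockSet S y → y ≤ q := by
  have hne := List.ne_nil_of_mem hx
  refine ⟨_, List.getLast_mem hne, List.getLast?_eq_some_getLast hne, fun y hy => ?_⟩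
  refine le_getLast? (h.pairwise_leaves a) ?_ (List.mem_append.2 (h.mem_left_or_right.2 hy))
  rw [List.getLast?_append_of_ne_nil _ hne, List.getLast?_eq_some_getLast hne]

theorem IsDerivationTree.exists_mem_left {y : ℕ} (hy : a ∈ blockSet S y) :
    ∃ x, x ∈ leftLeaves S T a := by
  refine List.exists_mem_of_ne_nil _ ((h.full_proj a).first.leaves_ne_nil ?_)
  have : (proj S a T).leaves ≠ [] := by
    have := h.mem_left_or_right.2 hy
    rw [← List.mem_append, leftLeaves, rightLeaves, leaves_first_append_tail] at this
    exact List.ne_nil_of_mem this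
  cases hp : proj S a T <;> simp_all [first, leaves]

end Tree

section Composition

variable {P : List (List (List α))} {That : Forest α} {Tloc : ℕ → Forest α}
  (h : IsComposition P That Tloc) {a : α}
include h

theorem IsComposition.left_global (hg : IsGlobal P a) :
    leftLeaves P.flatten (compTree P That Tloc) a =
      (leftLeaves (contract P) That a).flatMap (occPos P a) := by
  rw [leftLeaves, h.proj_global hg, first_graft, leaves_graft]
  simp only [leaves_ofLeaves]
  rfl

theorem IsComposition.right_global (hg : IsGlobal P a) :
    rightLeaves P.flatten (compTree P That Tloc) a =
      (rightLeaves (contract P) That a).flatMap (occPos P a) := by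
  rw [rightLeaves, h.proj_global hg, tail_graft, leaves_graft]
  simp only [leaves_ofLeaves]
  rfl

theorem IsComposition.mem_left_global (hg : IsGlobal P a) {q p : ℕ}
    (hp : p < (P.getD q []).length) (ha : a ∈ blockSet (P.getD q []) p) :
    off P q + p ∈ leftLeaves P.flatten (compTree P That Tloc) a ↔
      q ∈ leftLeaves (contract P) That a := by
  rw [h.left_global hg, List.mem_flatMap]
  simp only [off_add_mem_occPos hp]
  constructor
  · rintro ⟨r, hr, rfl, -⟩; exact hr
  · exact fun hq => ⟨q, hq, rfl, ha⟩

theorem IsComposition.mem_right_global (hg : IsGlobal P a) {q p : ℕ}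
    (hp : p < (P.getD q []).length) (ha : a ∈ blockSet (P.getD q []) p) :
    off P q + p ∈ rightLeaves P.flatten (compTree P That Tloc) a ↔
      q ∈ rightLeaves (contract P) That a := by
  rw [h.right_global hg, List.mem_flatMap]
  simp only [off_add_mem_occPos hp]
  constructor
  · rintro ⟨r, hr, rfl, -⟩; exact hr
  · exact fun hq => ⟨q, hq, rfl, ha⟩

/-- The left wing is prolonged by the node of the first interval `q` and the first occurrence in it.
The other occurrences in `q` become quills that are leaves, hence feathers. An old quill stays a
quill, and its feather moves to the last occurrence of `a` in the feather's interval. -/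
theorem IsComposition.dove_global (hg : IsGlobal P a) {q : ℕ}
    (hq : (leftLeaves (contract P) That a).head? = some q) :
    doveFeathers P.flatten (compTree P That Tloc) a = (occPos P a q).tail ++
      (doveFeathers (contract P) That a).flatMap fun r => (occPos P a r).getLast?.toList := by
  have hF := (h.hat.full_proj a).first
  rw [doveFeathers, doveQuills, h.proj_global hg, first_graft, hangingOffLeft_graft hF _ _ hq,
    rightmostLeaves_append, hangingOffLeft_ofLeaves, rightmostLeaves_ofLeaves,
    rightmostLeaves_graft]
  · simp only [leaves_ofLeaves]
    rfl
  · intro r hr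
    rw [leaves_ofLeaves]
    refine occPos_ne_nil (mem_syms_of_mem_leaves_proj (That := That) ?_)
    rw [← leaves_first_append_tail]
    exact List.mem_append_left _ (leaves_hangingOffLeft_subset _ hr)

theorem IsComposition.hawk_global (hg : IsGlobal P a) {q : ℕ}
    (hq : (rightLeaves (contract P) That a).getLast? = some q) :
    hawkFeathers P.flatten (compTree P That Tloc) a =
      ((hawkFeathers (contract P) That a).flatMap fun r => (occPos P a r).head?.toList) ++
        (occPos P a q).dropLast := by
  have hF := (h.hat.full_proj a).tail
  rw [hawkFeathers, hawkQuills, h.proj_global hg, tail_graft, hangingOffRight_graft hF _ _ hq,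
    leftmostLeaves_append, hangingOffRight_ofLeaves, leftmostLeaves_ofLeaves,
    leftmostLeaves_graft]
  · simp only [leaves_ofLeaves]
    rfl
  · intro r hr
    rw [leaves_ofLeaves]
    refine occPos_ne_nil (mem_syms_of_mem_leaves_proj (That := That) ?_)
    rw [← leaves_first_append_tail]
    exact List.mem_append_right _ (leaves_hangingOffRight_subset _ hr)

variable {q : ℕ} (hg : ¬ IsGlobal P a) (hq : a ∈ syms P q)
include hg hq

theorem IsComposition.left_local : leftLeaves P.flatten (compTree P That Tloc) a =
    (leftLeaves (localPart P (P.getD q [])) (Tloc q) a).map (off P q + ·) := by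
  rw [leftLeaves, h.proj_local hg hq, first_shift, leaves_shift]; rfl

theorem IsComposition.right_local : rightLeaves P.flatten (compTree P That Tloc) a =
    (rightLeaves (localPart P (P.getD q [])) (Tloc q) a).map (off P q + ·) := by
  rw [rightLeaves, h.proj_local hg hq, tail_shift, leaves_shift]; rfl

theorem IsComposition.dove_local : doveFeathers P.flatten (compTree P That Tloc) a =
    (doveFeathers (localPart P (P.getD q [])) (Tloc q) a).map (off P q + ·) := by
  rw [doveFeathers, doveQuills, h.proj_local hg hq, first_shift, hangingOffLeft_shift,
    rightmostLeaves_shift]; rfl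

theorem IsComposition.hawk_local : hawkFeathers P.flatten (compTree P That Tloc) a =
    (hawkFeathers (localPart P (P.getD q [])) (Tloc q) a).map (off P q + ·) := by
  rw [hawkFeathers, hawkQuills, h.proj_local hg hq, tail_shift, hangingOffRight_shift,
    leftmostLeaves_shift]; rfl

end Composition

theorem base_left (S : List (List α)) (a : α) : leftLeaves S (ofLeaves (List.range S.length)) a =
    ((List.range S.length).filter fun p => a ∈ blockSet S p).take 1 := by
  rw [leftLeaves, proj_of_not_hasNode (not_hasNode_ofLeaves a _), leaves_ofLeaves]
  cases (List.range S.length).filter _ <;> simp [first, leaves]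

theorem base_right (S : List (List α)) (a : α) : rightLeaves S (ofLeaves (List.range S.length)) a =
    ((List.range S.length).filter fun p => a ∈ blockSet S p).tail := by
  rw [rightLeaves, proj_of_not_hasNode (not_hasNode_ofLeaves a _), leaves_ofLeaves, tail_ofLeaves,
    leaves_ofLeaves]

/-- In a sequence of at most two blocks, the leaves are the wing tips. -/
theorem base_dove {S : List (List α)} (a : α) :
    doveFeathers S (ofLeaves (List.range S.length)) a = [] := by
  rw [doveFeathers, doveQuills, proj_of_not_hasNode (not_hasNode_ofLeaves a _), leaves_ofLeaves]
  cases (List.range S.length).filter _ <;> simp [first, hangingOffLeft, rightmostLeaves]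

theorem base_hawk {S : List (List α)} (hS : S.length ≤ 2) (a : α) :
    hawkFeathers S (ofLeaves (List.range S.length)) a = [] := by
  rw [hawkFeathers, hawkQuills, proj_of_not_hasNode (not_hasNode_ofLeaves a _), leaves_ofLeaves,
    tail_ofLeaves, hangingOffRight_ofLeaves, leftmostLeaves_ofLeaves, ← List.length_eq_zero_iff]
  have := List.length_filter_le (fun p => decide (a ∈ blockSet S p)) (List.range S.length)
  rw [List.length_range] at this
  rw [List.length_dropLast, List.length_tail]
  omega

/-- Two occurrences guarantee a second head: a local symbol gets it from its interval's tree, a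
global one from the contracted sequence, where it also occurs twice. -/
theorem IsDerivationTree.exists_mem_right {S : List (List α)} {T : Forest α}
    (h : IsDerivationTree S T) {a : α} {x y : ℕ} (hx : a ∈ blockSet S x) (hy : a ∈ blockSet S y)
    (hxy : x < y) : ∃ z, z ∈ rightLeaves S T a := by
  revert x y
  refine h.induct (motive := fun S T => ∀ {x y}, a ∈ blockSet S x → a ∈ blockSet S y → x < y →
    ∃ z, z ∈ rightLeaves S T a) ?_ ?_
  · intro S _ x y hx hy hxy
    rw [base_right]
    refine ⟨y, mem_tail_of_lt (List.pairwise_lt_range.filter _) (x := x) ?_ ?_ hxy⟩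
    · simpa using ⟨lt_length_of_mem_blockSet hx, hx⟩
    · simpa using ⟨lt_length_of_mem_blockSet hy, hy⟩
  · intro P That Tloc hc hhat hloc x y hx hy hxy
    obtain ⟨q, p, hp, rfl, hx'⟩ := exists_eq_off_add_of_mem hx
    obtain ⟨r, p', hp', rfl, hy'⟩ := exists_eq_off_add_of_mem hy
    by_cases hg : IsGlobal P a
    · obtain ⟨u, v, huv, hu, hv⟩ := isGlobal_iff.1 hg
      have hu' := mem_blockSet_contract.2 ⟨hu, hg⟩
      have hv' := mem_blockSet_contract.2 ⟨hv, hg⟩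
      obtain ⟨z, hz⟩ := hhat hu' hv' huv
      have hz' : a ∈ blockSet (contract P) z := hc.hat.mem_left_or_right.1 (Or.inr hz)
      obtain ⟨w, hw, hw'⟩ := exists_mem_blockSet_of_mem_syms (mem_blockSet_contract.1 hz').1
      exact ⟨_, (hc.mem_right_global hg hw hw').2 hz⟩
    · have hq := mem_syms_of_mem_blockSet hx'
      obtain rfl := eq_of_not_isGlobal hg hq (mem_syms_of_mem_blockSet hy')
      rw [hc.right_local hg hq]
      have hl : ∀ x, a ∈ blockSet (P.getD q []) x →
          a ∈ blockSet (localPart P (P.getD q [])) x := fun x hx => by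
        rw [localPart_eq_restrict, mem_blockSet_restrict]; exact ⟨hx, hg⟩
      obtain ⟨z, hz⟩ := hloc q (lt_of_mem_syms hq) (hl _ hx') (hl _ hy') (by omega)
      exact ⟨_, List.mem_map_of_mem hz⟩

theorem mem_blockSet_localPart {P : List (List (List α))} {a : α} {q x : ℕ} :
    a ∈ blockSet (localPart P (P.getD q [])) x ↔ a ∈ blockSet (P.getD q []) x ∧ ¬ IsGlobal P a := by
  rw [localPart_eq_restrict, mem_blockSet_restrict]

/-! ### Alternations around non-feathers -/

/-- If `a` is not a dove feather at `x`, and neither `a` nor `b` is the tip of its left wing, then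
`a … b` occurs before or after `x`. -/
theorem IsDerivationTree.dove_alternation {S : List (List α)} {T : Forest α}
    (h : IsDerivationTree S T) {a b : α} {x : ℕ} (ha : x ∈ leftLeaves S T a)
    (hb : x ∈ leftLeaves S T b) (hf : x ∉ doveFeathers S T a) (ha' : ∃ y < x, a ∈ blockSet S y)
    (hb' : ∃ y < x, b ∈ blockSet S y) :
    [a, b].Sublist (S.take x).flatten ∨ [a, b].Sublist (S.drop (x + 1)).flatten := by
  revert x
  refine h.induct (motive := fun S T => ∀ {x : ℕ}, x ∈ leftLeaves S T a → x ∈ leftLeaves S T b →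
    x ∉ doveFeathers S T a → (∃ y < x, a ∈ blockSet S y) → (∃ y < x, b ∈ blockSet S y) →
    [a, b].Sublist (S.take x).flatten ∨ [a, b].Sublist (S.drop (x + 1)).flatten) ?_ ?_
  · intro S hS x ha _ _ ⟨y, hy, hy'⟩ _
    obtain ⟨q, -, hq, hle⟩ := (IsDerivationTree.base S hS).head?_left ha
    -- With at most two blocks, the only leaf below the left head is the first occurrence, which
    -- contradicts the earlier one at `y`.
    have hq' : x = q := by
      change (leftLeaves S (ofLeaves (List.range S.length)) a).head? = some q at hq
      rw [base_left] at ha hq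
      generalize (List.range S.length).filter _ = l at ha hq
      cases l <;> simp_all
    have := hle y hy'
    omega
  · intro P That Tloc hc hhat hloc x ha hb hf ⟨y, hyx, hy⟩ ⟨z, hzx, hz⟩
    have hax := hc.comp.mem_left_or_right.1 (Or.inl ha)
    have hbx := hc.comp.mem_left_or_right.1 (Or.inl hb)
    obtain ⟨q, p, hp, rfl, hap⟩ := exists_eq_off_add_of_mem hax
    have hbp := hbx
    rw [blockSet_off_add hp] at hbp
    have haq := mem_syms_of_mem_blockSet hap
    have hbq := mem_syms_of_mem_blockSet hbp
    have hq := lt_of_mem_syms haq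
    obtain ⟨r, p', hp', rfl, hy'⟩ := exists_eq_off_add_of_mem hy
    obtain ⟨t, p'', hp'', rfl, hz'⟩ := exists_eq_off_add_of_mem hz
    have har := mem_syms_of_mem_blockSet hy'
    have hbt := mem_syms_of_mem_blockSet hz'
    -- a global symbol whose left wing ends in this interval has a feather here
    have hwing : IsGlobal P a → ∃ u < q, a ∈ syms P u := by
      intro hga
      by_contra! hcon
      have hqa := (hc.mem_left_global hga hp hap).1 ha
      obtain ⟨u, hu, hu', hle⟩ := hc.hat.head?_left hqa
      have huq : u = q := by
        refine le_antisymm (hle q (mem_blockSet_contract.2 ⟨haq, hga⟩)) ?_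
        by_contra hlt
        exact hcon u (by omega) (mem_blockSet_contract.1 (hc.hat.mem_left_or_right.1 (Or.inl hu))).1
      subst huq
      refine hf ?_
      rw [hc.dove_global hga hu']
      refine List.mem_append_left _ (mem_tail_of_lt (pairwise_occPos a u) ?_ ?_ hyx)
      · refine (off_add_mem_occPos hp').2 ⟨?_, hy'⟩
        refine le_antisymm (lt_of_off_add_lt hp hyx.le) ?_
        by_contra hlt
        exact hcon r (by omega) har
      · exact (off_add_mem_occPos hp).2 ⟨rfl, hap⟩
    -- If `b` misses all earlier intervals, its occurrence before `x` lies in interval `q`, to the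
    -- right of an `a` in an earlier interval.
    have hbefore : (∃ u < q, a ∈ syms P u) → (∀ u < q, b ∉ syms P u) →
        [a, b].Sublist (P.flatten.take (off P q + p)).flatten := by
      rintro ⟨u, huq, hu⟩ hnb
      obtain ⟨w, hw, hw'⟩ := exists_mem_blockSet_of_mem_syms hu
      have htq : q ≤ t := by by_contra hlt; exact hnb t (by omega) hbt
      rw [← blockSet_off_add hw] at hw'
      exact pair_sublist_take hw' hz (off_add_lt_off_add hw (by omega)) hzx
    -- For global `b`, interval `q` lies below its left head, so an occurrence below the right head
    -- is in a later interval, to the right of any `a` that follows `x` inside `q`.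
    have hafter : IsGlobal P b → (∃ w, w < (P.getD q []).length ∧ p < w ∧
        a ∈ blockSet (P.getD q []) w) →
        [a, b].Sublist (P.flatten.drop (off P q + p + 1)).flatten := by
      rintro hgb ⟨w, hw, hpw, haw⟩
      have hqb := (hc.mem_left_global hgb hp hbp).1 hb
      obtain ⟨u, v, huv, hu, hv⟩ := isGlobal_iff.1 hgb
      obtain ⟨g, hg⟩ := hc.hat.exists_mem_right (mem_blockSet_contract.2 ⟨hu, hgb⟩)
        (mem_blockSet_contract.2 ⟨hv, hgb⟩) huv
      have hqg := hc.hat.left_lt_right hqb hg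
      have hg' := (mem_blockSet_contract.1 (hc.hat.mem_left_or_right.1 (Or.inr hg))).1
      obtain ⟨k, hk, hk'⟩ := exists_mem_blockSet_of_mem_syms hg'
      rw [← blockSet_off_add hw] at haw
      rw [← blockSet_off_add hk] at hk'
      exact pair_sublist_drop haw hk' (off_add_lt_off_add hw hqg) (by omega)
    by_cases hga : IsGlobal P a
    · by_cases hnb : ∀ u < q, b ∉ syms P u
      · exact Or.inl (hbefore (hwing hga) hnb)
      · push Not at hnb
        obtain ⟨u, huq, hu⟩ := hnb
        have hgb : IsGlobal P b := isGlobal_iff.2 ⟨u, q, huq, hu, hbq⟩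
        by_cases hlast : ∃ w, w < (P.getD q []).length ∧ p < w ∧ a ∈ blockSet (P.getD q []) w
        · exact Or.inr (hafter hgb hlast)
        · obtain ⟨v, hvq, hv⟩ := hwing hga
          have hqa := (hc.mem_left_global hga hp hap).1 ha
          have hqb := (hc.mem_left_global hgb hp hbp).1 hb
          obtain ⟨u', hu', hu'', -⟩ := hc.hat.head?_left hqa
          -- In the remaining case `x` is the last occurrence of `a` in its interval. A feather of
          -- `a` at `q` in the contracted sequence would thus become a feather at `x`, so the
          -- induction hypothesis applies to `q`.
          refine (hhat hqa hqb ?_ ⟨v, hvq, mem_blockSet_contract.2 ⟨hv, hga⟩⟩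
            ⟨u, huq, mem_blockSet_contract.2 ⟨hu, hgb⟩⟩).imp
              (fun h => h.trans (contract_take_sublist' q p))
              (fun h => h.trans (contract_drop_sublist' hp))
          intro hqf
          refine hf ?_
          rw [hc.dove_global hga hu'']
          refine List.mem_append_right _ (List.mem_flatMap.2 ⟨q, hqf, ?_⟩)
          rw [getLast?_eq_of_le (pairwise_occPos a q) ((off_add_mem_occPos hp).2 ⟨rfl, hap⟩)]
          · simp
          · intro x hx
            obtain ⟨w, hw, rfl, haw⟩ := mem_occPos.1 hx
            by_contra hlt
            exact hlast ⟨w, hw, by omega, haw⟩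
    · obtain rfl := eq_of_not_isGlobal hga haq har
      by_cases hgb : IsGlobal P b
      · refine Or.inr (hafter hgb ?_)
        -- `a` is local and occurs twice, so its right head provides an occurrence after `x` in the
        -- same interval.
        obtain ⟨v, hv⟩ := hc.comp.exists_mem_right hy hax hyx
        have hv' := hc.comp.mem_left_or_right.1 (Or.inr hv)
        have hlt := hc.comp.left_lt_right ha hv
        obtain ⟨g, w, hw, rfl, haw⟩ := exists_eq_off_add_of_mem hv'
        obtain rfl := eq_of_not_isGlobal hga haq (mem_syms_of_mem_blockSet haw)
        exact ⟨w, hw, by omega, haw⟩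
      · obtain rfl := eq_of_not_isGlobal hgb hbq hbt
        rw [hc.left_local hga haq] at ha
        rw [hc.left_local hgb hbq] at hb
        rw [hc.dove_local hga haq] at hf
        simp only [List.mem_map, Nat.add_left_cancel_iff, exists_eq_right] at ha hb hf
        exact (hloc q hq ha hb hf ⟨p', by omega, mem_blockSet_localPart.2 ⟨hy', hga⟩⟩
          ⟨p'', by omega, mem_blockSet_localPart.2 ⟨hz', hgb⟩⟩).imp
            (fun h => h.trans (localPart_take_sublist' hp))
            (fun h => h.trans (localPart_drop_sublist' hp))

/-- If `a` is not a hawk feather at `x`, and neither `a` nor `b` is the tip of its right wing, then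
`b … a` occurs before or after `x`. -/
theorem IsDerivationTree.hawk_alternation {S : List (List α)} {T : Forest α}
    (h : IsDerivationTree S T) {a b : α} {x : ℕ} (ha : x ∈ rightLeaves S T a)
    (hb : x ∈ rightLeaves S T b) (hf : x ∉ hawkFeathers S T a) (ha' : ∃ y > x, a ∈ blockSet S y)
    (hb' : ∃ y > x, b ∈ blockSet S y) :
    [b, a].Sublist (S.take x).flatten ∨ [b, a].Sublist (S.drop (x + 1)).flatten := by
  revert x
  refine h.induct (motive := fun S T => ∀ {x : ℕ}, x ∈ rightLeaves S T a → x ∈ rightLeaves S T b →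
    x ∉ hawkFeathers S T a → (∃ y > x, a ∈ blockSet S y) → (∃ y > x, b ∈ blockSet S y) →
    [b, a].Sublist (S.take x).flatten ∨ [b, a].Sublist (S.drop (x + 1)).flatten) ?_ ?_
  · intro S hS x ha _ _ ⟨y, hy, hy'⟩ _
    have hT := IsDerivationTree.base S hS
    -- Here `q < x < y` would be three positions in at most two blocks.
    obtain ⟨q, hq⟩ := hT.exists_mem_left hy'
    have h1 := hT.left_lt_right hq ha
    have h2 := lt_length_of_mem_blockSet hy'
    omega
  · intro P That Tloc hc hhat hloc x ha hb hf ⟨y, hyx, hy⟩ ⟨z, hzx, hz⟩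
    have hax := hc.comp.mem_left_or_right.1 (Or.inr ha)
    have hbx := hc.comp.mem_left_or_right.1 (Or.inr hb)
    obtain ⟨q, p, hp, rfl, hap⟩ := exists_eq_off_add_of_mem hax
    have hbp := hbx
    rw [blockSet_off_add hp] at hbp
    have haq := mem_syms_of_mem_blockSet hap
    have hbq := mem_syms_of_mem_blockSet hbp
    have hq := lt_of_mem_syms haq
    obtain ⟨r, p', hp', rfl, hy'⟩ := exists_eq_off_add_of_mem hy
    obtain ⟨t, p'', hp'', rfl, hz'⟩ := exists_eq_off_add_of_mem hz
    have har := mem_syms_of_mem_blockSet hy'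
    have hbt := mem_syms_of_mem_blockSet hz'
    -- a global symbol whose right wing ends in this interval has a feather here
    have hwing : IsGlobal P a → ∃ u > q, a ∈ syms P u := by
      intro hga
      by_contra! hcon
      have hqa := (hc.mem_right_global hga hp hap).1 ha
      obtain ⟨u, hu, hu', hle⟩ := hc.hat.getLast?_right hqa
      have huq : u = q := by
        refine le_antisymm ?_ (hle q (mem_blockSet_contract.2 ⟨haq, hga⟩))
        by_contra hlt
        exact hcon u (by omega)
          (mem_blockSet_contract.1 (hc.hat.mem_left_or_right.1 (Or.inr hu))).1
      subst huq
      refine hf ?_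
      rw [hc.hawk_global hga hu']
      refine List.mem_append_right _ (mem_dropLast_of_lt (pairwise_occPos a u) ?_ ?_ hyx)
      · exact (off_add_mem_occPos hp).2 ⟨rfl, hap⟩
      · refine (off_add_mem_occPos hp').2 ⟨?_, hy'⟩
        refine le_antisymm ?_ (lt_of_off_add_lt hp' hyx.le)
        by_contra hlt
        exact hcon r (by omega) har
    have hafter : (∃ u > q, a ∈ syms P u) → (∀ u > q, b ∉ syms P u) →
        [b, a].Sublist (P.flatten.drop (off P q + p + 1)).flatten := by
      rintro ⟨u, huq, hu⟩ hnb
      obtain ⟨w, hw, hw'⟩ := exists_mem_blockSet_of_mem_syms hu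
      have htq : t ≤ q := by by_contra hlt; exact hnb t (by omega) hbt
      rw [← blockSet_off_add hw] at hw'
      exact pair_sublist_drop hz hw' (off_add_lt_off_add hp'' (by omega)) hzx
    have hbefore : IsGlobal P b → (∃ w, w < (P.getD q []).length ∧ w < p ∧
        a ∈ blockSet (P.getD q []) w) →
        [b, a].Sublist (P.flatten.take (off P q + p)).flatten := by
      rintro hgb ⟨w, hw, hpw, haw⟩
      have hqb := (hc.mem_right_global hgb hp hbp).1 hb
      obtain ⟨g, hg⟩ := hc.hat.exists_mem_left (mem_blockSet_contract.2 ⟨hbq, hgb⟩)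
      have hqg := hc.hat.left_lt_right hg hqb
      have hg' := (mem_blockSet_contract.1 (hc.hat.mem_left_or_right.1 (Or.inl hg))).1
      obtain ⟨k, hk, hk'⟩ := exists_mem_blockSet_of_mem_syms hg'
      rw [← blockSet_off_add hw] at haw
      rw [← blockSet_off_add hk] at hk'
      exact pair_sublist_take hk' haw (off_add_lt_off_add hk hqg) (by omega)
    by_cases hga : IsGlobal P a
    · by_cases hnb : ∀ u > q, b ∉ syms P u
      · exact Or.inr (hafter (hwing hga) hnb)
      · push Not at hnb
        obtain ⟨u, huq, hu⟩ := hnb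
        have hgb : IsGlobal P b := isGlobal_iff.2 ⟨q, u, huq, hbq, hu⟩
        by_cases hfirst : ∃ w, w < (P.getD q []).length ∧ w < p ∧ a ∈ blockSet (P.getD q []) w
        · exact Or.inl (hbefore hgb hfirst)
        · obtain ⟨v, hvq, hv⟩ := hwing hga
          have hqa := (hc.mem_right_global hga hp hap).1 ha
          have hqb := (hc.mem_right_global hgb hp hbp).1 hb
          obtain ⟨u', hu', hu'', -⟩ := hc.hat.getLast?_right hqa
          refine (hhat hqa hqb ?_ ⟨v, hvq, mem_blockSet_contract.2 ⟨hv, hga⟩⟩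
            ⟨u, huq, mem_blockSet_contract.2 ⟨hu, hgb⟩⟩).imp
              (fun h => h.trans (contract_take_sublist' q p))
              (fun h => h.trans (contract_drop_sublist' hp))
          intro hqf
          refine hf ?_
          rw [hc.hawk_global hga hu'']
          refine List.mem_append_left _ (List.mem_flatMap.2 ⟨q, hqf, ?_⟩)
          rw [head?_eq_of_le (pairwise_occPos a q) ((off_add_mem_occPos hp).2 ⟨rfl, hap⟩)]
          · simp
          · intro x hx
            obtain ⟨w, hw, rfl, haw⟩ := mem_occPos.1 hx
            by_contra hlt
            exact hfirst ⟨w, hw, by omega, haw⟩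
    · obtain rfl := eq_of_not_isGlobal hga haq har
      by_cases hgb : IsGlobal P b
      · refine Or.inl (hbefore hgb ?_)
        obtain ⟨v, hv⟩ := hc.comp.exists_mem_left hax
        have hv' := hc.comp.mem_left_or_right.1 (Or.inl hv)
        have hlt := hc.comp.left_lt_right hv ha
        obtain ⟨g, w, hw, rfl, haw⟩ := exists_eq_off_add_of_mem hv'
        obtain rfl := eq_of_not_isGlobal hga haq (mem_syms_of_mem_blockSet haw)
        exact ⟨w, hw, by omega, haw⟩
      · obtain rfl := eq_of_not_isGlobal hgb hbq hbt
        rw [hc.right_local hga haq] at ha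
        rw [hc.right_local hgb hbq] at hb
        rw [hc.hawk_local hga haq] at hf
        simp only [List.mem_map, Nat.add_left_cancel_iff, exists_eq_right] at ha hb hf
        exact (hloc q hq ha hb hf ⟨p', by omega, mem_blockSet_localPart.2 ⟨hy', hga⟩⟩
          ⟨p'', by omega, mem_blockSet_localPart.2 ⟨hz', hgb⟩⟩).imp
            (fun h => h.trans (localPart_take_sublist' hp))
            (fun h => h.trans (localPart_drop_sublist' hp))

end Wings

end DavenportSchinzel

namespace DavenportSchinzel
open Forest

/-! ### Recurrences -/

section Feathers

variable {α : Type*} [DecidableEq α]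

/-- The set of all feathers. -/
def featherSet (S : List (List α)) (T : Forest α) : Finset (α × ℕ) :=
  (S.flatten.toFinset ×ˢ Finset.range S.length).filter fun x => IsFeather S T x.1 x.2

theorem card_featherSet (S : List (List α)) (T : Forest α) :
    (featherSet S T).card = featherCount S T := rfl

theorem IsDerivationTree.mem_featherSet {S : List (List α)} {T : Forest α}
    (h : IsDerivationTree S T) {a : α} {p : ℕ} :
    (a, p) ∈ featherSet S T ↔ p ∈ doveFeathers S T a ∨ p ∈ hawkFeathers S T a := by
  have : IsFeather S T a p ↔ p ∈ doveFeathers S T a ∨ p ∈ hawkFeathers S T a := Iff.rfl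
  rw [featherSet, Finset.mem_filter, this, and_iff_right_iff_imp]
  intro hp
  have ha : a ∈ blockSet S p := h.mem_left_or_right.1
    (hp.imp (fun h => doveFeathers_subset _ _ _ h) (fun h => hawkFeathers_subset _ _ _ h))
  rw [Finset.mem_product, List.mem_toFinset, Finset.mem_range]
  exact ⟨mem_flatten_iff_blockSet.2 ⟨p, ha⟩, lt_length_of_mem_blockSet ha⟩

/-- The set of all occurrences of symbols in blocks. -/
def occSet (S : List (List α)) : Finset (α × ℕ) :=
  (S.flatten.toFinset ×ˢ Finset.range S.length).filter fun x => x.1 ∈ blockSet S x.2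

theorem mem_occSet {S : List (List α)} {a : α} {p : ℕ} :
    (a, p) ∈ occSet S ↔ a ∈ blockSet S p := by
  rw [occSet, Finset.mem_filter, and_iff_right_iff_imp]
  intro ha
  rw [Finset.mem_product, List.mem_toFinset, Finset.mem_range]
  exact ⟨mem_flatten_iff_blockSet.2 ⟨p, ha⟩, lt_length_of_mem_blockSet ha⟩

theorem card_occSet_le (S : List (List α)) : (occSet S).card ≤ S.flatten.length := by
  have h : occSet S ⊆ (Finset.range S.length).biUnion fun p =>
      (blockSet S p).image fun a => (a, p) := by
    rintro ⟨a, p⟩ h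
    rw [mem_occSet] at h
    exact Finset.mem_biUnion.2 ⟨p, Finset.mem_range.2 (lt_length_of_mem_blockSet h),
      Finset.mem_image_of_mem _ h⟩
  refine (Finset.card_le_card h).trans (Finset.card_biUnion_le.trans ?_)
  rw [length_flatten_eq_sum]
  exact Finset.sum_le_sum fun p _ => Finset.card_image_le.trans (List.toFinset_card_le _)

/-- Feathers of local symbols come from the trees of the intervals. A feather of a global symbol
either stems from one feather of the contracted sequence, or lies in the interval where the symbol
starts or ends. In the latter intervals all occurrences of the symbol are counted. -/
theorem IsComposition.featherCount_le {P : List (List (List α))} {That : Forest α}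
    {Tloc : ℕ → Forest α} (hc : IsComposition P That Tloc) :
    featherCount P.flatten (compTree P That Tloc) ≤
      ∑ q ∈ Finset.range P.length, featherCount (localPart P (P.getD q [])) (Tloc q)
      + featherCount (contract P) That
      + ∑ q ∈ Finset.range P.length, (restrict (StartsAt P q) (P.getD q [])).flatten.length
      + ∑ q ∈ Finset.range P.length, (restrict (EndsAt P q) (P.getD q [])).flatten.length := by
  classical
  set sh : ℕ → α × ℕ → α × ℕ := fun q x => (x.1, off P q + x.2) with hsh
  -- A left feather of the contracted sequence moves to the last occurrence in its interval, a right
  -- one to the first. Left and right leaves are disjoint, so membership on the left tells which;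
  -- the default `0` is never reached at a feather.
  set g : α × ℕ → α × ℕ := fun x => (x.1, if x.2 ∈ leftLeaves (contract P) That x.1 then
    (occPos P x.1 x.2).getLast?.getD 0 else (occPos P x.1 x.2).head?.getD 0) with hg
  set U₁ := (Finset.range P.length).biUnion fun q =>
    (featherSet (localPart P (P.getD q [])) (Tloc q)).image (sh q) with hU₁
  set U₂ := (featherSet (contract P) That).image g with hU₂
  set U₃ := (Finset.range P.length).biUnion fun q =>
    (occSet (restrict (StartsAt P q) (P.getD q []))).image (sh q) with hU₃
  set U₄ := (Finset.range P.length).biUnion fun q =>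
    (occSet (restrict (EndsAt P q) (P.getD q []))).image (sh q) with hU₄
  have hsub : featherSet P.flatten (compTree P That Tloc) ⊆ U₁ ∪ U₂ ∪ U₃ ∪ U₄ := by
    rintro ⟨a, x⟩ hx
    simp only [Finset.mem_union]
    rw [hc.comp.mem_featherSet] at hx
    have hax : a ∈ blockSet P.flatten x := hc.comp.mem_left_or_right.1
      (hx.imp (fun h => doveFeathers_subset _ _ _ h) (fun h => hawkFeathers_subset _ _ _ h))
    obtain ⟨q, p, hp, rfl, hap⟩ := exists_eq_off_add_of_mem hax
    have haq := mem_syms_of_mem_blockSet hap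
    have hq := Finset.mem_range.2 (lt_of_mem_syms haq)
    by_cases hga : IsGlobal P a
    · rcases hx with hx | hx
      · obtain ⟨u, hu, hu', hle⟩ := hc.hat.head?_left
          ((hc.mem_left_global hga hp hap).1 (doveFeathers_subset _ _ _ hx))
        rw [hc.dove_global hga hu', List.mem_append, List.mem_flatMap] at hx
        rcases hx with hx | ⟨r, hr, hx⟩
        · obtain ⟨rfl, -⟩ := (off_add_mem_occPos hp).1 (List.mem_of_mem_tail hx)
          refine Or.inl (Or.inr (Finset.mem_biUnion.2 ⟨q, hq, Finset.mem_image.2 ⟨(a, p), ?_, rfl⟩⟩))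
          rw [mem_occSet, mem_blockSet_restrict]
          refine ⟨hap, hga, fun r hr har => ?_⟩
          have := hle r (mem_blockSet_contract.2 ⟨har, hga⟩)
          omega
        · refine Or.inl (Or.inl (Or.inr (Finset.mem_image.2
            ⟨(a, r), hc.hat.mem_featherSet.2 (Or.inl hr), ?_⟩)))
          rw [Option.mem_toList] at hx
          simp only [hg, if_pos (doveFeathers_subset _ _ _ hr)]
          rw [hx]; rfl
      · obtain ⟨u, hu, hu', hle⟩ := hc.hat.getLast?_right
          ((hc.mem_right_global hga hp hap).1 (hawkFeathers_subset _ _ _ hx))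
        rw [hc.hawk_global hga hu', List.mem_append, List.mem_flatMap] at hx
        rcases hx with ⟨r, hr, hx⟩ | hx
        · refine Or.inl (Or.inl (Or.inr (Finset.mem_image.2
            ⟨(a, r), hc.hat.mem_featherSet.2 (Or.inr hr), ?_⟩)))
          have hnl : r ∉ leftLeaves (contract P) That a := fun hl =>
            (hc.hat.left_lt_right hl (hawkFeathers_subset _ _ _ hr)).ne rfl
          rw [Option.mem_toList] at hx
          simp only [hg, if_neg hnl]
          rw [hx]; rfl
        · obtain ⟨rfl, -⟩ := (off_add_mem_occPos hp).1 (List.mem_of_mem_dropLast hx)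
          refine Or.inr (Finset.mem_biUnion.2 ⟨q, hq, Finset.mem_image.2 ⟨(a, p), ?_, rfl⟩⟩)
          rw [mem_occSet, mem_blockSet_restrict]
          refine ⟨hap, hga, fun r hr har => ?_⟩
          have := hle r (mem_blockSet_contract.2 ⟨har, hga⟩)
          omega
    · refine Or.inl (Or.inl (Or.inl (Finset.mem_biUnion.2 ⟨q, hq, Finset.mem_image.2
        ⟨(a, p), ?_, rfl⟩⟩)))
      rw [(hc.loc q (Finset.mem_range.1 hq)).mem_featherSet]
      rw [hc.dove_local hga haq, hc.hawk_local hga haq] at hx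
      simpa only [List.mem_map, Nat.add_left_cancel_iff, exists_eq_right] using hx
  have h1 : U₁.card ≤ _ := Finset.card_biUnion_le.trans
    (Finset.sum_le_sum fun q _ => Finset.card_image_le)
  have h2 : U₂.card ≤ _ := Finset.card_image_le
  have h3 : U₃.card ≤ _ := Finset.card_biUnion_le.trans
    (Finset.sum_le_sum fun q _ => Finset.card_image_le.trans (card_occSet_le _))
  have h4 : U₄.card ≤ _ := Finset.card_biUnion_le.trans
    (Finset.sum_le_sum fun q _ => Finset.card_image_le.trans (card_occSet_le _))
  have h5 := Finset.card_le_card hsub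
  have h6 := Finset.card_union_le (U₁ ∪ U₂ ∪ U₃) U₄
  have h7 := Finset.card_union_le (U₁ ∪ U₂) U₃
  have h8 := Finset.card_union_le U₁ U₂
  rw [card_featherSet] at h5 h2
  simp only [card_featherSet] at h1
  omega

theorem length_filter_le_of_cover {β : Type*} (l : List β) (p p₁ p₂ p₃ : β → Bool)
    (h : ∀ a ∈ l, p a → p₁ a ∨ p₂ a ∨ p₃ a) :
    (l.filter p).length ≤ (l.filter p₁).length + (l.filter p₂).length + (l.filter p₃).length := by
  induction l with
  | nil => simp
  | cons a l ih =>
    have h1 := ih (fun b hb => h b (by simp [hb]))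
    have h2 := h a (by simp)
    simp only [← List.countP_eq_length_filter, List.countP_cons] at h1 ⊢
    by_cases hp : p a
    · rcases h2 hp with h | h | h <;> simp only [h, hp, if_true] <;> omega
    · simp only [hp]; simp only [Bool.false_eq_true, if_false]; omega

/-- The symbol `a` passes the `q`-th interval, below its left head but not at a feather. -/
def PassesDove (P : List (List (List α))) (That : Forest α) (q : ℕ) (a : α) : Prop :=
  PassesAt P q a ∧ q ∈ leftLeaves (contract P) That a ∧ q ∉ doveFeathers (contract P) That a

/-- The symbol `a` passes the `q`-th interval, below its right head but not at a feather. -/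
def PassesHawk (P : List (List (List α))) (That : Forest α) (q : ℕ) (a : α) : Prop :=
  PassesAt P q a ∧ q ∈ rightLeaves (contract P) That a ∧ q ∉ hawkFeathers (contract P) That a

/-- The symbol `a` passes the `q`-th interval, at a feather. -/
def PassesFeather (P : List (List (List α))) (That : Forest α) (q : ℕ) (a : α) : Prop :=
  PassesAt P q a ∧ (a, q) ∈ featherSet (contract P) That

variable {P : List (List (List α))} {That : Forest α}

theorem length_passesAt_le (hT : IsDerivationTree (contract P) That) (q : ℕ) :
    (restrict (PassesAt P q) (P.getD q [])).flatten.length ≤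
      (restrict (PassesFeather P That q) (P.getD q [])).flatten.length
      + (restrict (PassesDove P That q) (P.getD q [])).flatten.length
      + (restrict (PassesHawk P That q) (P.getD q [])).flatten.length := by
  classical
  simp only [flatten_restrict]
  refine length_filter_le_of_cover _ _ _ _ _ fun a ha hp => ?_
  rw [decide_eq_true_eq] at hp
  have h : PassesFeather P That q a ∨ PassesDove P That q a ∨ PassesHawk P That q a := by
    by_cases hf : (a, q) ∈ featherSet (contract P) That
    · exact Or.inl ⟨hp, hf⟩
    · rw [hT.mem_featherSet, not_or] at hf
      rcases hT.mem_left_or_right.2 (mem_blockSet_contract.2 ⟨mem_syms.2 ha, hp.1⟩) with h | h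
      exacts [Or.inr (Or.inl ⟨hp, h, hf.1⟩), Or.inr (Or.inr ⟨hp, h, hf.2⟩)]
  simpa only [decide_eq_true_eq] using h

theorem sum_nsym_passesFeather_le :
    ∑ q ∈ Finset.range P.length, nsym (restrict (PassesFeather P That q) (P.getD q [])) ≤
      featherCount (contract P) That := by
  classical
  rw [← card_featherSet, Finset.card_eq_sum_card_fiberwise (f := Prod.snd)
    (t := Finset.range P.length)]
  · refine Finset.sum_le_sum fun q _ => ?_
    rw [nsym_restrict]
    refine Finset.card_le_card_of_injOn (fun a => (a, q)) ?_ ?_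
    · intro a ha
      simp only [Finset.coe_filter, Set.mem_ofPred_eq] at ha ⊢
      exact ⟨ha.2.2, trivial⟩
    · intro a _ b _ hab
      exact (Prod.ext_iff.1 hab).1
  · intro x hx
    simp only [featherSet, Finset.coe_filter, Set.mem_ofPred_eq, Finset.mem_product,
      length_contract] at hx
    simpa using hx.1.2

/-- The left and right leaves of a symbol are disjoint, so the two classes together are bounded by
all passing symbols. -/
theorem sum_nsym_passesDove_add_le (hT : IsDerivationTree (contract P) That) :
    ∑ q ∈ Finset.range P.length, nsym (restrict (PassesDove P That q) (P.getD q []))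
      + ∑ q ∈ Finset.range P.length, nsym (restrict (PassesHawk P That q) (P.getD q [])) ≤
    (contract P).flatten.length := by
  classical
  refine le_trans ?_ ((Nat.le_add_right _ _).trans (sum_nsym_passesAt_le (P := P)))
  rw [← Finset.sum_add_distrib]
  refine Finset.sum_le_sum fun q _ => ?_
  simp only [nsym_restrict]
  rw [← Finset.card_union_of_disjoint]
  · refine Finset.card_le_card fun a ha => ?_
    simp only [Finset.mem_union, Finset.mem_filter] at ha ⊢
    rcases ha with ha | ha
    exacts [⟨ha.1, ha.2.1⟩, ⟨ha.1, ha.2.1⟩]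
  · rw [Finset.disjoint_left]
    intro a ha hb
    simp only [Finset.mem_filter] at ha hb
    exact (hT.left_lt_right ha.2.2.1 hb.2.2.1).ne rfl

theorem IsBlocked.restrict_passesFeather {s : ℕ} (h : IsBlocked (s + 2) P.flatten) (q : ℕ) :
    IsBlocked s (restrict (PassesFeather P That q) (P.getD q [])) := by
  refine ⟨nodup_restrict (h.nodup_interval q), ?_⟩
  refine IsOrder.of_surround (h.2.sublist (surround_sublist _ q)) ?_ ?_
  · intro a ha
    exact mem_flatten_flatten_take.2 (mem_flatten_restrict.1 ha).2.1.2.1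
  · intro a ha
    exact mem_flatten_flatten_drop.2 (mem_flatten_restrict.1 ha).2.1.2.2

/-- A passing symbol is not at its wing tip, so `IsDerivationTree.dove_alternation` in the
contracted sequence puts `a b` before or after the interval for every pair. The order then drops by
three. -/
theorem IsBlocked.restrict_passesDove {s : ℕ} (hs : Even s) (h : IsBlocked (s + 3) P.flatten)
    (hT : IsDerivationTree (contract P) That) (q : ℕ) :
    IsBlocked s (restrict (PassesDove P That q) (P.getD q [])) := by
  refine ⟨nodup_restrict (h.nodup_interval q), ?_⟩
  refine IsOrder.of_surround_odd hs (h.2.sublist (surround_sublist _ q)) ?_ ?_ ?_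
  · intro a ha
    exact mem_flatten_flatten_take.2 (mem_flatten_restrict.1 ha).2.1.2.1
  · intro a ha
    exact mem_flatten_flatten_drop.2 (mem_flatten_restrict.1 ha).2.1.2.2
  · intro a ha b hb _
    obtain ⟨-, ⟨hga, ⟨x, hx, hx'⟩, -⟩, ha, hfa⟩ := mem_flatten_restrict.1 ha
    obtain ⟨-, ⟨hgb, ⟨y, hy, hy'⟩, -⟩, hb, -⟩ := mem_flatten_restrict.1 hb
    exact (hT.dove_alternation ha hb hfa ⟨x, hx, mem_blockSet_contract.2 ⟨hx', hga⟩⟩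
      ⟨y, hy, mem_blockSet_contract.2 ⟨hy', hgb⟩⟩).imp
        (fun h => h.trans (contract_take_sublist q))
        (fun h => h.trans (contract_drop_sublist (q + 1)))

theorem IsBlocked.restrict_passesHawk {s : ℕ} (hs : Even s) (h : IsBlocked (s + 3) P.flatten)
    (hT : IsDerivationTree (contract P) That) (q : ℕ) :
    IsBlocked s (restrict (PassesHawk P That q) (P.getD q [])) := by
  refine ⟨nodup_restrict (h.nodup_interval q), ?_⟩
  refine IsOrder.of_surround_odd hs (h.2.sublist (surround_sublist _ q)) ?_ ?_ ?_
  · intro a ha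
    exact mem_flatten_flatten_take.2 (mem_flatten_restrict.1 ha).2.1.2.1
  · intro a ha
    exact mem_flatten_flatten_drop.2 (mem_flatten_restrict.1 ha).2.1.2.2
  · intro a ha b hb _
    obtain ⟨-, ⟨hga, -, x, hx, hx'⟩, ha, -⟩ := mem_flatten_restrict.1 ha
    obtain ⟨-, ⟨hgb, -, y, hy, hy'⟩, hb, hfb⟩ := mem_flatten_restrict.1 hb
    exact (hT.hawk_alternation hb ha hfb ⟨y, hy, mem_blockSet_contract.2 ⟨hy', hgb⟩⟩
      ⟨x, hx, mem_blockSet_contract.2 ⟨hx', hga⟩⟩).imp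
        (fun h => h.trans (contract_take_sublist q))
        (fun h => h.trans (contract_drop_sublist (q + 1)))

end Feathers

/-! ### Linear bounds -/

/-- Order-`s` sequences with at most `M` blocks satisfy the linear bound with coefficients `A`
and `B`. -/
def LengthBound (s M : ℕ) (A B : ℝ) : Prop :=
  ∀ S : List (List ℕ), S ≠ [] → S.length ≤ M → IsBlocked s S →
    (S.flatten.length : ℝ) ≤ A * nsym S + B * (S.length - 1)

/-- Order-`s` sequences with at most `M` blocks have derivation trees whose number of feathers
satisfies the linear bound with coefficients `A` and `B`. -/
def FeatherBound (s M : ℕ) (A B : ℝ) : Prop :=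
  ∀ S : List (List ℕ), S ≠ [] → S.length ≤ M → IsBlocked s S →
    ∃ T, IsDerivationTree S T ∧ (featherCount S T : ℝ) ≤ A * nsym S + B * (S.length - 1)

theorem one_le_length_cast {β : Type*} {S : List β} (hS : S ≠ []) : (1 : ℝ) ≤ S.length := by
  exact_mod_cast List.length_pos_of_ne_nil hS

theorem LengthBound.mono {s M M' : ℕ} {A A' B B' : ℝ} (h : LengthBound s M A B) (hM : M' ≤ M)
    (hA : A ≤ A') (hB : B ≤ B') : LengthBound s M' A' B' := by
  intro S hS hl hb
  have h1 := one_le_length_cast hS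
  refine (h S hS (hl.trans hM) hb).trans (add_le_add ?_ ?_)
  · exact mul_le_mul_of_nonneg_right hA (Nat.cast_nonneg _)
  · exact mul_le_mul_of_nonneg_right hB (by linarith)

theorem FeatherBound.mono {s M M' : ℕ} {A A' B B' : ℝ} (h : FeatherBound s M A B) (hM : M' ≤ M)
    (hA : A ≤ A') (hB : B ≤ B') : FeatherBound s M' A' B' := by
  intro S hS hl hb
  have h1 := one_le_length_cast hS
  obtain ⟨T, hT, hle⟩ := h S hS (hl.trans hM) hb
  refine ⟨T, hT, hle.trans (add_le_add ?_ ?_)⟩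
  · exact mul_le_mul_of_nonneg_right hA (Nat.cast_nonneg _)
  · exact mul_le_mul_of_nonneg_right hB (by linarith)

/-- A single block has as many symbols as letters, and its block term vanishes whatever `B` is. -/
theorem lengthBound_one_block {s : ℕ} {A B : ℝ} (hA : 1 ≤ A) : LengthBound s 1 A B := by
  intro S hS hl hb
  match S, hS, hl, hb with
  | [D], _, _, hb =>
    have : nsym [D] = D.length := by
      rw [nsym, List.flatten_singleton, List.toFinset_card_of_nodup (hb.1 D (by simp))]
    rw [this, List.flatten_singleton]
    have := mul_le_mul_of_nonneg_right hA (Nat.cast_nonneg (α := ℝ) D.length)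
    simp only [List.length_singleton]
    push_cast
    linarith

/-- With at most two blocks every occurrence is a wing tip, so there are no feathers at all. -/
theorem featherBound_two_blocks {s : ℕ} {A B : ℝ} (hA : 0 ≤ A) (hB : 0 ≤ B) :
    FeatherBound s 2 A B := by
  intro S hS hl _
  have h := IsDerivationTree.base S hl
  refine ⟨_, h, ?_⟩
  have h0 : featherCount S (ofLeaves (List.range S.length)) = 0 := by
    rw [← card_featherSet, Finset.card_eq_zero, Finset.eq_empty_iff_forall_notMem]
    rintro ⟨a, p⟩ hx
    have h' : IsDerivationTree S (ofLeaves (List.range S.length)) := h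
    rw [h'.mem_featherSet, base_dove, base_hawk hl] at hx
    simp at hx
  have h1 := one_le_length_cast hS
  change (featherCount S (ofLeaves (List.range S.length)) : ℝ) ≤ _
  rw [h0, Nat.cast_zero]
  have : 0 ≤ B * ((S.length : ℝ) - 1) := mul_nonneg hB (by linarith)
  positivity

/-! ### Recurrences over a partition into intervals -/

/-- All intervals of `P` are nonempty and have at most `M` blocks. -/
def IsPartition (P : List (List (List ℕ))) (M : ℕ) : Prop := ∀ I ∈ P, I ≠ [] ∧ I.length ≤ M

section Recurrence

variable {P : List (List (List ℕ))} {M : ℕ} (hP : IsPartition P M)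
include hP

theorem IsPartition.getD {q : ℕ} (hq : q ∈ Finset.range P.length) :
    P.getD q [] ≠ [] ∧ (P.getD q []).length ≤ M :=
  hP _ (getD_mem (Finset.mem_range.1 hq))

/-- Each interval saves one block in the linear bound, and the savings sum to the number of
intervals. -/
theorem LengthBound.sum_le {s : ℕ} {A B : ℝ} (h : LengthBound s M A B)
    {X : ℕ → List (List ℕ)} (hX : ∀ q, (X q).length = (P.getD q []).length)
    (hb : ∀ q, IsBlocked s (X q)) {N : ℝ} (hA : 0 ≤ A)
    (hN : ((∑ q ∈ Finset.range P.length, nsym (X q) : ℕ) : ℝ) ≤ N) :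
    ((∑ q ∈ Finset.range P.length, (X q).flatten.length : ℕ) : ℝ) ≤
      A * N + B * (P.flatten.length - P.length) := by
  have h1 : ∀ q ∈ Finset.range P.length, ((X q).flatten.length : ℝ) ≤
      A * nsym (X q) + B * ((P.getD q []).length - 1) := by
    intro q hq
    obtain ⟨h1, h2⟩ := hP.getD hq
    have := h (X q) (by rw [← List.length_pos_iff, hX]; exact List.length_pos_of_ne_nil h1)
      (by rw [hX]; exact h2) (hb q)
    rwa [hX] at this
  push_cast at hN ⊢
  refine (Finset.sum_le_sum h1).trans ?_
  rw [Finset.sum_add_distrib, ← Finset.mul_sum, ← Finset.mul_sum, Finset.sum_sub_distrib,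
    length_flatten_eq_sum]
  simp only [Finset.sum_const, Finset.card_range, nsmul_eq_mul, mul_one]
  push_cast
  have := mul_le_mul_of_nonneg_left hN hA
  linarith

variable {s : ℕ} {A B A₁ B₁ : ℝ}

theorem LengthBound.sum_local_le (h : LengthBound s M A B) (hb : IsBlocked s P.flatten)
    (hA : 0 ≤ A) : ((∑ q ∈ Finset.range P.length,
      (localPart P (P.getD q [])).flatten.length : ℕ) : ℝ) ≤
      A * (nsym P.flatten - (globals P).card) + B * (P.flatten.length - P.length) := by
  refine h.sum_le hP (fun q => length_localPart P _) (fun q => hb.restrict_local q) hA ?_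
  have : ((_ : ℕ) : ℝ) ≤ _ := Nat.cast_le.2 (sum_nsym_local_le (P := P))
  push_cast at this ⊢
  linarith

theorem LengthBound.sum_startsAt_le (h : LengthBound s M A B) (hb : IsBlocked (s + 1) P.flatten)
    (hA : 0 ≤ A) : ((∑ q ∈ Finset.range P.length,
      (restrict (StartsAt P q) (P.getD q [])).flatten.length : ℕ) : ℝ) ≤
      A * (globals P).card + B * (P.flatten.length - P.length) :=
  h.sum_le hP (fun _ => length_restrict _ _) (fun q => hb.restrict_startsAt q) hA
    (Nat.cast_le.2 sum_nsym_startsAt_le)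

theorem LengthBound.sum_endsAt_le (h : LengthBound s M A B) (hb : IsBlocked (s + 1) P.flatten)
    (hA : 0 ≤ A) : ((∑ q ∈ Finset.range P.length,
      (restrict (EndsAt P q) (P.getD q [])).flatten.length : ℕ) : ℝ) ≤
      A * (globals P).card + B * (P.flatten.length - P.length) :=
  h.sum_le hP (fun _ => length_restrict _ _) (fun q => hb.restrict_endsAt q) hA
    (Nat.cast_le.2 sum_nsym_endsAt_le)

/-- The common part of the recurrences. -/
theorem length_le_of_partition (h₀ : LengthBound (s + 1) M A B) (h₁ : LengthBound s M A₁ B₁)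
    (hA : 0 ≤ A) (hA₁ : 0 ≤ A₁) (hb : IsBlocked (s + 1) P.flatten) :
    (P.flatten.flatten.length : ℝ) ≤
      A * (nsym P.flatten - (globals P).card) + B * (P.flatten.length - P.length)
      + 2 * (A₁ * (globals P).card + B₁ * (P.flatten.length - P.length))
      + (∑ q ∈ Finset.range P.length,
        (restrict (PassesAt P q) (P.getD q [])).flatten.length : ℕ) := by
  have h : ((_ : ℕ) : ℝ) ≤ _ := Nat.cast_le.2 (length_flatten_flatten_le (P := P))
  rw [Finset.sum_add_distrib, Finset.sum_add_distrib, Finset.sum_add_distrib, Nat.cast_add,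
    Nat.cast_add, Nat.cast_add] at h
  have h1 := h₀.sum_local_le hP hb hA
  have h2 := h₁.sum_startsAt_le hP hb hA₁
  have h3 := h₁.sum_endsAt_le hP hb hA₁
  linarith

/-- The recurrence for all orders. -/
theorem length_le_recurrence {A₂ B₂ : ℝ} (h₀ : LengthBound (s + 2) M A B)
    (h₁ : LengthBound (s + 1) M A₁ B₁) (h₂ : LengthBound s M A₂ B₂)
    (hA : 0 ≤ A) (hA₁ : 0 ≤ A₁) (hA₂ : 0 ≤ A₂) (hb : IsBlocked (s + 2) P.flatten) :
    (P.flatten.flatten.length : ℝ) ≤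
      A * (nsym P.flatten - (globals P).card) + B * (P.flatten.length - P.length)
      + 2 * (A₁ * (globals P).card + B₁ * (P.flatten.length - P.length))
      + (A₂ * ((contract P).flatten.length - 2 * (globals P).card)
        + B₂ * (P.flatten.length - P.length)) := by
  refine (length_le_of_partition hP h₀ h₁ hA hA₁ hb).trans (add_le_add le_rfl ?_)
  refine h₂.sum_le hP (fun _ => length_restrict _ _) (fun q => hb.restrict_passesAt q) hA₂ ?_
  have : ((_ : ℕ) : ℝ) ≤ _ := Nat.cast_le.2 (sum_nsym_passesAt_le (P := P))
  push_cast at this ⊢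
  linarith

/-- The improved recurrence for odd orders. -/
theorem length_le_recurrence_odd {A₂ B₂ A₃ B₃ : ℝ} (hs : Even s)
    (h₀ : LengthBound (s + 3) M A B) (h₁ : LengthBound (s + 2) M A₁ B₁)
    (h₂ : LengthBound (s + 1) M A₂ B₂) (h₃ : LengthBound s M A₃ B₃)
    (hA : 0 ≤ A) (hA₁ : 0 ≤ A₁) (hA₂ : 0 ≤ A₂) (hA₃ : 0 ≤ A₃)
    (hb : IsBlocked (s + 3) P.flatten) {That : Forest ℕ}
    (hT : IsDerivationTree (contract P) That) :
    (P.flatten.flatten.length : ℝ) ≤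
      A * (nsym P.flatten - (globals P).card) + B * (P.flatten.length - P.length)
      + 2 * (A₁ * (globals P).card + B₁ * (P.flatten.length - P.length))
      + (A₂ * featherCount (contract P) That + B₂ * (P.flatten.length - P.length))
      + (A₃ * (contract P).flatten.length + 2 * (B₃ * (P.flatten.length - P.length))) := by
  have hpart := length_le_of_partition hP h₀ h₁ hA hA₁ hb
  have h : ((_ : ℕ) : ℝ) ≤ _ := Nat.cast_le.2 (Finset.sum_le_sum
    fun q (_ : q ∈ Finset.range P.length) => length_passesAt_le hT q)
  rw [Finset.sum_add_distrib, Finset.sum_add_distrib, Nat.cast_add, Nat.cast_add] at h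
  have h4 := h₂.sum_le hP (X := fun q => restrict (PassesFeather P That q) (P.getD q []))
    (fun _ => length_restrict _ _) (fun q => hb.restrict_passesFeather q) hA₂
    (Nat.cast_le.2 sum_nsym_passesFeather_le)
  -- The symbol counts of this and the next sum are left as they are; only their total is bounded by
  -- the contracted length, so a separate estimate would lose a factor two.
  have h5 := h₃.sum_le hP (X := fun q => restrict (PassesDove P That q) (P.getD q []))
    (fun _ => length_restrict _ _) (fun q => hb.restrict_passesDove hs hT q) hA₃ le_rfl
  have h6 := h₃.sum_le hP (X := fun q => restrict (PassesHawk P That q) (P.getD q []))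
    (fun _ => length_restrict _ _) (fun q => hb.restrict_passesHawk hs hT q) hA₃ le_rfl
  have h7 : ((_ : ℕ) : ℝ) ≤ _ := Nat.cast_le.2 (sum_nsym_passesDove_add_le hT)
  rw [Nat.cast_add] at h7
  have h8 := mul_le_mul_of_nonneg_left h7 hA₃
  linarith

/-- The recurrence for feathers. -/
theorem feathers_le_recurrence {M' : ℕ} {A' B' : ℝ} (h₀ : FeatherBound (s + 1) M A B)
    (h₁ : LengthBound s M A₁ B₁) (h' : FeatherBound (s + 1) M' A' B')
    (hA : 0 ≤ A) (hA₁ : 0 ≤ A₁) (hb : IsBlocked (s + 1) P.flatten) (h2 : 2 ≤ P.length)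
    (hM' : P.length ≤ M') (hlt : P.length < P.flatten.length) :
    ∃ T, IsDerivationTree P.flatten T ∧ (featherCount P.flatten T : ℝ) ≤
      A * (nsym P.flatten - (globals P).card) + B * (P.flatten.length - P.length)
      + 2 * (A₁ * (globals P).card + B₁ * (P.flatten.length - P.length))
      + (A' * (globals P).card + B' * (P.length - 1)) := by
  obtain ⟨That, hThat, hhat⟩ := h' (contract P)
    (by rw [← List.length_pos_iff, length_contract]; omega) (by rwa [length_contract]) hb.contracted
  rw [nsym_contract, length_contract] at hhat
  have hloc : ∀ q, ∃ T, q ∈ Finset.range P.length →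
      IsDerivationTree (localPart P (P.getD q [])) T ∧
      (featherCount (localPart P (P.getD q [])) T : ℝ) ≤
        A * nsym (localPart P (P.getD q [])) + B * ((P.getD q []).length - 1) := by
    intro q
    by_cases hq : q ∈ Finset.range P.length
    · obtain ⟨h1, h2⟩ := hP.getD hq
      obtain ⟨T, hT, hle⟩ := h₀ (localPart P (P.getD q []))
        (by rw [← List.length_pos_iff, length_localPart]; exact List.length_pos_of_ne_nil h1)
        (by rwa [length_localPart]) (hb.restrict_local q)
      rw [length_localPart] at hle
      exact ⟨T, fun _ => ⟨hT, hle⟩⟩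
    · exact ⟨nil, fun h => absurd h hq⟩
  choose Tloc hTloc using hloc
  have hc : IsComposition P That Tloc := isComposition hThat
    (fun q hq => (hTloc q (Finset.mem_range.2 hq)).1) (fun I hI => (hP I hI).1) h2 hlt
  refine ⟨_, hc.comp, ?_⟩
  have h : ((_ : ℕ) : ℝ) ≤ _ := Nat.cast_le.2 hc.featherCount_le
  rw [Nat.cast_add, Nat.cast_add, Nat.cast_add] at h
  have h3 := h₁.sum_startsAt_le hP hb hA₁
  have h4 := h₁.sum_endsAt_le hP hb hA₁
  have h5 : ((∑ q ∈ Finset.range P.length, featherCount (localPart P (P.getD q [])) (Tloc q) : ℕ)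
      : ℝ) ≤ A * (nsym P.flatten - (globals P).card) + B * (P.flatten.length - P.length) := by
    push_cast
    refine (Finset.sum_le_sum fun q hq => (hTloc q hq).2).trans ?_
    rw [Finset.sum_add_distrib, ← Finset.mul_sum, ← Finset.mul_sum, Finset.sum_sub_distrib,
      length_flatten_eq_sum P]
    simp only [Finset.sum_const, Finset.card_range, nsmul_eq_mul, mul_one]
    have h6 : ((_ : ℕ) : ℝ) ≤ _ := Nat.cast_le.2 (sum_nsym_local_le (P := P))
    push_cast at h6 ⊢
    have := mul_le_mul_of_nonneg_left h6 hA
    linarith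
  linarith

end Recurrence

/-- The recurrence for two intervals. -/
theorem length_le_recurrence_two {I J : List (List ℕ)} {M s : ℕ} {A B A₁ B₁ : ℝ}
    (hP : IsPartition [I, J] M) (h₀ : LengthBound (s + 1) M A B) (h₁ : LengthBound s M A₁ B₁)
    (hA : 0 ≤ A) (hA₁ : 0 ≤ A₁) (hb : IsBlocked (s + 1) (I ++ J)) :
    ∃ g : ℕ, g ≤ nsym (I ++ J) ∧ ((I ++ J).flatten.length : ℝ) ≤
      A * (nsym (I ++ J) - g) + B * ((I ++ J).length - 2)
      + (2 * A₁ * g + B₁ * ((I ++ J).length - 2)) := by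
  have hf : [I, J].flatten = I ++ J := by simp
  rw [← hf] at hb ⊢
  refine ⟨(globals [I, J]).card, (Nat.le_add_left _ _).trans sum_nsym_local_le, ?_⟩
  have hlt : ∀ {q : ℕ} {a : ℕ}, a ∈ syms [I, J] q → q < 2 := fun h => lt_of_mem_syms h
  -- With two intervals, every global symbol starts in the first and ends in the second, and none
  -- passes. This saves one of the two block terms of the general recurrence.
  have hs : (restrict (StartsAt [I, J] 1) J).flatten = [] := by
    rw [List.eq_nil_iff_forall_not_mem]
    intro a ha
    obtain ⟨-, hg, h⟩ := mem_flatten_restrict.1 ha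
    obtain ⟨q, r, hqr, hq, hr⟩ := isGlobal_iff.1 hg
    have := hlt hr
    exact h q (by omega) hq
  have he : (restrict (EndsAt [I, J] 0) I).flatten = [] := by
    rw [List.eq_nil_iff_forall_not_mem]
    intro a ha
    obtain ⟨-, hg, h⟩ := mem_flatten_restrict.1 ha
    obtain ⟨q, r, hqr, hq, hr⟩ := isGlobal_iff.1 hg
    exact h r (by omega) hr
  have hp : ∀ q, (restrict (PassesAt [I, J] q) ([I, J].getD q [])).flatten = [] := by
    intro q
    rw [List.eq_nil_iff_forall_not_mem]
    intro a ha
    obtain ⟨-, hg, ⟨x, hx, -⟩, y, hy, hy'⟩ := mem_flatten_restrict.1 ha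
    have := hlt hy'
    omega
  have hI := hP I (by simp)
  have hJ := hP J (by simp)
  have h1 := h₁ (restrict (StartsAt [I, J] 0) I)
    (by rw [← List.length_pos_iff, length_restrict]; exact List.length_pos_of_ne_nil hI.1)
    (by rw [length_restrict]; exact hI.2) (hb.restrict_startsAt 0)
  have h2 := h₁ (restrict (EndsAt [I, J] 1) J)
    (by rw [← List.length_pos_iff, length_restrict]; exact List.length_pos_of_ne_nil hJ.1)
    (by rw [length_restrict]; exact hJ.2) (hb.restrict_endsAt 1)
  rw [length_restrict] at h1 h2
  have h3 := h₀.sum_local_le hP hb hA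
  have h4 := sum_nsym_startsAt_le (P := [I, J])
  have h5 := sum_nsym_endsAt_le (P := [I, J])
  have h6 : ((_ : ℕ) : ℝ) ≤ _ := Nat.cast_le.2 (length_flatten_flatten_le (P := [I, J]))
  simp only [hp] at h6
  simp only [List.length_cons, List.length_nil, zero_add, Nat.reduceAdd, Finset.sum_range_succ,
    Finset.range_zero, Finset.sum_empty, List.getD_cons_zero, List.getD_cons_succ, hs, he]
    at h3 h4 h5 h6
  have h7 : (nsym (restrict (StartsAt [I, J] 0) I) : ℝ) ≤ (globals [I, J]).card := by
    exact_mod_cast (Nat.le_add_right _ _).trans h4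
  have h8 : (nsym (restrict (EndsAt [I, J] 1) J) : ℝ) ≤ (globals [I, J]).card := by
    exact_mod_cast (Nat.le_add_left _ _).trans h5
  have h9 := mul_le_mul_of_nonneg_left h7 hA₁
  have h10 := mul_le_mul_of_nonneg_left h8 hA₁
  have h11 : ([I, J].flatten.length : ℝ) = I.length + J.length := by rw [hf]; simp
  push_cast at h3 h6
  rw [h11] at h3 ⊢
  linarith

end DavenportSchinzel

namespace DavenportSchinzel

/-! ### Closed forms: few blocks -/

/-- The slack available when the number of blocks doubles. -/
theorem pow_succ_add_pow_le {x : ℝ} (hx : 0 ≤ x) (e : ℕ) :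
    x ^ (e + 1) + x ^ e ≤ (x + 1) ^ (e + 1) := by
  have h : x ^ e ≤ (x + 1) ^ e := pow_le_pow_left₀ hx (by linarith) e
  have := mul_le_mul_of_nonneg_right h (by linarith : 0 ≤ x + 1)
  rw [pow_succ (x + 1)]
  calc x ^ (e + 1) + x ^ e = x ^ e * (x + 1) := by ring
    _ ≤ _ := this

theorem isPartition_take_drop {S : List (List ℕ)} {W : ℕ} (hW : 1 ≤ W) (h : W < S.length)
    (h' : S.length ≤ 2 * W) : IsPartition [S.take W, S.drop W] W := by
  intro I hI
  simp only [List.mem_cons, List.not_mem_nil, or_false] at hI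
  rcases hI with rfl | rfl
  · refine ⟨?_, by simp⟩
    rw [← List.length_pos_iff, List.length_take]; omega
  · refine ⟨?_, by rw [List.length_drop]; omega⟩
    rw [← List.length_pos_iff, List.length_drop]; omega

/-- Halving. A global symbol is charged `A₁` in each half, hence `2 * A₁ ≤ A`. Each doubling adds
`B₁ * x ^ e` per block, and the sum over all doublings has degree `e + 1`. -/
theorem lengthBound_two_pow {s e : ℕ} {A B A₁ B₁ : ℝ}
    (h₁ : ∀ x : ℕ, LengthBound s (2 ^ x) A₁ (B₁ * (x : ℝ) ^ e)) (hA₁ : 0 ≤ A₁) (hA : 1 ≤ A)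
    (hB₁ : 0 ≤ B₁) (hAA : 2 * A₁ ≤ A) (hBB : B₁ ≤ B) (x : ℕ) :
    LengthBound (s + 1) (2 ^ x) A (B * (x : ℝ) ^ (e + 1)) := by
  induction x with
  | zero => exact lengthBound_one_block hA
  | succ x ih =>
    have hx := pow_succ_add_pow_le (Nat.cast_nonneg (α := ℝ) x) e
    have hx0 : 0 ≤ (x : ℝ) ^ e := by positivity
    have hB : 0 ≤ B := hB₁.trans hBB
    have hcast : ((x + 1 : ℕ) : ℝ) = x + 1 := by push_cast; ring
    rw [hcast]
    intro S hS hl hb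
    have hS1 := one_le_length_cast hS
    by_cases hle : S.length ≤ 2 ^ x
    · refine ih.mono le_rfl le_rfl ?_ S hS hle hb
      exact mul_le_mul_of_nonneg_left (by linarith) hB
    · rw [not_le] at hle
      have hP := isPartition_take_drop Nat.one_le_two_pow hle (by rw [pow_succ] at hl; omega)
      obtain ⟨g, hg, h⟩ := length_le_recurrence_two hP ih (h₁ x) (by linarith) hA₁
        (by rwa [List.take_append_drop])
      rw [List.take_append_drop] at hg h
      refine h.trans ?_
      have h2 : (2 : ℝ) ≤ S.length := by
        have : 1 ≤ 2 ^ x := Nat.one_le_two_pow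
        exact_mod_cast (by omega : 2 ≤ S.length)
      have h3 : 2 * A₁ * g ≤ A * g := mul_le_mul_of_nonneg_right hAA (Nat.cast_nonneg _)
      have h4 : B * (x : ℝ) ^ (e + 1) + B₁ * (x : ℝ) ^ e ≤ B * ((x : ℝ) + 1) ^ (e + 1) := by
        have := mul_le_mul_of_nonneg_left hx hB
        have := mul_le_mul_of_nonneg_right hBB hx0
        linarith
      have h5 := mul_le_mul_of_nonneg_right h4 (by linarith : (0 : ℝ) ≤ S.length - 2)
      have h6 : 0 ≤ B * ((x : ℝ) + 1) ^ (e + 1) := by positivity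
      linarith

theorem featherBound_two_pow {s e : ℕ} {A B A₁ B₁ : ℝ}
    (h₁ : ∀ x : ℕ, LengthBound s (2 ^ x) A₁ (B₁ * (x : ℝ) ^ e)) (hA₁ : 0 ≤ A₁)
    (hB₁ : 0 ≤ B₁) (hAA : 2 * A₁ ≤ A) (hBB : 2 * B₁ ≤ B) (x : ℕ) :
    FeatherBound (s + 1) (2 ^ x) A (B * (x : ℝ) ^ (e + 1)) := by
  have hB : 0 ≤ B := by linarith
  have hA : 0 ≤ A := by linarith
  induction x with
  | zero =>
    exact (featherBound_two_blocks hA (by positivity)).mono (by norm_num) le_rfl le_rfl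
  | succ x ih =>
    have hx := pow_succ_add_pow_le (Nat.cast_nonneg (α := ℝ) x) e
    have hx0 : 0 ≤ (x : ℝ) ^ e := by positivity
    have hcast : ((x + 1 : ℕ) : ℝ) = x + 1 := by push_cast; ring
    rw [hcast]
    intro S hS hl hb
    have hS1 := one_le_length_cast hS
    by_cases hle : S.length ≤ 2 ^ x
    · refine ih.mono le_rfl le_rfl ?_ S hS hle hb
      exact mul_le_mul_of_nonneg_left (by linarith) hB
    -- A composite tree needs fewer intervals than blocks, so two blocks are treated apart.
    by_cases hle2 : S.length ≤ 2
    · exact featherBound_two_blocks hA (by positivity) S hS hle2 hb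
    · rw [not_le] at hle hle2
      have hP := isPartition_take_drop Nat.one_le_two_pow hle (by rw [pow_succ] at hl; omega)
      have hf : [S.take (2 ^ x), S.drop (2 ^ x)].flatten = S := by simp
      -- The contracted sequence has two blocks and no feathers, so its coefficients may be zero.
      obtain ⟨T, hT, h⟩ := feathers_le_recurrence hP ih (h₁ x)
        (featherBound_two_blocks (A := 0) (B := 0) le_rfl le_rfl) hA hA₁ (by rwa [hf]) le_rfl le_rfl
        (by rw [hf]; exact hle2)
      rw [hf] at hT h
      refine ⟨T, hT, h.trans ?_⟩
      generalize (globals [S.take (2 ^ x), S.drop (2 ^ x)]).card = g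
      have h2 : (2 : ℝ) ≤ S.length := by exact_mod_cast hle2.le
      have h3 := mul_le_mul_of_nonneg_right hAA (Nat.cast_nonneg (α := ℝ) g)
      have h4 : B * (x : ℝ) ^ (e + 1) + 2 * (B₁ * (x : ℝ) ^ e) ≤ B * ((x : ℝ) + 1) ^ (e + 1) := by
        have := mul_le_mul_of_nonneg_left hx hB
        have := mul_le_mul_of_nonneg_right hBB hx0
        linarith
      have h5 := mul_le_mul_of_nonneg_right h4 (by linarith : (0 : ℝ) ≤ S.length - 2)
      have h6 : 0 ≤ B * ((x : ℝ) + 1) ^ (e + 1) := by positivity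
      simp only [List.length_cons, List.length_nil]
      push_cast
      linarith

/-! ### Closed forms: the inductive steps -/

theorem exists_partition {S : List (List ℕ)} {W K : ℕ} (hW : 1 ≤ W) (hS : S ≠ [])
    (hl : S.length ≤ W * K) : ∃ P, P.flatten = S ∧ IsPartition P W ∧ P ≠ [] ∧ P.length ≤ K ∧
      W * ((P.length : ℝ) - 1) ≤ S.length - 1 := by
  obtain ⟨P, h1, h2, h3, h4⟩ := exists_chunks S hW hS
  have hpos := List.length_pos_of_ne_nil h3
  refine ⟨P, h1, h2, h3, ?_, ?_⟩
  · have : (P.length - 1) * W < K * W := by rw [mul_comm K]; omega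
    have := Nat.lt_of_mul_lt_mul_right this
    omega
  · obtain ⟨k, hk⟩ : ∃ k, P.length = k + 1 := ⟨P.length - 1, by omega⟩
    rw [hk] at h4 ⊢
    have : k * W + 1 ≤ S.length := by simpa using h4
    have : ((k * W + 1 : ℕ) : ℝ) ≤ S.length := by exact_mod_cast this
    push_cast at this ⊢
    linarith

theorem length_le_length_flatten {P : List (List (List ℕ))} {W : ℕ} (hP : IsPartition P W) :
    P.length ≤ P.flatten.length := by
  rw [length_flatten_eq_sum]
  have : ∑ q ∈ Finset.range P.length, 1 ≤
      ∑ q ∈ Finset.range P.length, (P.getD q []).length :=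
    Finset.sum_le_sum fun q hq => List.length_pos_of_ne_nil (hP.getD hq).1
  simpa using this

/-! ### Power estimates for the inductive steps, with `X = c (j + 1)` -/

section Powers

variable {c X : ℝ} (hc : 2 ≤ c) (hX : 2 * c ≤ X) (e : ℕ)
include hc hX

omit hc in
-- The gain `c * X ^ e` on passing from `c j` to `c (j + 1)` is the budget for all new block terms;
-- the next three estimates measure those terms against such a budget.
theorem sub_pow_add_le (hc0 : 0 ≤ c) : (X - c) ^ (e + 1) + c * X ^ e ≤ X ^ (e + 1) := by
  have h : (X - c) ^ e ≤ X ^ e := pow_le_pow_left₀ (by linarith) (by linarith) e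
  have := mul_le_mul_of_nonneg_right h (by linarith : 0 ≤ X - c)
  rw [pow_succ, pow_succ]
  linarith

theorem two_mul_pow_le_mul_pow : 2 * X ^ e ≤ c * X ^ e :=
  mul_le_mul_of_nonneg_right hc (pow_nonneg (by linarith) e)

theorem pow_le_mul_pow_succ : 2 * X ^ e ≤ c * X ^ (e + 1) := by
  refine (two_mul_pow_le_mul_pow hc hX e).trans (mul_le_mul_of_nonneg_left ?_ (by linarith))
  exact pow_le_pow_right₀ (by linarith) (by omega)

theorem two_mul_pow_le : 2 * c ^ (e + 2) ≤ c * X ^ (e + 1) := by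
  have h : (2 * c) ^ (e + 1) ≤ X ^ (e + 1) := pow_le_pow_left₀ (by linarith) hX _
  have h2 : (2 : ℝ) ≤ 2 ^ (e + 1) := by
    rw [pow_succ]; have := one_le_pow₀ (n := e) (one_le_two (α := ℝ)); linarith
  have h3 : 0 ≤ c ^ (e + 1) := pow_nonneg (by linarith) _
  rw [mul_pow] at h
  have h4 := mul_le_mul_of_nonneg_right h2 h3
  have h5 := mul_le_mul_of_nonneg_left (h4.trans h) (by linarith : 0 ≤ c)
  calc 2 * c ^ (e + 2) = c * (2 * c ^ (e + 1)) := by ring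
    _ ≤ _ := h5

end Powers

/-- The contracted sequence has few enough blocks for the factor `w ^ e` to be absorbed. -/
theorem pow_mul_le {c w e : ℕ} {k m : ℝ} (hw : 1 ≤ w) (he : e ≤ c) (hk : 1 ≤ k)
    (h : ((w ^ c : ℕ) : ℝ) * (k - 1) ≤ m - 1) :
    ((c : ℝ) * w) ^ e * (k - 1) ≤ (c : ℝ) ^ e * (m - 1) := by
  -- Here the lower bound on `c` enters: `w ^ e` must not exceed the length `w ^ c` of an interval.
  have h1 : ((w : ℝ)) ^ e ≤ (w : ℝ) ^ c := pow_le_pow_right₀ (by exact_mod_cast hw) he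
  have h2 := mul_le_mul_of_nonneg_right h1 (by linarith : 0 ≤ k - 1)
  push_cast at h
  have h3 := mul_le_mul_of_nonneg_left (h2.trans h) (pow_nonneg (Nat.cast_nonneg (α := ℝ) c) e)
  rw [mul_pow]
  linarith

section Steps

variable {c w K : ℕ} (hw : 1 ≤ w) {X : ℝ}
include hw

/-- A global symbol costs `2 + 2` at its ends and `(A - 2) - 2` at the passed intervals, in total
`A`. The three block terms with coefficient `1` fit into the `3 * c` left by the `b - 3` of the
contracted sequence. -/
theorem lengthBound_three_step (hc : 1 ≤ c) (hX : 2 * (c : ℝ) ≤ X) {A b : ℝ} (hA : 2 ≤ A)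
    (hb : 3 ≤ b) (h₀ : LengthBound 3 (w ^ c) A (b * (X - c)))
    (h₁ : LengthBound 2 (w ^ c) 2 1) (h₂ : LengthBound 1 (w ^ c) 1 1)
    (h' : LengthBound 3 K (A - 2) ((b - 3) * (c * w))) :
    LengthBound 3 (w ^ c * K) A (b * X) := by
  intro S hS hl hbl
  have hW : 1 ≤ w ^ c := Nat.one_le_pow _ _ hw
  have hc' : (1 : ℝ) ≤ c := by exact_mod_cast hc
  obtain ⟨P, rfl, hP, hne, hK, hkm⟩ := exists_partition hW hS hl
  have hk := one_le_length_cast hne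
  have h1 := length_le_recurrence hP h₀ h₁ h₂ (by linarith) (by norm_num) (by norm_num) hbl
  have h2 := h' (contract P) (by rw [← List.length_pos_iff, length_contract]
                                 exact List.length_pos_of_ne_nil hne)
    (by rwa [length_contract]) hbl.contracted
  rw [nsym_contract, length_contract] at h2
  have h3 := pow_mul_le hw hc hk hkm
  simp only [pow_one] at h3
  have hD : (P.length : ℝ) ≤ P.flatten.length := by
    exact_mod_cast length_le_length_flatten hP
  generalize (globals P).card = g at *
  generalize (P.flatten.length : ℝ) = m at *
  generalize (P.length : ℝ) = k at *
  have h4 := mul_le_mul_of_nonneg_left h3 (by linarith : 0 ≤ b - 3)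
  have h5 : b * (X - c) * (m - k) ≤ b * (X - c) * (m - 1) :=
    mul_le_mul_of_nonneg_left (by linarith) (mul_nonneg (by linarith) (by linarith))
  have h6 : 0 ≤ (c - 1) * (m - 1) := mul_nonneg (by linarith) (by linarith)
  nlinarith

/-- `hn` collects the cost per global symbol and `hm` the cost per block, measured in units of `c *
X ^ (s + 1)`. Since `2 ≤ c` and `2 * c ≤ X`, the factor two before `B₁` disappears and the
contracted term is halved. -/
theorem lengthBound_step {s : ℕ} (hsc : s + 2 ≤ c) (hX : 2 * (c : ℝ) ≤ X)
    {A A₁ B₁ A₂ B₂ A' : ℝ} (hA : 0 ≤ A) (hA₁ : 0 ≤ A₁) (hB₁ : 0 ≤ B₁) (hA₂ : 0 ≤ A₂) (hB₂ : 0 ≤ B₂)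
    (hA' : 0 ≤ A')
    (h₀ : LengthBound (s + 4) (w ^ c) A (A * (X - c) ^ (s + 2)))
    (h₁ : LengthBound (s + 3) (w ^ c) A₁ (B₁ * X ^ (s + 1)))
    (h₂ : LengthBound (s + 2) (w ^ c) A₂ (B₂ * X ^ s))
    (h' : LengthBound (s + 4) K A' (A' * (c * w) ^ (s + 2)))
    (hn : 2 * A₁ + A₂ * (A' - 2) ≤ A) (hm : B₁ + A₂ * A' / 2 + B₂ ≤ A) :
    LengthBound (s + 4) (w ^ c * K) A (A * X ^ (s + 2)) := by
  intro S hS hl hbl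
  have hW : 1 ≤ w ^ c := Nat.one_le_pow _ _ hw
  have hc' : (2 : ℝ) ≤ c := by exact_mod_cast (by omega : 2 ≤ c)
  obtain ⟨P, rfl, hP, hne, hK, hkm⟩ := exists_partition hW hS hl
  have hk := one_le_length_cast hne
  have h1 := length_le_recurrence hP h₀ h₁ h₂ hA hA₁ hA₂ hbl
  have h2 := h' (contract P) (by rw [← List.length_pos_iff, length_contract]
                                 exact List.length_pos_of_ne_nil hne)
    (by rwa [length_contract]) hbl.contracted
  rw [nsym_contract, length_contract] at h2
  have h3 := pow_mul_le hw hsc hk hkm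
  have hD : (P.length : ℝ) ≤ P.flatten.length := by
    exact_mod_cast length_le_length_flatten hP
  have hg : (0 : ℝ) ≤ (globals P).card := Nat.cast_nonneg _
  generalize ((globals P).card : ℝ) = g at *
  generalize (P.flatten.length : ℝ) = m at *
  generalize (P.length : ℝ) = k at *
  have p1 := sub_pow_add_le hX (s + 1) (by linarith)
  have p2 := two_mul_pow_le_mul_pow hc' hX (s + 1)
  have p3 := two_mul_pow_le hc' hX s
  have p4 := pow_le_mul_pow_succ hc' hX s
  have p5 : 0 ≤ X ^ s := pow_nonneg (by linarith) s
  have p6 : 0 ≤ X ^ (s + 1) := pow_nonneg (by linarith) _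
  have p7 : 0 ≤ (X - c) ^ (s + 2) := pow_nonneg (by linarith) _
  have p8 : 0 ≤ (c : ℝ) ^ (s + 2) := pow_nonneg (by linarith) _
  set Q := (c : ℝ) * X ^ (s + 1) with hQ
  have hQ0 : 0 ≤ Q := mul_nonneg (by linarith) p6
  have hbr : A * (X - c) ^ (s + 2) + 2 * (B₁ * X ^ (s + 1)) + A₂ * A' * (c : ℝ) ^ (s + 2)
      + B₂ * X ^ s ≤ A * X ^ (s + 2) := by
    have q1 := mul_le_mul_of_nonneg_left p1 hA
    have q2 := mul_le_mul_of_nonneg_left p2 hB₁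
    have q3 := mul_le_mul_of_nonneg_left p3 (mul_nonneg hA₂ hA')
    have q4 := mul_le_mul_of_nonneg_left p4 hB₂
    have q5 := mul_le_mul_of_nonneg_right hm hQ0
    have q6 := mul_nonneg hB₂ p5
    linarith
  have hR : 0 ≤ m - 1 := by linarith
  have r1 := mul_le_mul_of_nonneg_right hbr hR
  have r2 := mul_le_mul_of_nonneg_right hn hg
  have r3 := mul_le_mul_of_nonneg_left h2 hA₂
  have r4 := mul_le_mul_of_nonneg_left h3 (mul_nonneg hA₂ hA')
  have r5 : (A * (X - c) ^ (s + 2) + 2 * (B₁ * X ^ (s + 1)) + B₂ * X ^ s) * (m - k) ≤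
      (A * (X - c) ^ (s + 2) + 2 * (B₁ * X ^ (s + 1)) + B₂ * X ^ s) * (m - 1) :=
    mul_le_mul_of_nonneg_left (by linarith) (by positivity)
  linarith

/-- The same accounting with the passing term split: feathers cost `A₂` each and number at most the
feather bound `N'` allows, while the other passing symbols cost only `A₃` each. -/
theorem lengthBound_odd_step {s : ℕ} (hs : Even s) (hsc : s + 3 ≤ c) (hX : 2 * (c : ℝ) ≤ X)
    {A A₁ B₁ A₂ B₂ A₃ B₃ A' N' : ℝ} (hA : 0 ≤ A) (hA₁ : 0 ≤ A₁) (hB₁ : 0 ≤ B₁) (hA₂ : 0 ≤ A₂)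
    (hB₂ : 0 ≤ B₂) (hA₃ : 0 ≤ A₃) (hB₃ : 0 ≤ B₃) (hA' : 0 ≤ A') (hN' : 0 ≤ N')
    (h₀ : LengthBound (s + 5) (w ^ c) A (A * (X - c) ^ (s + 3)))
    (h₁ : LengthBound (s + 4) (w ^ c) A₁ (B₁ * X ^ (s + 2)))
    (h₂ : LengthBound (s + 3) (w ^ c) A₂ (B₂ * X ^ (s + 1)))
    (h₃ : LengthBound (s + 2) (w ^ c) A₃ (B₃ * X ^ s))
    (h' : LengthBound (s + 5) K A' (A' * (c * w) ^ (s + 3)))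
    (hf : FeatherBound (s + 5) K N' (N' * (c * w) ^ (s + 3)))
    (hn : 2 * A₁ + A₂ * N' + A₃ * A' ≤ A) (hm : B₁ + (A₂ * N' + A₃ * A') / 2 + B₂ + B₃ ≤ A) :
    LengthBound (s + 5) (w ^ c * K) A (A * X ^ (s + 3)) := by
  intro S hS hl hbl
  have hW : 1 ≤ w ^ c := Nat.one_le_pow _ _ hw
  have hc' : (2 : ℝ) ≤ c := by exact_mod_cast (by omega : 2 ≤ c)
  obtain ⟨P, rfl, hP, hne, hK, hkm⟩ := exists_partition hW hS hl
  have hk := one_le_length_cast hne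
  have hne' : contract P ≠ [] := by
    rw [← List.length_pos_iff, length_contract]; exact List.length_pos_of_ne_nil hne
  obtain ⟨That, hThat, hft⟩ := hf (contract P) hne' (by rwa [length_contract]) hbl.contracted
  have h1 := length_le_recurrence_odd hP (by simp [hs, parity_simps] : Even (s + 2)) h₀ h₁ h₂ h₃
    hA hA₁ hA₂ hA₃ hbl hThat
  have h2 := h' (contract P) hne' (by rwa [length_contract]) hbl.contracted
  rw [nsym_contract, length_contract] at h2 hft
  have h3 := pow_mul_le hw hsc hk hkm
  have hD : (P.length : ℝ) ≤ P.flatten.length := by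
    exact_mod_cast length_le_length_flatten hP
  have hg : (0 : ℝ) ≤ (globals P).card := Nat.cast_nonneg _
  generalize ((globals P).card : ℝ) = g at *
  generalize (P.flatten.length : ℝ) = m at *
  generalize (P.length : ℝ) = k at *
  have p1 := sub_pow_add_le hX (s + 2) (by linarith)
  have p2 := two_mul_pow_le_mul_pow hc' hX (s + 2)
  have p3 := two_mul_pow_le hc' hX (s + 1)
  have p4 := pow_le_mul_pow_succ hc' hX (s + 1)
  have p4' := pow_le_mul_pow_succ hc' hX s
  have p5 : 0 ≤ X ^ s := pow_nonneg (by linarith) s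
  have p5' : 0 ≤ X ^ (s + 1) := pow_nonneg (by linarith) _
  have p6 : 0 ≤ X ^ (s + 2) := pow_nonneg (by linarith) _
  have p6' : X ^ (s + 1) ≤ X ^ (s + 2) := pow_le_pow_right₀ (by linarith) (by omega)
  have p7 : 0 ≤ (X - c) ^ (s + 3) := pow_nonneg (by linarith) _
  have p9 : (c : ℝ) * X ^ (s + 1) ≤ c * X ^ (s + 2) :=
    mul_le_mul_of_nonneg_left p6' (by linarith)
  set Q := (c : ℝ) * X ^ (s + 2) with hQ
  have hQ0 : 0 ≤ Q := mul_nonneg (by linarith) p6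
  have hZ : 0 ≤ A₂ * N' + A₃ * A' := by positivity
  have hbr : A * (X - c) ^ (s + 3) + 2 * (B₁ * X ^ (s + 2))
      + (A₂ * N' + A₃ * A') * (c : ℝ) ^ (s + 3)
      + B₂ * X ^ (s + 1) + 2 * (B₃ * X ^ s) ≤ A * X ^ (s + 3) := by
    have q1 := mul_le_mul_of_nonneg_left p1 hA
    have q2 := mul_le_mul_of_nonneg_left p2 hB₁
    have q3 := mul_le_mul_of_nonneg_left p3 hZ
    have q4 := mul_le_mul_of_nonneg_left p4 hB₂
    have q4' := mul_le_mul_of_nonneg_left (p4'.trans p9) hB₃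
    have q5 := mul_le_mul_of_nonneg_right hm hQ0
    have q6 := mul_nonneg hB₂ p5'
    linarith
  have hR : 0 ≤ m - 1 := by linarith
  have r1 := mul_le_mul_of_nonneg_right hbr hR
  have r2 := mul_le_mul_of_nonneg_right hn hg
  have r3 := mul_le_mul_of_nonneg_left h2 hA₃
  have r3' := mul_le_mul_of_nonneg_left hft hA₂
  have r4 := mul_le_mul_of_nonneg_left h3 hZ
  have r5 : (A * (X - c) ^ (s + 3) + 2 * (B₁ * X ^ (s + 2)) + B₂ * X ^ (s + 1)
      + 2 * (B₃ * X ^ s)) * (m - k) ≤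
      (A * (X - c) ^ (s + 3) + 2 * (B₁ * X ^ (s + 2)) + B₂ * X ^ (s + 1)
      + 2 * (B₃ * X ^ s)) * (m - 1) :=
    mul_le_mul_of_nonneg_left (by linarith) (by positivity)
  linarith

theorem featherBound_step {s : ℕ} (hw2 : 2 ≤ w) (hsc : s + 2 ≤ c) (hX : 2 * (c : ℝ) ≤ X)
    {A A₁ B₁ A' : ℝ} (hA : 0 ≤ A) (hA₁ : 0 ≤ A₁) (hB₁ : 0 ≤ B₁) (hA' : 0 ≤ A')
    (h₀ : FeatherBound (s + 4) (w ^ c) A (A * (X - c) ^ (s + 2)))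
    (h₁ : LengthBound (s + 3) (w ^ c) A₁ (B₁ * X ^ (s + 1)))
    (h' : FeatherBound (s + 4) K A' (A' * (c * w) ^ (s + 2)))
    (hn : 2 * A₁ + A' ≤ A) (hm : B₁ + A' / 2 ≤ A) :
    FeatherBound (s + 4) (w ^ c * K) A (A * X ^ (s + 2)) := by
  intro S hS hl hbl
  have hc' : (2 : ℝ) ≤ c := by exact_mod_cast (by omega : 2 ≤ c)
  have hS1 := one_le_length_cast hS
  -- Short sequences would form a single interval, which a derivation tree does not allow. Beyond `w
  -- ^ c ≥ 2` blocks there are at least two intervals, and fewer intervals than blocks.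
  by_cases hle : S.length ≤ w ^ c
  · refine h₀.mono le_rfl le_rfl ?_ S hS hle hbl
    exact mul_le_mul_of_nonneg_left (pow_le_pow_left₀ (by linarith) (by linarith) _) hA
  rw [not_le] at hle
  have hW : 2 ≤ w ^ c := hw2.trans (Nat.le_self_pow (by omega) w)
  obtain ⟨P, rfl, hP, hne, hK, hkm⟩ := exists_partition (by omega) hS hl
  have hk := one_le_length_cast hne
  have hk2 : 2 ≤ P.length := by
    by_contra hlt
    have h1 : P.length = 1 := by
      have := List.length_pos_of_ne_nil hne
      omega
    obtain ⟨I, rfl⟩ := List.length_eq_one_iff.1 h1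
    have := (hP I (by simp)).2
    simp at hle
    omega
  have hk3 : P.length < P.flatten.length := by
    have h1 : (2 : ℝ) * ((P.length : ℝ) - 1) ≤ P.flatten.length - 1 := by
      refine le_trans (mul_le_mul_of_nonneg_right ?_ (by linarith)) hkm
      exact_mod_cast hW
    have h2 : (2 : ℝ) ≤ P.length := by exact_mod_cast hk2
    by_contra hlt
    have h3 : (P.flatten.length : ℝ) ≤ P.length := by exact_mod_cast not_lt.1 hlt
    linarith
  obtain ⟨T, hT, h1⟩ := feathers_le_recurrence hP h₀ h₁ h' hA hA₁ hbl hk2 hK hk3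
  refine ⟨T, hT, h1.trans ?_⟩
  have h3 := pow_mul_le hw hsc hk hkm
  have hD : (P.length : ℝ) ≤ P.flatten.length := by
    exact_mod_cast length_le_length_flatten hP
  have hg : (0 : ℝ) ≤ (globals P).card := Nat.cast_nonneg _
  generalize ((globals P).card : ℝ) = g at *
  generalize (P.flatten.length : ℝ) = m at *
  generalize (P.length : ℝ) = k at *
  have p1 := sub_pow_add_le hX (s + 1) (by linarith)
  have p2 := two_mul_pow_le_mul_pow hc' hX (s + 1)
  have p3 := two_mul_pow_le hc' hX s
  have p6 : 0 ≤ X ^ (s + 1) := pow_nonneg (by linarith) _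
  have p7 : 0 ≤ (X - c) ^ (s + 2) := pow_nonneg (by linarith) _
  set Q := (c : ℝ) * X ^ (s + 1) with hQ
  have hQ0 : 0 ≤ Q := mul_nonneg (by linarith) p6
  have hbr : A * (X - c) ^ (s + 2) + 2 * (B₁ * X ^ (s + 1)) + A' * (c : ℝ) ^ (s + 2)
      ≤ A * X ^ (s + 2) := by
    have q1 := mul_le_mul_of_nonneg_left p1 hA
    have q2 := mul_le_mul_of_nonneg_left p2 hB₁
    have q3 := mul_le_mul_of_nonneg_left p3 hA'
    have q5 := mul_le_mul_of_nonneg_right hm hQ0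
    linarith
  have hR : 0 ≤ m - 1 := by linarith
  have r1 := mul_le_mul_of_nonneg_right hbr hR
  have r2 := mul_le_mul_of_nonneg_right hn hg
  have r4 := mul_le_mul_of_nonneg_left h3 hA'
  have r5 : (A * (X - c) ^ (s + 2) + 2 * (B₁ * X ^ (s + 1))) * (m - k) ≤
      (A * (X - c) ^ (s + 2) + 2 * (B₁ * X ^ (s + 1))) * (m - 1) :=
    mul_le_mul_of_nonneg_left (by linarith) (by positivity)
  linarith

end Steps

end DavenportSchinzel

namespace DavenportSchinzel

/-! ### The constants -/

section Choose

theorem two_mul_choose_two (u : ℕ) : 2 * (u + 2).choose 2 = (u + 2) * (u + 1) := by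
  induction u with
  | zero => rfl
  | succ u ih =>
    rw [Nat.choose_succ_succ' (u + 2) 1, mul_add, ih, Nat.choose_one_right]
    ring

theorem le_choose_two {n : ℕ} (hn : 3 ≤ n) : n ≤ n.choose 2 := by
  obtain ⟨u, rfl⟩ : ∃ u, n = u + 2 := ⟨n - 2, by omega⟩
  have := two_mul_choose_two u
  nlinarith

theorem choose_two_le_choose {n t : ℕ} (ht : 2 ≤ t) (hn : t + 2 ≤ n) :
    n.choose 2 ≤ n.choose t := by
  induction n generalizing t with
  | zero => omega
  | succ n ih =>
    obtain ⟨k, rfl⟩ : ∃ k, t = k + 1 := ⟨t - 1, by omega⟩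
    rcases eq_or_lt_of_le ht with h | h
    · rw [← h]
    rcases eq_or_lt_of_le hn with h' | h'
    · rw [← Nat.choose_symm (show 2 ≤ n + 1 by omega)]
      rw [show n + 1 - 2 = k + 1 by omega]
    · rw [Nat.choose_succ_succ' n k, Nat.choose_succ_succ' n 1, Nat.choose_one_right]
      have h1 := ih (t := k) (by omega) (by omega)
      have h2 := ih (t := k + 1) (by omega) (by omega)
      have h3 := le_choose_two (n := n) (by omega)
      rw [one_add_one_eq_two]
      omega

theorem le_choose {n k : ℕ} (hk : 1 ≤ k) (hn : k + 2 ≤ n) : n ≤ n.choose k := by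
  rcases eq_or_lt_of_le hk with h | h
  · rw [← h, Nat.choose_one_right]
  · exact (le_choose_two (by omega)).trans (choose_two_le_choose h hn)

theorem sq_le_two_pow {u : ℕ} (hu : 3 ≤ u) : (2 * u) ^ 2 ≤ 2 ^ (u + 3) := by
  induction u, hu using Nat.le_induction with
  | base => norm_num
  | succ u hu ih => rw [show u + 1 + 3 = (u + 3) + 1 by ring, pow_succ 2 (u + 3)]; nlinarith

/-- Squared, the left side is at most `2 ^ 5 * (2 ^ (u + 3)) ^ t`, and `5 + (u + 3) * (u - 1)` does
not exceed `(u + 2) * (u + 1)`, twice the binomial coefficient over two. -/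
theorem five_mul_pow_le {t u : ℕ} (ht : 2 ≤ t) (hu : t + 1 ≤ u) :
    5 * (2 * u) ^ t ≤ 2 ^ (u + 2).choose t := by
  rw [← Nat.pow_le_pow_iff_left (n := 2) (by norm_num)]
  have h1 : (5 * (2 * u) ^ t) ^ 2 ≤ 2 ^ 5 * (2 ^ (u + 3)) ^ t := by
    rw [mul_pow, ← pow_mul, mul_comm t 2, pow_mul]
    exact Nat.mul_le_mul (by norm_num) (Nat.pow_le_pow_left (sq_le_two_pow (by omega)) t)
  refine h1.trans ?_
  rw [← pow_mul, ← pow_add, ← pow_mul]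
  refine Nat.pow_le_pow_right (by norm_num) ?_
  have h2 := choose_two_le_choose ht (show t + 2 ≤ u + 2 by omega)
  have h3 := two_mul_choose_two u
  have h4 : (u + 3) * t ≤ (u + 3) * (u - 1) := Nat.mul_le_mul_left _ (by omega)
  obtain ⟨v, rfl⟩ : ∃ v, u = v + 1 := ⟨u - 1, by omega⟩
  simp only [Nat.add_sub_cancel] at h4
  nlinarith

end Choose

/-- The coefficient for order `2 * t + 2`. -/
noncomputable def evenCoeff : ℕ → ℕ → ℝ
  | 0, _ => 2
  | t + 1, i => 2 ^ (i + t + 4).choose (t + 1) - 3 * (2 * ((i : ℝ) + t + 2)) ^ (t + 1)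

/-- The coefficient for order `2 * t + 3`. -/
noncomputable def oddCoeff : ℕ → ℕ → ℝ
  | 0, i => 2 * i + 2
  | t + 1, i => 3 / 2 * (2 * ((i : ℝ) + t + 2)) ^ (t + 2) * 2 ^ (i + t + 4).choose (t + 1)

/-- The coefficient of the number of blocks for order `2 * t + 2`. -/
noncomputable def evenBlockCoeff : ℕ → ℕ → ℝ
  | 0, _ => 1
  | t + 1, i => evenCoeff (t + 1) i

/-- The coefficient of the number of blocks for order `2 * t + 3`. -/
noncomputable def oddBlockCoeff : ℕ → ℕ → ℝ
  | 0, i => 3 * i - 2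
  | t + 1, i => oddCoeff (t + 1) i

/-- The coefficient for the number of feathers for order `2 * t + 5`. -/
noncomputable def featherCoeff (t i : ℕ) : ℝ := 4 * 2 ^ (i + t + 4).choose (t + 1)

theorem mu_even (t i : ℕ) : mu (2 * t + 4) i = evenCoeff (t + 1) i := by
  have h1 : (2 * t + 4 - 2) / 2 = t + 1 := by omega
  have h2 : Even (2 * t + 4) := by simp [parity_simps]
  simp only [mu, h1, h2, if_true, evenCoeff]
  push_cast
  rw [show i + (t + 1) + 3 = i + t + 4 by ring]
  ring

theorem mu_odd (t i : ℕ) : mu (2 * t + 5) i = oddCoeff (t + 1) i := by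
  have h1 : (2 * t + 5 - 2) / 2 = t + 1 := by omega
  have h2 : ¬ Even (2 * t + 5) := by simp [parity_simps]
  simp only [mu, h1, h2, if_false, oddCoeff]
  push_cast
  rw [show i + (t + 1) + 3 = i + t + 4 by ring]
  ring

theorem nu_odd (t i : ℕ) : nu (2 * t + 5) i = featherCoeff t i := by
  have h1 : (2 * t + 5 - 2) / 2 = t + 1 := by omega
  simp only [nu, h1, featherCoeff]
  rw [show i + (t + 1) + 3 = i + t + 4 by ring]

/-- All coefficients of a step in common variables: `y = 2 (i + t + 3)`, `p = y ^ (t + 1)`, and `A`,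
`B` the powers of two for `(t + 1, i + 1)` and `(t + 2, i)`. Pascal's rule makes `A * B` the power
of two for `(t + 2, i + 1)`, where `y` becomes `y + 2`. -/
theorem exists_factors (t i : ℕ) : ∃ A B y p : ℝ, 6 ≤ y ∧ 6 ≤ p ∧ 2 ^ (t + 2) ≤ p ∧
    (y + 2) ^ (t + 2) ≤ 2 ^ (t + 2) * (y * p) ∧ y ^ 2 * p + 6 * (y * p) ≤ (y + 2) ^ (t + 3) ∧
    8 ≤ A ∧ 2 * 2 ^ (t + 2) ≤ A ∧ 5 * (y * p) ≤ B ∧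
    evenCoeff (t + 1) (i + 1) = A - 3 * p ∧ oddCoeff (t + 1) (i + 1) = 3 / 2 * (y * p) * A ∧
    evenCoeff (t + 2) i = B - 3 * (y * p) ∧ oddCoeff (t + 2) i = 3 / 2 * (y ^ 2 * p) * B ∧
    evenCoeff (t + 2) (i + 1) = A * B - 3 * (y + 2) ^ (t + 2) ∧
    oddCoeff (t + 2) (i + 1) = 3 / 2 * (y + 2) ^ (t + 3) * (A * B) ∧
    featherCoeff (t + 1) i = 4 * B ∧ featherCoeff (t + 1) (i + 1) = 4 * (A * B) := by
  have hy : (6 : ℝ) ≤ 2 * ((i : ℝ) + t + 3) := by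
    have := Nat.cast_nonneg (α := ℝ) i
    have := Nat.cast_nonneg (α := ℝ) t
    linarith
  obtain ⟨y, hye⟩ : ∃ y, y = 2 * ((i : ℝ) + t + 3) := ⟨_, rfl⟩
  rw [← hye] at hy
  have hAB : (2 : ℝ) ^ (i + 1 + (t + 1) + 4).choose (t + 1 + 1) =
      2 ^ (i + t + 5).choose (t + 1) * 2 ^ (i + t + 5).choose (t + 2) := by
    rw [← pow_add, ← Nat.choose_succ_succ', show i + 1 + (t + 1) + 4 = i + t + 5 + 1 by ring]
  have hyp : y * y ^ (t + 1) = y ^ (t + 2) := by ring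
  have hA : (2 : ℝ) * 2 ^ (t + 2) ≤ 2 ^ (i + t + 5).choose (t + 1) := by
    rw [← pow_succ']
    refine pow_le_pow_right₀ (by norm_num) ?_
    have := le_choose (n := i + t + 5) (k := t + 1) (by omega) (by omega)
    omega
  have h4 : (4 : ℝ) ≤ 2 ^ (t + 2) := by
    have : (2 : ℝ) ^ 2 ≤ 2 ^ (t + 2) := pow_le_pow_right₀ (by norm_num) (by omega)
    linarith
  refine ⟨2 ^ (i + t + 5).choose (t + 1), 2 ^ (i + t + 5).choose (t + 2), y, y ^ (t + 1), hy,
    ?_, ?_, ?_, ?_, by linarith, hA, ?_, ?_, ?_, ?_, ?_, ?_, ?_, ?_, ?_⟩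
  · exact hy.trans (le_self_pow₀ (by linarith) (by omega))
  · calc (2 : ℝ) ^ (t + 2) ≤ 2 ^ (2 * (t + 1)) := pow_le_pow_right₀ (by norm_num) (by omega)
      _ = 4 ^ (t + 1) := by rw [pow_mul]; norm_num
      _ ≤ y ^ (t + 1) := pow_le_pow_left₀ (by norm_num) (by linarith) _
  · rw [hyp, ← mul_pow]
    exact pow_le_pow_left₀ (by linarith) (by linarith) _
  · have h1 : y ^ t ≤ (y + 2) ^ t := pow_le_pow_left₀ (by linarith) (by linarith) _
    have h2 : y ^ 3 + 6 * y ^ 2 ≤ (y + 2) ^ 3 := by nlinarith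
    calc y ^ 2 * y ^ (t + 1) + 6 * (y * y ^ (t + 1)) = y ^ t * (y ^ 3 + 6 * y ^ 2) := by ring
      _ ≤ (y + 2) ^ t * (y + 2) ^ 3 := mul_le_mul h1 h2 (by positivity) (by positivity)
      _ = _ := by ring
  · rw [hyp]
    have := five_mul_pow_le (t := t + 2) (u := i + t + 3) (by omega) (by omega)
    rw [hye]
    exact_mod_cast this
  · rw [evenCoeff, hye, show i + 1 + t + 4 = i + t + 5 by ring]; push_cast; ring
  · rw [oddCoeff, hyp, hye, show i + 1 + t + 4 = i + t + 5 by ring]; push_cast; ring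
  · rw [evenCoeff, hyp, hye, show i + (t + 1) + 4 = i + t + 5 by ring]; push_cast; ring
  · rw [oddCoeff, hye, show i + (t + 1) + 4 = i + t + 5 by ring]; push_cast; ring
  · rw [evenCoeff, hAB, hye]; push_cast; ring
  · rw [oddCoeff, hAB, hye]; push_cast; ring
  · rw [featherCoeff, show i + (t + 1) + 4 = i + t + 5 by ring]
  · rw [featherCoeff, hAB]

theorem evenCoeff_one (i : ℕ) : evenCoeff 1 i = 16 * 2 ^ i - 6 * (i + 2) := by
  rw [evenCoeff, zero_add, Nat.choose_one_right]; push_cast; ring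

theorem oddCoeff_one (i : ℕ) : oddCoeff 1 i = 96 * (i + 2) ^ 2 * 2 ^ i := by
  rw [oddCoeff, zero_add, Nat.choose_one_right]; push_cast; ring

theorem featherCoeff_zero (i : ℕ) : featherCoeff 0 i = 64 * 2 ^ i := by
  rw [featherCoeff, zero_add, Nat.choose_one_right]; ring

theorem add_one_le_two_pow (i : ℕ) : (i : ℝ) + 1 ≤ 2 ^ i := by
  exact_mod_cast Nat.lt_two_pow_self (n := i)

/-- For larger `t`, `5 * (y * p) ≤ B` gives `A * B ≥ 5 * (y * p) * A`. Three fifths pay for the odd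
coefficient and the rest for the subtracted power. -/
theorem evenCoeff_base (t i : ℕ) (hi : 1 ≤ i) :
    2 * oddCoeff t i ≤ evenCoeff (t + 1) i := by
  obtain ⟨i, rfl⟩ : ∃ k, i = k + 1 := ⟨i - 1, by omega⟩
  cases t with
  | zero =>
    rw [zero_add, evenCoeff_one, oddCoeff, pow_succ]
    have := add_one_le_two_pow i
    push_cast
    nlinarith [Nat.cast_nonneg (α := ℝ) i]
  | succ t =>
    obtain ⟨A, B, y, p, hy, hp, h1, h2, h3, hA, hA', hB, e1, o1, e2, o2, e3, o3, f1, f2⟩ :=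
      exists_factors t i
    rw [o1, e3]
    have h0 : 0 ≤ y * p := by positivity
    have h4 := mul_le_mul_of_nonneg_left hB (by linarith : 0 ≤ A)
    have h5 := mul_le_mul_of_nonneg_right hA' h0
    nlinarith

theorem oddCoeff_ge (t i : ℕ) : 2 ≤ oddCoeff t i := by
  cases t with
  | zero => rw [oddCoeff]; have := Nat.cast_nonneg (α := ℝ) i; linarith
  | succ t =>
    rw [oddCoeff]
    have h1 : (2 : ℝ) ≤ (2 * ((i : ℝ) + t + 2)) ^ (t + 2) := by
      have h0 : (4 : ℝ) ≤ 2 * ((i : ℝ) + t + 2) := by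
        have := Nat.cast_nonneg (α := ℝ) i
        have := Nat.cast_nonneg (α := ℝ) t
        linarith
      have := le_self_pow₀ (by linarith : 1 ≤ 2 * ((i : ℝ) + t + 2)) (by omega : t + 2 ≠ 0)
      linarith
    have h2 : (1 : ℝ) ≤ 2 ^ (i + t + 4).choose (t + 1) := one_le_pow₀ (by norm_num)
    nlinarith

theorem evenCoeff_ge (t i : ℕ) (hi : 1 ≤ i) : 6 ≤ evenCoeff (t + 1) i := by
  have h := evenCoeff_base t i hi
  cases t with
  | zero =>
    rw [oddCoeff] at h
    have : (1 : ℝ) ≤ i := by exact_mod_cast hi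
    linarith
  | succ t =>
    have h1 : (4 : ℝ) ≤ 2 * ((i : ℝ) + t + 2) := by
      have := Nat.cast_nonneg (α := ℝ) i
      have := Nat.cast_nonneg (α := ℝ) t
      linarith
    have h2 := le_self_pow₀ (by linarith : 1 ≤ 2 * ((i : ℝ) + t + 2)) (by omega : t + 2 ≠ 0)
    have h3 : (1 : ℝ) ≤ 2 ^ (i + t + 4).choose (t + 1) := one_le_pow₀ (by norm_num)
    rw [oddCoeff] at h
    nlinarith

theorem evenCoeff_nonneg (t i : ℕ) (hi : 1 ≤ i) : 0 ≤ evenCoeff t i := by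
  cases t with
  | zero => simp [evenCoeff]
  | succ t => linarith [evenCoeff_ge t i hi]

/-- For larger `t`, the subtracted term in `B - 3 * (y * p)` is chosen so that, multiplied by `A`,
it cancels twice the odd coefficient exactly. The product of `3 * p` with the rest covers the
subtracted power at `y + 2`. -/
theorem evenCoeff_step (t i : ℕ) :
    2 * oddCoeff t (i + 1) + evenCoeff t (i + 1) * (evenCoeff (t + 1) i - 2) ≤
      evenCoeff (t + 1) (i + 1) := by
  cases t with
  | zero =>
    rw [zero_add, evenCoeff_one, evenCoeff_one, oddCoeff, evenCoeff, pow_succ]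
    push_cast
    linarith [Nat.cast_nonneg (α := ℝ) i]
  | succ t =>
    obtain ⟨A, B, y, p, hy, hp, h1, h2, h3, hA, hA', hB, e1, o1, e2, o2, e3, o3, f1, f2⟩ :=
      exists_factors t i
    rw [o1, e1, e2, e3]
    have h0 : 0 ≤ y * p := by positivity
    have h36 : 36 ≤ y * p := by nlinarith
    have h4 : 2 ^ (t + 2) * (y * p) ≤ p * (y * p) := mul_le_mul_of_nonneg_right h1 h0
    have h5 : p * (y * p) ≤ p * (B - 3 * (y * p) - 2) :=
      mul_le_mul_of_nonneg_left (by linarith) (by linarith)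
    nlinarith

theorem oddCoeff_base (t i : ℕ) : 2 * evenCoeff (t + 1) i ≤ oddCoeff (t + 1) i := by
  rw [evenCoeff, oddCoeff]
  have h0 : (4 : ℝ) ≤ 2 * ((i : ℝ) + t + 2) := by
    have := Nat.cast_nonneg (α := ℝ) i
    have := Nat.cast_nonneg (α := ℝ) t
    linarith
  have h1 := le_self_pow₀ (by linarith : 1 ≤ 2 * ((i : ℝ) + t + 2)) (by omega : t + 2 ≠ 0)
  have h2 : (1 : ℝ) ≤ 2 ^ (i + t + 4).choose (t + 1) := one_le_pow₀ (by norm_num)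
  have h3 : 0 ≤ (2 * ((i : ℝ) + t + 2)) ^ (t + 1) := by positivity
  nlinarith

/-- For larger `t`, growing `y` by two adds at least `6 * (y * p)` to `y ^ 2 * p`. After the factor
`3 / 2` this is `9 * (y * p) * (A * B)`, of which the feathers take `6` and the even coefficient
fits in the rest. -/
theorem oddCoeff_step (t i : ℕ) :
    2 * evenCoeff (t + 1) (i + 1) + oddCoeff t (i + 1) * featherCoeff t i
      + evenCoeff t (i + 1) * oddCoeff (t + 1) i ≤ oddCoeff (t + 1) (i + 1) := by
  cases t with
  | zero =>
    rw [zero_add, evenCoeff_one, oddCoeff_one, oddCoeff_one, featherCoeff_zero, oddCoeff, evenCoeff,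
      pow_succ]
    have := one_le_pow₀ (n := i) (one_le_two (α := ℝ))
    have h0 := Nat.cast_nonneg (α := ℝ) i
    push_cast
    nlinarith [mul_nonneg h0 (by linarith : (0 : ℝ) ≤ 2 ^ i)]
  | succ t =>
    obtain ⟨A, B, y, p, hy, hp, h1, h2, h3, hA, hA', hB, e1, o1, e2, o2, e3, o3, f1, f2⟩ :=
      exists_factors t i
    rw [o1, e1, e3, o2, o3, f1]
    have h0 : 0 ≤ y * p := by positivity
    have h36 : 36 ≤ y * p := by nlinarith
    have hB0 : 0 ≤ B := by linarith
    have hAB : 0 ≤ A * B := by positivity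
    have h4 := mul_le_mul_of_nonneg_right h3 hAB
    have h5 := mul_le_mul_of_nonneg_right h36 hAB
    have h6 : 0 ≤ (y + 2) ^ (t + 2) := by positivity
    have h7 : 0 ≤ p * (y ^ 2 * p * B) := by positivity
    linarith

theorem featherCoeff_base (t i : ℕ) : 2 * evenCoeff (t + 1) i ≤ featherCoeff t i := by
  rw [evenCoeff, featherCoeff]
  have h2 : (1 : ℝ) ≤ 2 ^ (i + t + 4).choose (t + 1) := one_le_pow₀ (by norm_num)
  have h3 : 0 ≤ (2 * ((i : ℝ) + t + 2)) ^ (t + 1) := by positivity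
  linarith

theorem featherCoeff_ge (t i : ℕ) : 4 ≤ featherCoeff t i := by
  rw [featherCoeff]
  have h2 : (1 : ℝ) ≤ 2 ^ (i + t + 4).choose (t + 1) := one_le_pow₀ (by norm_num)
  linarith

/-- By Pascal's rule the power of two at least doubles from `i` to `i + 1`; half of the new
coefficient covers the even term and the other half the old coefficient. -/
theorem featherCoeff_step (t i : ℕ) :
    2 * evenCoeff (t + 1) (i + 1) + featherCoeff t i ≤ featherCoeff t (i + 1) := by
  rw [evenCoeff, featherCoeff, featherCoeff, show i + 1 + t + 4 = i + t + 4 + 1 by ring,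
    Nat.choose_succ_succ', pow_add]
  have h1 : (2 : ℝ) ≤ 2 ^ (i + t + 4).choose t :=
    le_self_pow₀ (by norm_num) (Nat.choose_pos (by omega)).ne'
  have h2 : (1 : ℝ) ≤ 2 ^ (i + t + 4).choose (t + 1) := one_le_pow₀ (by norm_num)
  have h3 : 0 ≤ (2 * (((i + 1 : ℕ) : ℝ) + t + 2)) ^ (t + 1) := by positivity
  nlinarith

end DavenportSchinzel

namespace DavenportSchinzel

/-! ### Comparison of the block and symbol coefficients -/

theorem evenBlockCoeff_nonneg (t i : ℕ) (hi : 1 ≤ i) : 0 ≤ evenBlockCoeff t i := by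
  cases t with
  | zero => simp [evenBlockCoeff]
  | succ t => exact evenCoeff_nonneg (t + 1) i hi

theorem evenBlockCoeff_le (t i : ℕ) : evenBlockCoeff t i ≤ evenCoeff t i := by
  cases t with
  | zero => norm_num [evenBlockCoeff, evenCoeff]
  | succ t => exact le_rfl

theorem oddBlockCoeff_nonneg (t i : ℕ) (hi : 1 ≤ i) : 0 ≤ oddBlockCoeff t i := by
  cases t with
  | zero =>
    have : (1 : ℝ) ≤ i := by exact_mod_cast hi
    rw [oddBlockCoeff]; linarith
  | succ t =>
    rw [show oddBlockCoeff (t + 1) i = oddCoeff (t + 1) i from rfl]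
    linarith [oddCoeff_ge (t + 1) i]

/-- The factor two is needed only for order three, where `3 * i - 2` eventually exceeds `2 * i + 2`.
-/
theorem oddBlockCoeff_le (t i : ℕ) : oddBlockCoeff t i ≤ 2 * oddCoeff t i := by
  cases t with
  | zero =>
    have := Nat.cast_nonneg (α := ℝ) i
    rw [oddBlockCoeff, oddCoeff]; linarith
  | succ t =>
    rw [show oddBlockCoeff (t + 1) i = oddCoeff (t + 1) i from rfl]
    linarith [oddCoeff_ge (t + 1) i]

/-! ### Closed forms -/

theorem lengthBound_one (M : ℕ) : LengthBound 1 M 1 1 := by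
  intro S hS _ hb
  have := length_le_of_isOrder_one S hS hb.1 hb.2
  have : ((S.flatten.length + 1 : ℕ) : ℝ) ≤ ((nsym S + S.length : ℕ) : ℝ) := Nat.cast_le.2 this
  push_cast at this
  linarith

theorem lengthBound_two (M : ℕ) : LengthBound 2 M 2 1 := by
  intro S hS _ hb
  have := length_le_of_isOrder_two S hS hb.1 hb.2
  have : ((S.flatten.length + 1 : ℕ) : ℝ) ≤ ((2 * nsym S + S.length : ℕ) : ℝ) := Nat.cast_le.2 this
  push_cast at this
  linarith

theorem ackermann_succ {i j : ℕ} (hi : 1 ≤ i) (hj : 1 ≤ j) : ackermann (i + 1) (j + 1) =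
    ackermann (i + 1) j * ackermann i (ackermann (i + 1) j) := by
  obtain ⟨i, rfl⟩ : ∃ k, i = k + 1 := ⟨i - 1, by omega⟩
  obtain ⟨j, rfl⟩ : ∃ k, j = k + 1 := ⟨j - 1, by omega⟩
  exact ackermann.eq_5 i j

/-- Induction along the recursion of Ackermann's function. -/
theorem ackermann_induction {c : ℕ} {p : ℕ → ℕ → ℝ → Prop}
    (base : ∀ i x : ℕ, 1 ≤ i → p i (2 ^ x) x)
    (step : ∀ i j w : ℕ, 1 ≤ i → 1 ≤ j → w = ackermann (i + 1) j → 2 ≤ w →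
      p (i + 1) (w ^ c) (c * j) → p i (ackermann i w ^ c) (c * w) →
      p (i + 1) (w ^ c * ackermann i w ^ c) (c * (j + 1 : ℕ)))
    {i j : ℕ} (hi : 1 ≤ i) (hj : 1 ≤ j) : p i (ackermann i j ^ c) (c * j) := by
  induction i, hi using Nat.le_induction generalizing j with
  | base =>
    rw [ackermann, ← pow_mul]
    -- Both boundary cases are powers of two: `(2 ^ j) ^ c` here, with exponent `c * j`, and `2 ^ c`
    -- for `j = 1` below.
    have := base 1 (j * c) le_rfl
    push_cast at this
    rwa [mul_comm (j : ℝ)] at this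
  | succ i hi ih =>
    induction j, hj using Nat.le_induction with
    | base =>
      obtain ⟨i, rfl⟩ : ∃ k, i = k + 1 := ⟨i - 1, by omega⟩
      rw [ackermann]
      simpa using base (i + 1 + 1) c (by omega)
    | succ j hj ihj =>
      -- The product splits into the interval length `w ^ c` and the number of intervals.
      rw [ackermann_succ hi hj, mul_pow]
      have hw : j + 1 ≤ ackermann (i + 1) j := le_ackermann (by omega) hj
      exact step i j _ hi hj rfl (by omega) ihj (ih (by omega))

theorem le_ackermann_pow {i j c : ℕ} (hi : 1 ≤ i) (hj : 1 ≤ j) :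
    ackermann (i + 1) j ^ c ≤ ackermann (i + 1) (j + 1) ^ c := by
  have h1 : j + 1 ≤ ackermann (i + 1) j := le_ackermann (by omega) hj
  have h2 : ackermann (i + 1) j + 1 ≤ ackermann i (ackermann (i + 1) j) :=
    le_ackermann hi (by omega)
  rw [ackermann_succ hi hj]
  exact Nat.pow_le_pow_left (Nat.le_mul_of_pos_right _ (by omega)) c

/-- The closed form for order `2 * t + 2`. -/
def EvenBound (t : ℕ) : Prop := ∀ i, 1 ≤ i →
  (∀ x : ℕ, LengthBound (2 * t + 2) (2 ^ x) (evenCoeff t i)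
    (evenBlockCoeff t i * (x : ℝ) ^ (2 * t))) ∧
  ∀ c j : ℕ, 2 * t ≤ c → 1 ≤ j → LengthBound (2 * t + 2) (ackermann i j ^ c) (evenCoeff t i)
    (evenBlockCoeff t i * ((c : ℝ) * j) ^ (2 * t))

/-- The closed form for order `2 * t + 3`. -/
def OddBound (t : ℕ) : Prop := ∀ i, 1 ≤ i →
  (∀ x : ℕ, LengthBound (2 * t + 3) (2 ^ x) (oddCoeff t i)
    (oddBlockCoeff t i * (x : ℝ) ^ (2 * t + 1))) ∧
  ∀ c j : ℕ, 2 * t + 1 ≤ c → 1 ≤ j → LengthBound (2 * t + 3) (ackermann i j ^ c) (oddCoeff t i)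
    (oddBlockCoeff t i * ((c : ℝ) * j) ^ (2 * t + 1))

theorem two_mul_le_mul_succ (c : ℕ) {j : ℕ} (hj : 1 ≤ j) :
    2 * (c : ℝ) ≤ c * (j + 1 : ℕ) := by
  have hj' : (1 : ℝ) ≤ j := by exact_mod_cast hj
  push_cast
  nlinarith [Nat.cast_nonneg (α := ℝ) c]

theorem mul_succ_sub (c j : ℕ) : (c : ℝ) * (j + 1 : ℕ) - c = c * j := by
  push_cast; ring

theorem evenBound_zero : EvenBound 0 := by
  have h : ∀ M i : ℕ, ∀ x : ℝ, LengthBound (2 * 0 + 2) M (evenCoeff 0 i)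
      (evenBlockCoeff 0 i * x ^ (2 * 0)) := by
    intro M i x
    simpa [evenCoeff, evenBlockCoeff] using lengthBound_two M
  exact fun i _ => ⟨fun x => h _ _ _, fun c j _ _ => h _ _ _⟩

theorem oddBound_zero : OddBound 0 := by
  have hbase : ∀ i x : ℕ, 1 ≤ i → LengthBound 3 (2 ^ x) (2 * i + 2) ((3 * i - 2) * (x : ℝ)) := by
    intro i x hi
    have hi' : (1 : ℝ) ≤ i := by exact_mod_cast hi
    have := lengthBound_two_pow (s := 2) (e := 0) (A := 2 * i + 2) (B := 3 * i - 2) (A₁ := 2)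
      (B₁ := 1) (fun x => by simpa using lengthBound_two (2 ^ x)) (by norm_num) (by linarith)
      (by norm_num) (by linarith) (by linarith) x
    simpa using this
  intro i hi
  constructor
  · intro x
    simpa [oddCoeff, oddBlockCoeff] using hbase i x hi
  · intro c j hc hj
    have := ackermann_induction (c := c)
      (p := fun i M X => LengthBound 3 M (2 * i + 2) ((3 * i - 2) * X)) hbase ?_ hi hj
    · simpa [oddCoeff, oddBlockCoeff] using this
    · intro i j w hi hj _ hw h₀ h'
      have hi' : (1 : ℝ) ≤ i := by exact_mod_cast hi
      refine lengthBound_three_step (by omega) (by omega) (two_mul_le_mul_succ c hj) ?_ ?_ ?_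
        (lengthBound_two _) (lengthBound_one _) ?_
      · push_cast; linarith
      · push_cast; linarith
      · rwa [mul_succ_sub]
      -- Raising `i` by one raises the coefficients by exactly the `2` and `3` that the step
      -- requires.
      · convert h' using 1
        · push_cast; ring
        · push_cast; ring

/-- The two lower orders are taken at the target pair `(i + 1, j + 1)`, which covers intervals of `w
^ c` blocks by `le_ackermann_pow`; the same order is used at `(i + 1, j)` and `(i, w)`. -/
theorem EvenBound.succ {t : ℕ} (hE : EvenBound t) (hO : OddBound t) : EvenBound (t + 1) := by
  have hbase : ∀ i x : ℕ, 1 ≤ i → LengthBound (2 * t + 4) (2 ^ x) (evenCoeff (t + 1) i)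
      (evenCoeff (t + 1) i * (x : ℝ) ^ (2 * t + 2)) := by
    intro i x hi
    have h1 := evenCoeff_base t i hi
    have h2 := oddBlockCoeff_le t i
    have h3 := evenCoeff_ge t i hi
    have h4 := oddCoeff_ge t i
    exact lengthBound_two_pow (hO i hi).1 (by linarith) (by linarith)
      (oddBlockCoeff_nonneg t i hi) h1 (by linarith) x
  intro i hi
  refine ⟨fun x => hbase i x hi, fun c j hc hj => ?_⟩
  refine ackermann_induction (c := c) (p := fun i M X => LengthBound (2 * t + 4) M
    (evenCoeff (t + 1) i) (evenCoeff (t + 1) i * X ^ (2 * t + 2))) hbase ?_ hi hj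
  intro i j w hi hj hwe hw h₀ h'
  have hle : w ^ c ≤ ackermann (i + 1) (j + 1) ^ c := hwe ▸ le_ackermann_pow hi hj
  have h1 := evenCoeff_step t i
  have h2 := oddBlockCoeff_le t (i + 1)
  have h3 := evenCoeff_ge t i hi
  have h4 := oddCoeff_ge t (i + 1)
  have h5 := evenBlockCoeff_le t (i + 1)
  have h6 := evenCoeff_nonneg t (i + 1) (by omega)
  have h7 := mul_nonneg h6 (by linarith : 0 ≤ evenCoeff (t + 1) i - 6)
  refine lengthBound_step (by omega) (by omega) (two_mul_le_mul_succ c hj)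
    (evenCoeff_nonneg _ _ (by omega)) (by linarith) (oddBlockCoeff_nonneg t (i + 1) (by omega)) h6
    (evenBlockCoeff_nonneg t (i + 1) (by omega)) (by linarith) ?_
    (((hO (i + 1) (by omega)).2 c (j + 1) (by omega) (by omega)).mono hle le_rfl le_rfl)
    (((hE (i + 1) (by omega)).2 c (j + 1) (by omega) (by omega)).mono hle le_rfl le_rfl)
    h' h1 (by linarith)
  rwa [mul_succ_sub]

/-- The closed form for the feathers of order `2 * t + 5`. -/
theorem EvenBound.featherBound {t : ℕ} (hE : EvenBound (t + 1)) : ∀ i, 1 ≤ i →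
    ∀ c j : ℕ, 2 * t + 3 ≤ c → 1 ≤ j → FeatherBound (2 * t + 5) (ackermann i j ^ c)
      (featherCoeff t i) (featherCoeff t i * ((c : ℝ) * j) ^ (2 * t + 3)) := by
  intro i hi c j hc hj
  refine ackermann_induction (c := c) (p := fun i M X => FeatherBound (2 * t + 5) M
    (featherCoeff t i) (featherCoeff t i * X ^ (2 * t + 3))) ?_ ?_ hi hj
  · intro i x hi
    exact featherBound_two_pow (hE i hi).1 (evenCoeff_nonneg (t + 1) i hi)
      (evenCoeff_nonneg (t + 1) i hi) (featherCoeff_base t i) (featherCoeff_base t i) x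
  · intro i j w hi hj hwe hw h₀ h'
    have hle : w ^ c ≤ ackermann (i + 1) (j + 1) ^ c := hwe ▸ le_ackermann_pow hi hj
    have h1 := featherCoeff_step t i
    have h2 := featherCoeff_ge t i
    have h3 := featherCoeff_ge t (i + 1)
    have h4 := evenCoeff_nonneg (t + 1) (i + 1) (by omega)
    refine featherBound_step (s := 2 * t + 1) (by omega) hw (by omega) (two_mul_le_mul_succ c hj)
      (by linarith) h4 h4 (by linarith) ?_
      (((hE (i + 1) (by omega)).2 c (j + 1) (by omega) (by omega)).mono hle le_rfl le_rfl)
      h' h1 (by linarith)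
    rwa [mul_succ_sub]

/-- The feather bound for this order follows from the even order just below, so it is already
available at `(i, w)` for the contracted sequence. -/
theorem OddBound.succ {t : ℕ} (hE : EvenBound t) (hO : OddBound t) (hE' : EvenBound (t + 1)) :
    OddBound (t + 1) := by
  have hbase : ∀ i x : ℕ, 1 ≤ i → LengthBound (2 * t + 5) (2 ^ x) (oddCoeff (t + 1) i)
      (oddCoeff (t + 1) i * (x : ℝ) ^ (2 * t + 3)) := by
    intro i x hi
    have h1 := oddCoeff_base t i
    have h2 := evenCoeff_nonneg (t + 1) i hi
    have h3 := oddCoeff_ge (t + 1) i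
    exact lengthBound_two_pow (hE' i hi).1 h2 (by linarith) h2 h1
      ((by linarith : evenCoeff (t + 1) i ≤ oddCoeff (t + 1) i)) x
  intro i hi
  refine ⟨fun x => hbase i x hi, fun c j hc hj => ?_⟩
  refine ackermann_induction (c := c) (p := fun i M X => LengthBound (2 * t + 5) M
    (oddCoeff (t + 1) i) (oddCoeff (t + 1) i * X ^ (2 * t + 3))) hbase ?_ hi hj
  intro i j w hi hj hwe hw h₀ h'
  have hle : w ^ c ≤ ackermann (i + 1) (j + 1) ^ c := hwe ▸ le_ackermann_pow hi hj
  have hw1 : 1 ≤ w := by omega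
  have h1 := oddCoeff_step t i
  have h2 := oddBlockCoeff_le t (i + 1)
  have h3 := oddCoeff_ge t (i + 1)
  have h4 := oddCoeff_ge (t + 1) i
  have h4' := oddCoeff_ge (t + 1) (i + 1)
  have h5 := evenBlockCoeff_le t (i + 1)
  have h6 := evenCoeff_nonneg t (i + 1) (by omega)
  have h7 := evenCoeff_nonneg (t + 1) (i + 1) (by omega)
  have h8 := featherCoeff_ge t i
  have h9 := mul_nonneg (by linarith : 0 ≤ oddCoeff t (i + 1)) (by linarith : 0 ≤ featherCoeff t i - 4)
  have h10 := mul_nonneg h6 (by linarith : 0 ≤ oddCoeff (t + 1) i - 2)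
  refine lengthBound_odd_step hw1 (even_two_mul t) (by omega) (two_mul_le_mul_succ c hj)
    (by linarith) h7 h7 (by linarith) (oddBlockCoeff_nonneg t (i + 1) (by omega)) h6
    (evenBlockCoeff_nonneg t (i + 1) (by omega)) (by linarith)
    (by linarith : 0 ≤ featherCoeff t i) ?_
    (((hE' (i + 1) (by omega)).2 c (j + 1) (by omega) (by omega)).mono hle le_rfl le_rfl)
    (((hO (i + 1) (by omega)).2 c (j + 1) (by omega) (by omega)).mono hle le_rfl le_rfl)
    (((hE (i + 1) (by omega)).2 c (j + 1) (by omega) (by omega)).mono hle le_rfl le_rfl)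
    h' (hE'.featherBound i hi c w (by omega) (by omega)) h1 (by linarith)
  rwa [mul_succ_sub]

theorem evenBound_and_oddBound (t : ℕ) : EvenBound t ∧ OddBound t := by
  induction t with
  | zero => exact ⟨evenBound_zero, oddBound_zero⟩
  | succ t ih =>
    have h := ih.1.succ ih.2
    exact ⟨h, .succ ih.1 ih.2 h⟩

/-! ### Bounds for the extremal functions -/

theorem LengthBound.lam_le {s M n m : ℕ} {A B : ℝ} (h : LengthBound s M A B) (hs : 1 ≤ s)
    (hm : 1 ≤ m) (hM : m ≤ M) (hA : 0 ≤ A) (hB : 0 ≤ B) :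
    (lam s n m : ℝ) ≤ A * n + B * (m - 1) := by
  obtain ⟨S, ⟨h1, h2, h3, h4⟩, h5⟩ := exists_lam_eq n hs hm
  have hm' : (1 : ℝ) ≤ m := by exact_mod_cast hm
  rw [h5]
  -- The linear bounds assume a block; the sequence of no blocks has to be allowed separately.
  by_cases hS : S = []
  · subst hS
    have : 0 ≤ B * ((m : ℝ) - 1) := mul_nonneg hB (by linarith)
    simp only [List.flatten_nil, List.length_nil, Nat.cast_zero]
    positivity
  · have := h S hS (h1.trans hM) ⟨h2, h3⟩
    rw [nsym, h4] at this
    refine this.trans (add_le_add le_rfl (mul_le_mul_of_nonneg_left ?_ hB))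
    have : (S.length : ℝ) ≤ m := by exact_mod_cast h1
    linarith

theorem FeatherBound.Phi_le {s M n m : ℕ} {A B : ℝ} (h : FeatherBound s M A B) (hs : 1 ≤ s)
    (hm : 1 ≤ m) (hM : m ≤ M) (hA : 0 ≤ A) (hB : 0 ≤ B) :
    (Phi s n m : ℝ) ≤ A * n + B * (m - 1) := by
  obtain ⟨S, ⟨h1, h2, h3, h4⟩, h5⟩ := (isGreatest_Phi n hs hm).1
  have hm' : (1 : ℝ) ≤ m := by exact_mod_cast hm
  -- Any derivation tree bounds the minimum, so the one built by the recurrence suffices.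
  have hmin : ∀ T, IsDerivationTree S T → minFeathers S ≤ featherCount S T :=
    fun T hT => Nat.sInf_le ⟨T, hT, rfl⟩
  have hR : 0 ≤ B * ((m : ℝ) - 1) := mul_nonneg hB (by linarith)
  rw [h5]
  by_cases hS : S = []
  · subst hS
    have h0 := hmin _ (.base [] (by simp))
    have h6 : minFeathers ([] : List (List ℕ)) = 0 := Nat.le_zero.1 (h0.trans (by simp [featherCount]))
    rw [h6, Nat.cast_zero]
    positivity
  · obtain ⟨T, hT, hle⟩ := h S hS (h1.trans hM) ⟨h2, h3⟩
    rw [nsym, h4] at hle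
    refine (Nat.cast_le.2 (hmin T hT)).trans (hle.trans ?_)
    refine add_le_add le_rfl (mul_le_mul_of_nonneg_left ?_ hB)
    have : (S.length : ℝ) ≤ m := by exact_mod_cast h1
    linarith

theorem lam_three_le {n m i c : ℕ} (hm : 1 ≤ m) (hi : 1 ≤ i) (hc : 1 ≤ c) :
    (lam 3 n m : ℝ) ≤ (2 * i + 2) * n + (3 * i - 2) * c * ackIndex i c m * (m - 1) := by
  obtain ⟨hj, hM⟩ := (isLeast_ackIndex m hi hc).1
  have h := ((evenBound_and_oddBound 0).2 i hi).2 c _ (by omega) hj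
  have hb := oddBlockCoeff_nonneg 0 i hi
  refine (h.lam_le (n := n) (by norm_num) hm hM (by linarith [oddCoeff_ge 0 i])
    (mul_nonneg hb (by positivity))).trans (le_of_eq ?_)
  simp only [oddCoeff, oddBlockCoeff]
  ring

theorem lam_le {n m s i c : ℕ} (hm : 1 ≤ m) (hs : 4 ≤ s) (hi : 1 ≤ i) (hc : s - 2 ≤ c) :
    (lam s n m : ℝ) ≤ mu s i * (n + ((c : ℝ) * ackIndex i c m) ^ (s - 2) * (m - 1)) := by
  obtain ⟨hj, hM⟩ := (isLeast_ackIndex m hi (by omega : 1 ≤ c)).1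
  obtain ⟨t, rfl | rfl⟩ : ∃ t, s = 2 * t + 4 ∨ s = 2 * t + 5 := ⟨(s - 4) / 2, by omega⟩
  · have h := ((evenBound_and_oddBound (t + 1)).1 i hi).2 c _ (by omega) hj
    have hA := evenCoeff_nonneg (t + 1) i hi
    refine (h.lam_le (n := n) (by omega) hm hM hA (mul_nonneg hA (by positivity))).trans
      (le_of_eq ?_)
    rw [mu_even, show 2 * t + 4 - 2 = 2 * (t + 1) by omega, evenBlockCoeff]
    ring
  · have h := ((evenBound_and_oddBound (t + 1)).2 i hi).2 c _ (by omega) hj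
    have hA : 0 ≤ oddCoeff (t + 1) i := by linarith [oddCoeff_ge (t + 1) i]
    refine (h.lam_le (n := n) (by omega) hm hM hA (mul_nonneg hA (by positivity))).trans
      (le_of_eq ?_)
    rw [mu_odd, show 2 * t + 5 - 2 = 2 * (t + 1) + 1 by omega, oddBlockCoeff]
    ring

theorem Phi_le {n m s i c : ℕ} (hm : 1 ≤ m) (hs : 5 ≤ s) (hodd : Odd s) (hi : 1 ≤ i)
    (hc : s - 2 ≤ c) :
    (Phi s n m : ℝ) ≤ nu s i * (n + ((c : ℝ) * ackIndex i c m) ^ (s - 2) * (m - 1)) := by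
  obtain ⟨hj, hM⟩ := (isLeast_ackIndex m hi (by omega : 1 ≤ c)).1
  obtain ⟨t, rfl⟩ : ∃ t, s = 2 * t + 5 := by
    obtain ⟨k, rfl⟩ := hodd
    exact ⟨k - 2, by omega⟩
  have h := (evenBound_and_oddBound (t + 1)).1.featherBound i hi c _ (by omega) hj
  have hA : 0 ≤ featherCoeff t i := by linarith [featherCoeff_ge t i]
  refine (h.Phi_le (n := n) (by omega) hm hM hA (mul_nonneg hA (by positivity))).trans
    (le_of_eq ?_)
  rw [nu_odd, show 2 * t + 5 - 2 = 2 * t + 3 by omega]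
  ring

end DavenportSchinzel

/-! ### The main theorem -/

theorem mainTheorem5 (n m : ℕ) (hm : 1 ≤ m) :
    (1 ≤ n → (lam 1 n m : ℝ) = n + m - 1) ∧
    (1 ≤ n → (lam 2 n m : ℝ) ≤ 2 * n + m - 2) ∧
    (1 ≤ n → 2 ≤ m → (lam 2 n m : ℝ) = 2 * n + m - 2) ∧
    (∀ i c : ℕ, 1 ≤ i → 1 ≤ c →
      (lam 3 n m : ℝ) ≤ (2 * i + 2) * n + (3 * i - 2) * c * ackIndex i c m * (m - 1)) ∧
    (∀ s i c : ℕ, 4 ≤ s → 1 ≤ i → s - 2 ≤ c →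
      (lam s n m : ℝ) ≤ mu s i * (n + ((c : ℝ) * ackIndex i c m) ^ (s - 2) * (m - 1))) ∧
    (∀ s i c : ℕ, 5 ≤ s → Odd s → 1 ≤ i → s - 2 ≤ c →
      (Phi s n m : ℝ) ≤ nu s i * (n + ((c : ℝ) * ackIndex i c m) ^ (s - 2) * (m - 1))) := by
  refine ⟨fun hn => ?_, fun hn => ?_, fun hn h2 => ?_, fun i c hi hc => lam_three_le hm hi hc,
    fun s i c hs hi hc => lam_le hm hs hi hc, fun s i c hs ho hi hc => Phi_le hm hs ho hi hc⟩
  · have h : ((lam 1 n m + 1 : ℕ) : ℝ) = ((n + m : ℕ) : ℝ) := by rw [lam_one hn hm]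
    push_cast at h; linarith
  · have h : ((lam 2 n m + 2 : ℕ) : ℝ) ≤ ((2 * n + m : ℕ) : ℝ) := Nat.cast_le.2 (lam_two_le hn hm)
    push_cast at h; linarith
  · have h : ((lam 2 n m + 2 : ℕ) : ℝ) = ((2 * n + m : ℕ) : ℝ) := by rw [lam_two hn h2]
    push_cast at h; linarith
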